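/- Let $X$ be a smooth Riemannian manifold (Hausdorff, second countable, without boundary, of dimension $n$, not necessarily complete or connected), and let $K\subseteq X$ be a compact smooth submanifold of $X$ of the same dimension $n$, possibly with boundary. Put $X'=X\setminus K$ with the induced Riemannian metric. Let $d\colon C_c^\infty(X)\to C^\infty(X,\Lambda^1)$ be a linear differential operator of order one with smooth coefficients, from complex-valued functions to complex-valued $1$-forms, whose principal symbol is injective away from the zero section of the cotangent bundle: for all $x\in X$ and all real covectors $0\neq\xi\in T_x^*X$, the map $\sigma(x,\xi)\colon\mathbb{C}\to T_x^*X\otimes\mathbb{C}$ is injective. For $Y\in\{X,X'\}$, the operator $d$ with domain $C_c^\infty(Y)$ is closable as an operator from $L^2(Y)$ to $L^2(Y,\Lambda^1)$; let $d_Y$ be its closure and $\Delta_Y:=d_Y^*d_Y$, with its natural domain $\{f\in\mathcal{D}(d_Y)\mid d_Yf\in\mathcal{D}(d_Y^*)\}$. Then $d^*d$ is defined on $C_c^\infty(Y)$, $\Delta_Y$ is the Friedrichs extension of the operator $d^*d$ acting on $C_c^\infty(Y)$, and $$\sigma_{\mathrm{ess}}(\Delta_X)=\sigma_{\mathrm{ess}}(\Delta_{X'}),$$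 where $\sigma_{\mathrm{ess}}(T)$ is the set of all $z\in\mathbb{C}$ such that $T-z$ is not a Fredholm operator (finite-dimensional kernel, closed range of finite codimension). -/

import Mathlib

open Bundle Manifold MeasureTheory Set
open scoped ContDiff Topology ENNReal

set_option linter.unusedSectionVars false

noncomputable section

namespace RiemannianCut

/-- The model space `ℝⁿ`. -/
abbrev Model (n : ℕ) : Type := EuclideanSpace ℝ (Fin n)

section HilbertSpaceOperators

/-- The composition `g ∘ f` of two partially defined operators, on its natural domain
`{x ∈ dom f | f x ∈ dom g}`. -/
def compose {E F G : Type*} [AddCommGroup E] [Module ℂ E] [AddCommGroup F] [Module ℂ F]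
    [AddCommGroup G] [Module ℂ G] (g : F →ₗ.[ℂ] G) (f : E →ₗ.[ℂ] F) : E →ₗ.[ℂ] G :=
  ⟨(g.domain.comap f.toFun).map f.domain.subtype,
    { toFun := fun x => g ⟨f ⟨x.1, by obtain ⟨y, -, hy⟩ := x.2; rw [← hy]; exact y.2⟩, by
        obtain ⟨x, y, hy, rfl⟩ := x; exact hy⟩
      map_add' := fun x y => by
        rw [← g.map_add]; congr 1; ext1; exact f.map_add ⟨x.1, _⟩ ⟨y.1, _⟩
      map_smul' := fun c x => by
        rw [RingHom.id_apply, ← g.map_smul]; congr 1; ext1; exact f.map_smul c ⟨x.1, _⟩ }⟩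

variable {H : Type*} [NormedAddCommGroup H] [InnerProductSpace ℂ H]

/-- The operator `T - z`, with the domain of `T`. -/
def subScalar (T : H →ₗ.[ℂ] H) (z : ℂ) : T.domain →ₗ[ℂ] H := T.toFun - z • T.domain.subtype

/-- The essential spectrum of an unbounded (self-adjoint) operator `T`: the set of all `z` such
that `T - z` is not a Fredholm operator. An operator is Fredholm if its kernel is
finite-dimensional and its range is closed and of finite codimension. -/
def essSpectrum (T : H →ₗ.[ℂ] H) : Set ℂ :=
  {z | ¬ (FiniteDimensional ℂ (LinearMap.ker (subScalar T z)) ∧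
    IsClosed (LinearMap.range (subScalar T z) : Set H) ∧
    FiniteDimensional ℂ (H ⧸ LinearMap.range (subScalar T z)))}

/-- The form domain of a nonnegative symmetric operator `S`: the completion of `dom S` with
respect to the norm whose square is `⟪S φ, φ⟫ + ‖φ‖²`, realised inside `H`. It consists of the
limits in `H` of sequences of `dom S` which are Cauchy with respect to that norm. -/
def formDomain (S : H →ₗ.[ℂ] H) : Set H :=
  {f | ∃ φ : ℕ → S.domain, Filter.Tendsto (fun k => (φ k : H)) Filter.atTop (𝓝 f) ∧
    ∀ ε : ℝ, 0 < ε → ∃ N, ∀ j ≥ N, ∀ k ≥ N,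
      (inner ℂ (S (φ j - φ k)) ((φ j - φ k : S.domain) : H)).re < ε}

/-- `T` is the Friedrichs extension of the densely defined nonnegative symmetric operator `S`:
the domain of `T` consists of those `f` in the form domain of `S` for which `g ↦ ⟪S g, f⟫` is
represented by some vector `u`, and then `T f = u`. -/
structure IsFriedrichsExtension (S T : H →ₗ.[ℂ] H) : Prop where
  dense : Dense (S.domain : Set H)
  symmetric : ∀ f g : S.domain, inner ℂ (S f) (g : H) = inner ℂ (f : H) (S g)
  nonneg : ∀ f : S.domain, 0 ≤ (inner ℂ (S f) (f : H)).re
  mem_graph_iff : ∀ f u : H, (f, u) ∈ T.graph ↔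
    f ∈ formDomain S ∧ ∀ g : S.domain, inner ℂ (S g) f = inner ℂ (g : H) u

end HilbertSpaceOperators

section Smooth

variable (n : ℕ) (X : Type*) [TopologicalSpace X] [ChartedSpace (Model n) X]

/-- The tangent space at `x`. -/
abbrev Tan (x : X) : Type := TangentSpace (𝓡 n) x

/-- The complexified cotangent space at `x`: real-linear maps `T_x X → ℂ`. -/
abbrev CCot (x : X) : Type := Tan n X x →L[ℝ] ℂ

instance cCotAddCommGroup (x : X) : AddCommGroup (CCot n X x) :=
  ContinuousLinearMap.addCommGroup

instance cCotModule (x : X) : Module ℂ (CCot n X x) := ContinuousLinearMap.module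

variable {n X}

/-- A subset of `X` is a smooth submanifold (with possibly empty boundary) of the same dimension as
`X` if near each of its points it is either all of `X` or, in a suitable smooth chart, a half-space
`{y | 0 ≤ y i}`. -/
def IsCodimZeroSubmanifold (n : ℕ) {X : Type*} [TopologicalSpace X] [ChartedSpace (Model n) X]
    (K : Set X) : Prop :=
  ∀ x ∈ K, x ∈ interior K ∨
    ∃ φ ∈ IsManifold.maximalAtlas (𝓡 n) ∞ X, x ∈ φ.source ∧
      ∃ i : Fin n, ∀ y ∈ φ.source, y ∈ K ↔ 0 ≤ φ y i

/-- The real covector `ξ`, seen as a complex covector. -/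
def complexify {V : Type*} [AddCommGroup V] [Module ℝ V] [TopologicalSpace V]
    (ξ : V →L[ℝ] ℝ) : V →L[ℝ] ℂ :=
  Complex.ofRealCLM.comp ξ

/-- The space `C_c^∞(U)` of smooth complex functions with compact support contained in the open set
`U`, extended by zero to `X`. -/
def testFunctions (n : ℕ) {X : Type*} [TopologicalSpace X] [ChartedSpace (Model n) X]
    (U : TopologicalSpace.Opens X) : Submodule ℂ (X → ℂ) where
  carrier := {u | ContMDiff (𝓡 n) 𝓘(ℝ, ℂ) ∞ u ∧ HasCompactSupport u ∧ tsupport u ⊆ U}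
  zero_mem' := by
    refine ⟨contMDiff_const, HasCompactSupport.zero, ?_⟩
    simp [tsupport]
  add_mem' := by
    rintro u v ⟨hu, hu', hu''⟩ ⟨hv, hv', hv''⟩
    exact ⟨hu.add hv, hu'.add hv', (tsupport_add u v).trans (union_subset hu'' hv'')⟩
  smul_mem' := by
    rintro c u ⟨hu, hu', hu''⟩
    refine ⟨(contDiff_const_smul c).contMDiff.comp hu, hu'.mono' ?_ , (closure_mono ?_).trans hu''⟩
    · exact (Function.support_const_smul_subset c u).trans subset_closure
    · exact Function.support_const_smul_subset c u

/-- The differential `du` of a complex function `u`, as a complex `1`-form. -/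
def diff (n : ℕ) {X : Type*} [TopologicalSpace X] [ChartedSpace (Model n) X]
    (u : X → ℂ) (x : X) : CCot n X x := mfderiv (𝓡 n) 𝓘(ℝ, ℂ) u x

theorem diff_eq_zero {u : X → ℂ} {x : X} (h : x ∉ tsupport u) : diff n u x = 0 := by
  have h0 : u =ᶠ[𝓝 x] fun _ => (0 : ℂ) := notMem_tsupport_iff_eventuallyEq.1 h
  exact (h0.mfderiv_eq (I := 𝓡 n) (I' := 𝓘(ℝ, ℂ))).trans mfderiv_const

theorem diff_add {u v : X → ℂ} (hu : ContMDiff (𝓡 n) 𝓘(ℝ, ℂ) ∞ u) (hv : ContMDiff (𝓡 n) 𝓘(ℝ, ℂ) ∞ v)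
    (x : X) : diff n (u + v) x = diff n u x + diff n v x :=
  mfderiv_add (hu.mdifferentiableAt (by simp)) (hv.mdifferentiableAt (by simp))

theorem diff_smul (c : ℂ) {u : X → ℂ} (hu : ContMDiff (𝓡 n) 𝓘(ℝ, ℂ) ∞ u) (x : X) :
    diff n (c • u) x = c • diff n u x := by
  have h1 : MDifferentiableAt (𝓡 n) 𝓘(ℝ, ℂ) u x := hu.mdifferentiableAt (by simp)
  have h2 := ((c • ContinuousLinearMap.id ℝ ℂ).hasMFDerivAt (x := u x)).comp x h1.hasMFDerivAt
  exact h2.mfderiv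

variable [IsManifold (𝓡 n) ∞ X]

/-- A complex `1`-form is smooth if it is a smooth section of the bundle `Hom(TX, ℂ)`. -/
def IsSmoothForm (α : ∀ x : X, CCot n X x) : Prop :=
  ContMDiff (𝓡 n) ((𝓡 n).prod 𝓘(ℝ, Model n →L[ℝ] ℂ)) ∞
    (fun x => TotalSpace.mk' (Model n →L[ℝ] ℂ)
      (E := fun x : X => TangentSpace (𝓡 n) x →L[ℝ] Bundle.Trivial X ℂ x) x (α x))

theorem IsSmoothForm.add {α η : ∀ x : X, CCot n X x} (hα : IsSmoothForm α) (hη : IsSmoothForm η) :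
    IsSmoothForm (α + η) := ContMDiff.add_section hα hη

theorem IsSmoothForm.smul {α : ∀ x : X, CCot n X x} (c : ℂ) (hα : IsSmoothForm α) :
    IsSmoothForm (c • α) := by
  intro x
  have h := hα x
  rw [contMDiffAt_hom_bundle] at h ⊢
  refine ⟨h.1, ?_⟩
  have hc : ContDiff ℝ ∞ (fun y : Model n →L[ℝ] ℂ => c • y) := contDiff_const_smul c
  have h2 := hc.contMDiff.contMDiffAt.comp x h.2
  refine h2.congr_of_eventuallyEq (Filter.Eventually.of_forall fun y => ?_)
  ext v
  simp [ContinuousLinearMap.inCoordinates]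

/-- A linear differential operator of order one from complex functions to complex `1`-forms on `X`:
`D u = σ(du) + u b` where `σ`, the principal symbol (extended complex-linearly to complex
covectors), is an endomorphism of the complexified cotangent bundle and `b` is a complex `1`-form.
The smoothness of the coefficients `σ`, `b` is expressed by the fact that `D` maps smooth compactly
supported functions to smooth `1`-forms. -/
structure FirstOrderOperator (n : ℕ) (X : Type*) [TopologicalSpace X] [ChartedSpace (Model n) X]
    [IsManifold (𝓡 n) ∞ X] where
  symbol : ∀ x : X, CCot n X x →ₗ[ℂ] CCot n X x
  potential : ∀ x : X, CCot n X x
  smooth : ∀ u ∈ testFunctions n (⊤ : TopologicalSpace.Opens X),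
    IsSmoothForm fun x => symbol x (diff n u x) + u x • potential x

/-- The principal symbol of `D` is injective away from the zero section of the cotangent bundle:
for every nonzero real covector `ξ` at `x`, the symbol `σ(x, ξ) : ℂ → Λ¹_x ⊗ ℂ` is injective. -/
def FirstOrderOperator.HasInjectiveSymbol (D : FirstOrderOperator n X) : Prop :=
  ∀ (x : X) (ξ : Tan n X x →L[ℝ] ℝ), ξ ≠ 0 →
    Function.Injective fun z : ℂ => z • D.symbol x (complexify ξ)

end Smooth

section LinAlg

theorem gram_left_inv {V : Type*} [NormedAddCommGroup V] [InnerProductSpace ℝ V]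
    {ι κ : Type*} [Fintype ι] [Fintype κ] [DecidableEq κ] (b : OrthonormalBasis ι ℝ V)
    (f : Module.Basis κ ℝ V) :
    ((Matrix.of fun i k => f.repr (b i) k : Matrix ι κ ℝ).transpose *
      (Matrix.of fun i k => f.repr (b i) k : Matrix ι κ ℝ)) *
      (Matrix.of fun k l => inner ℝ (f k) (f l) : Matrix κ κ ℝ) = 1 := by
  have h1 : (Matrix.of fun i k => f.repr (b i) k : Matrix ι κ ℝ) *
      (Matrix.of fun k l => inner ℝ (f k) (f l) : Matrix κ κ ℝ) =
      Matrix.of fun i m => inner ℝ (b i) (f m) := by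
    ext i m
    simp only [Matrix.mul_apply, Matrix.of_apply]
    conv_rhs => rw [← f.sum_repr (b i), sum_inner]
    simp [real_inner_smul_left]
  rw [Matrix.mul_assoc, h1]
  ext k m
  simp only [Matrix.mul_apply, Matrix.transpose_apply, Matrix.of_apply]
  have h2 := congrArg (fun v => f.repr v k) (b.sum_repr' (f m))
  simp only [map_sum, map_smul, Finsupp.coe_finsetSum, Finset.sum_apply, Finsupp.smul_apply,
    smul_eq_mul, Module.Basis.repr_self] at h2
  rw [Matrix.one_apply, Finset.sum_congr rfl fun i _ => mul_comm _ _, h2, Finsupp.single_apply]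
  simp only [eq_comm]

theorem sum_orthonormal_eq_gram {V : Type*} [NormedAddCommGroup V] [InnerProductSpace ℝ V]
    {ι κ : Type*} [Fintype ι] [Fintype κ] [DecidableEq κ] (b : OrthonormalBasis ι ℝ V)
    (f : Module.Basis κ ℝ V) (α β : V →ₗ[ℝ] ℂ) :
    ∑ i, starRingEnd ℂ (α (b i)) * β (b i) =
      ∑ k, ∑ l, (((Matrix.of fun k l => inner ℝ (f k) (f l) : Matrix κ κ ℝ)⁻¹ k l : ℝ) : ℂ) *
        (starRingEnd ℂ (α (f k)) * β (f l)) := by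
  rw [Matrix.inv_eq_left_inv (gram_left_inv b f)]
  have hα : ∀ (γ : V →ₗ[ℝ] ℂ) i, γ (b i) = ∑ k, (f.repr (b i) k : ℂ) * γ (f k) := by
    intro γ i
    conv_lhs => rw [← f.sum_repr (b i), map_sum]
    simp
  have h1 : ∀ i, starRingEnd ℂ (α (b i)) * β (b i) = ∑ k, ∑ l,
      ((f.repr (b i) k : ℂ) * starRingEnd ℂ (α (f k))) * ((f.repr (b i) l : ℂ) * β (f l)) := by
    intro i
    rw [hα α, hα β, map_sum, Finset.sum_mul_sum]
    simp only [map_mul, Complex.conj_ofReal]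
  simp only [h1, Matrix.mul_apply, Matrix.transpose_apply, Matrix.of_apply, Complex.ofReal_sum,
    Complex.ofReal_mul, Finset.sum_mul]
  rw [Finset.sum_comm]
  refine Finset.sum_congr rfl fun k _ => ?_
  rw [Finset.sum_comm]
  refine Finset.sum_congr rfl fun l _ => Finset.sum_congr rfl fun i _ => ?_
  ring

end LinAlg

section Metric

variable {n : ℕ} {X : Type*} [TopologicalSpace X] [ChartedSpace (Model n) X]
  [IsManifold (𝓡 n) ∞ X]

instance tangentSpace_finiteDimensional (x : X) : FiniteDimensional ℝ (TangentSpace (𝓡 n) x) :=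
  inferInstanceAs (FiniteDimensional ℝ (Model n))

theorem symmL_eq_coord (c : X) {p : Model n} (hp : p ∈ (chartAt (Model n) c).target) (v : Model n) :
    (trivializationAt (Model n) (TangentSpace (𝓡 n)) c).symmL ℝ ((chartAt (Model n) c).symm p) v =
      mfderiv (𝓡 n) (𝓡 n) (chartAt (Model n) c).symm p v := by
  have e : ∀ q, q = p → (mfderiv (𝓡 n) (𝓡 n) (chartAt (Model n) c).symm q : Model n →L[ℝ] Model n) =
      mfderiv (𝓡 n) (𝓡 n) (chartAt (Model n) c).symm p := by rintro _ rfl; rfl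
  rw [TangentBundle.symmL_trivializationAt (I := 𝓡 n) ((chartAt (Model n) c).map_target hp)]
  have := e _ ((chartAt (Model n) c).right_inv hp)
  have h2 := congrArg (fun L : Model n →L[ℝ] Model n => L v) this
  simp only [mfld_simps, mfderivWithin_univ]
  exact h2

variable [RiemannianBundle (fun x : X => TangentSpace (𝓡 n) x)]

/-- The `i`-th coordinate vector field `∂_i` of the preferred chart at `c`, at the point with
coordinates `p`. -/
def coordVec (c : X) (p : Model n) (i : Fin n) : TangentSpace (𝓡 n) ((chartAt (Model n) c).symm p) :=
  mfderiv (𝓡 n) (𝓡 n) (chartAt (Model n) c).symm p (EuclideanSpace.single i (1 : ℝ))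

/-- The matrix `g_ij = ⟨∂_i, ∂_j⟩` of the metric in the preferred chart at `c`. -/
def gram (c : X) (p : Model n) : Matrix (Fin n) (Fin n) ℝ :=
  Matrix.of fun i j => inner ℝ (coordVec c p i) (coordVec c p j)

/-- The Riemannian density `√(det g_ij)` in the preferred chart at `c`. -/
def density (c : X) (p : Model n) : ℝ := Real.sqrt (gram c p).det

theorem density_change (c c' : X) {p : Model n} (hp : p ∈ (chartAt (Model n) c).target)
    (hp' : (chartAt (Model n) c).symm p ∈ (chartAt (Model n) c').source) :
    ∃ J : Model n →L[ℝ] Model n,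
      HasFDerivAt (chartAt (Model n) c' ∘ (chartAt (Model n) c).symm) J p ∧
      density c p = |J.det| * density c' (chartAt (Model n) c' ((chartAt (Model n) c).symm p)) := by
  set φ := chartAt (Model n) c
  set ψ := chartAt (Model n) c'
  have h1 : MDifferentiableAt (𝓡 n) (𝓡 n) φ.symm p :=
    mdifferentiableAt_atlas_symm (chart_mem_atlas (Model n) c) hp
  have h2 : MDifferentiableAt (𝓡 n) (𝓡 n) ψ (φ.symm p) :=
    mdifferentiableAt_atlas (chart_mem_atlas (Model n) c') hp'
  have h3 : MDifferentiableAt (𝓡 n) (𝓡 n) (ψ ∘ φ.symm) p := h2.comp p h1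
  have h4 : MDifferentiableAt (𝓡 n) (𝓡 n) ψ.symm ((ψ ∘ φ.symm) p) :=
    mdifferentiableAt_atlas_symm (chart_mem_atlas (Model n) c') (ψ.map_source hp')
  have h5 : φ.symm =ᶠ[𝓝 p] ψ.symm ∘ (ψ ∘ φ.symm) := by
    have : ∀ᶠ q in 𝓝 p, φ.symm q ∈ ψ.source :=
      (φ.continuousAt_symm hp).eventually (ψ.open_source.mem_nhds hp')
    filter_upwards [this] with q hq
    exact (ψ.left_inv hq).symm
  let J : Model n →L[ℝ] Model n := fderiv ℝ (ψ ∘ φ.symm) p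
  let D : Model n →L[ℝ] Model n := mfderiv (𝓡 n) (𝓡 n) φ.symm p
  let D' : Model n →L[ℝ] Model n := mfderiv (𝓡 n) (𝓡 n) ψ.symm (ψ (φ.symm p))
  have h6 : D = D'.comp J := by
    have := h5.mfderiv_eq (I := 𝓡 n) (I' := 𝓡 n)
    have h7 := mfderiv_comp p h4 h3
    have h8 : (mfderiv (𝓡 n) (𝓡 n) (ψ ∘ φ.symm) p : Model n →L[ℝ] Model n) = J :=
      mfderiv_eq_fderiv
    have h9 : D = D'.comp (mfderiv (𝓡 n) (𝓡 n) (ψ ∘ φ.symm) p : Model n →L[ℝ] Model n) :=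
      this.trans h7
    exact h9.trans (congrArg (fun L : Model n →L[ℝ] Model n => D'.comp L) h8)
  refine ⟨J, h3.differentiableAt.hasFDerivAt, ?_⟩
  let g : X → Model n → Model n → ℝ := fun x v w =>
    @inner ℝ (TangentSpace (𝓡 n) x) _ v w
  let b := EuclideanSpace.basisFun (Fin n) ℝ
  let M := LinearMap.toMatrix b.toBasis b.toBasis (J : Model n →ₗ[ℝ] Model n)
  have hgram : gram c p = M.transpose * gram c' (ψ (φ.symm p)) * M := by
    have hg : ∀ i j, gram c p i j = g (φ.symm p) (D (b i)) (D (b j)) := by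
      intro i j
      simp only [b, EuclideanSpace.basisFun_apply]
      rfl
    have hg' : ∀ i j, gram c' (ψ (φ.symm p)) i j = g (φ.symm p) (D' (b i)) (D' (b j)) := by
      intro i j
      have e : gram c' (ψ (φ.symm p)) i j =
          g (ψ.symm (ψ (φ.symm p))) (D' (b i)) (D' (b j)) := by
        simp only [b, EuclideanSpace.basisFun_apply]
        rfl
      rw [e, ψ.left_inv hp']
    have hD : ∀ i, D (b i) = ∑ k, M k i • D' (b k) := by
      intro i
      rw [h6, ContinuousLinearMap.comp_apply]
      conv_lhs => rw [← b.toBasis.sum_repr (J (b i)), map_sum]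
      refine Finset.sum_congr rfl fun k _ => ?_
      rw [map_smul]
      simp [M, LinearMap.toMatrix_apply]
    have hgs : ∀ x (a a' : Fin n → ℝ) (v : Fin n → Model n),
        g x (∑ k, a k • v k) (∑ l, a' l • v l) = ∑ k, ∑ l, a k * g x (v k) (v l) * a' l := by
      intro x a a' v
      have := sum_inner (𝕜 := ℝ) (E := TangentSpace (𝓡 n) x) Finset.univ (fun k => a k • v k)
        (∑ l, a' l • v l)
      refine this.trans (Finset.sum_congr rfl fun k _ => ?_)
      refine (inner_sum (𝕜 := ℝ) (E := TangentSpace (𝓡 n) x) Finset.univ (fun k => a' k • v k)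
        (a k • v k)).trans (Finset.sum_congr rfl fun l _ => ?_)
      refine (real_inner_smul_left (F := TangentSpace (𝓡 n) x) _ _ _).trans ?_
      rw [mul_assoc]
      congr 1
      refine (real_inner_smul_right (F := TangentSpace (𝓡 n) x) _ _ _).trans ?_
      rw [mul_comm]
    ext i j
    rw [hg, hD, hD, hgs, Matrix.mul_apply]
    simp only [Matrix.mul_apply, Matrix.transpose_apply, hg', Finset.sum_mul]
    exact Finset.sum_comm
  have hdet : M.det = J.det := LinearMap.det_toMatrix b.toBasis _
  rw [density, density, hgram, Matrix.det_mul, Matrix.det_mul, Matrix.det_transpose, hdet, mul_comm, ← mul_assoc,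
    Real.sqrt_mul (mul_self_nonneg _), Real.sqrt_mul_self_eq_abs]

theorem density_pos (c : X) {p : Model n} (hp : p ∈ (chartAt (Model n) c).target) :
    0 < density c p := by
  let e := trivializationAt (Model n) (TangentSpace (𝓡 n) : X → Type _) c
  have hx : (chartAt (Model n) c).symm p ∈ e.baseSet := by
    simpa [e] using (chartAt (Model n) c).map_target hp
  let b := (EuclideanSpace.basisFun (Fin n) ℝ).toBasis
  have hv : ∀ i, coordVec c p i = e.basisAt b hx i := by
    intro i
    have h1 := symmL_eq_coord c hp (EuclideanSpace.single i (1 : ℝ))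
    rw [Trivialization.symmL_apply _ hx] at h1
    rw [coordVec, ← h1]
    simp [Bundle.Trivialization.basisAt, b]
  have hG : gram c p = Matrix.of fun i j => inner ℝ (e.basisAt b hx i) (e.basisAt b hx j) := by
    ext i j
    simp only [gram, Matrix.of_apply, hv]
  have h0 : (gram c p).det ≠ 0 := by
    rw [hG]
    exact Matrix.det_ne_zero_of_left_inverse
      (gram_left_inv (stdOrthonormalBasis ℝ (TangentSpace (𝓡 n) ((chartAt (Model n) c).symm p))) _)
  have h1 : 0 ≤ (gram c p).det :=
    (Matrix.posSemidef_gram ℝ (coordVec c p)).det_nonneg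
  exact Real.sqrt_pos.2 (lt_of_le_of_ne h1 h0.symm)

section Continuity

variable [IsContMDiffRiemannianBundle (𝓡 n) ∞ (Model n) (fun x : X => TangentSpace (𝓡 n) x)]

theorem gram_continuousOn (c : X) (i j : Fin n) :
    ContinuousOn (fun p => gram c p i j) (chartAt (Model n) c).target := by
  have key : ∀ v : Model n, ContMDiffOn (𝓡 n) (𝓡 n).tangent ∞ (fun x : X => (TotalSpace.mk' (Model n) x
      ((trivializationAt (Model n) (TangentSpace (𝓡 n)) c).symmL ℝ x v) : TangentBundle (𝓡 n) X)) (chartAt (Model n) c).source := by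
    intro v
    have h := ((trivializationAt (Model n) (TangentSpace (𝓡 n)) c).contMDiffOn_section_baseSet_iff (IB := 𝓡 n) (n := ∞) (s := fun x : X => ((trivializationAt (Model n) (TangentSpace (𝓡 n)) c).symmL ℝ x v))).2 ?_
    · simpa using h
    · refine (contMDiffOn_const (c := v)).congr fun x hx => ?_
      rw [Trivialization.symmL_apply _ hx]
      exact congrArg Prod.snd (Trivialization.apply_mk_symm _ hx v)
  have h1 := ((key (EuclideanSpace.single i (1 : ℝ))).inner_bundle (key (EuclideanSpace.single j (1 : ℝ)))).continuousOn
  have h2 := h1.comp (chartAt (Model n) c).continuousOn_symm (chartAt (Model n) c).mapsTo_symm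
  refine h2.congr fun p hp => ?_
  have h3 := (chartAt (Model n) c).map_target hp
  simp only [gram, Matrix.of_apply, coordVec, Function.comp]
  rw [symmL_eq_coord c hp, symmL_eq_coord c hp]

theorem density_continuousOn (c : X) :
    ContinuousOn (density c) (chartAt (Model n) c).target := by
  have h : ContinuousOn (gram c) (chartAt (Model n) c).target :=
    continuousOn_pi.2 fun i => continuousOn_pi.2 fun j => gram_continuousOn c i j
  exact (Continuous.matrix_det continuous_id).comp_continuousOn h |>.sqrt

end Continuity

variable [MeasurableSpace X]

/-- The Riemannian volume of the domain of the preferred chart at `c`: the image under the inverse chart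
of the measure `√(det g_ij) dx`. -/
def chartVolume (c : X) : Measure X :=
  ((volume.restrict (chartAt (Model n) c).target).withDensity
    fun p => ENNReal.ofReal (density c p)).map (chartAt (Model n) c).symm

/-- The Riemannian volume measure of `X`. The measures `chartVolume c` agree on the overlaps of the
charts, and the volume is their supremum, that is, the measure which equals `√(det g_ij) dx` in
each chart. -/
def riemannianVolume (n : ℕ) (X : Type*) [TopologicalSpace X] [ChartedSpace (Model n) X]
    [RiemannianBundle (fun x : X => TangentSpace (𝓡 n) x)] [MeasurableSpace X] : Measure X :=
  ⨆ c : X, chartVolume (n := n) c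

theorem measurableSet_chart [BorelSpace X] (c : X) {A : Set X} (hA : MeasurableSet A) :
    MeasurableSet ((chartAt (Model n) c).target ∩ (chartAt (Model n) c).symm ⁻¹' A) := by
  have h := (chartAt (Model n) c).continuousOn_symm.domRestrict.measurable hA
  have h2 := (chartAt (Model n) c).open_target.measurableSet.subtype_image h
  convert h2 using 1
  ext p
  simp [and_comm]

theorem chartVolume_apply [BorelSpace X] (c : X) {A : Set X} (hA : MeasurableSet A) :
    chartVolume (n := n) c A = ∫⁻ p in (chartAt (Model n) c).target ∩ (chartAt (Model n) c).symm ⁻¹' A,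
      ENNReal.ofReal (density c p) := by
  have h : AEMeasurable (chartAt (Model n) c).symm ((volume.restrict (chartAt (Model n) c).target).withDensity
    fun p => ENNReal.ofReal (density c p)) :=
    ((chartAt (Model n) c).continuousOn_symm.aemeasurable
      (chartAt (Model n) c).open_target.measurableSet).mono_ac (withDensity_absolutelyContinuous _ _)
  rw [chartVolume, Measure.map_apply_of_aemeasurable h hA, withDensity_apply', 
    Measure.restrict_restrict' (chartAt (Model n) c).open_target.measurableSet, inter_comm]

theorem chartVolume_eq [BorelSpace X] (c c' : X) {A : Set X} (hA : MeasurableSet A)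
    (hc : A ⊆ (chartAt (Model n) c).source) (hc' : A ⊆ (chartAt (Model n) c').source) :
    chartVolume (n := n) c A = chartVolume (n := n) c' A := by
  rw [chartVolume_apply c hA, chartVolume_apply c' hA]
  set φ := chartAt (Model n) c
  set ψ := chartAt (Model n) c'
  have him : ψ.target ∩ ψ.symm ⁻¹' A = (ψ ∘ φ.symm) '' (φ.target ∩ φ.symm ⁻¹' A) := by
    ext q
    constructor
    · rintro ⟨hq, hqA⟩
      refine ⟨φ (ψ.symm q), ⟨φ.map_source (hc hqA), ?_⟩, ?_⟩
      · simpa [φ.left_inv (hc hqA)] using hqA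
      · simp [φ.left_inv (hc hqA), ψ.right_inv hq]
    · rintro ⟨p, ⟨hp, hpA⟩, rfl⟩
      refine ⟨ψ.map_source (hc' hpA), ?_⟩
      simpa [ψ.left_inv (hc' hpA)] using hpA
  have hJ := fun (p : Model n) (hp : p ∈ φ.target ∩ φ.symm ⁻¹' A) => density_change c c' hp.1 (hc' hp.2)
  classical
  let J : Model n → Model n →L[ℝ] Model n := fun p => if hp : p ∈ φ.target ∩ φ.symm ⁻¹' A then (hJ p hp).choose else 0
  have hJ1 : ∀ p ∈ φ.target ∩ φ.symm ⁻¹' A, HasFDerivAt (ψ ∘ φ.symm) (J p) p ∧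
      density c p = |(J p).det| * density c' (ψ (φ.symm p)) := by
    intro p hp
    simp only [J, dif_pos hp]
    exact (hJ p hp).choose_spec
  rw [him, lintegral_image_eq_lintegral_abs_det_fderiv_mul volume (measurableSet_chart c hA)
    (fun p hp => (hJ1 p hp).1.hasFDerivWithinAt)]
  · refine setLIntegral_congr_fun (measurableSet_chart c hA) fun p hp => ?_
    rw [(hJ1 p hp).2, ENNReal.ofReal_mul (abs_nonneg _)]
    rfl
  · rintro p ⟨hp, hpA⟩ q ⟨hq, hqA⟩ hpq
    have := ψ.injOn (hc' hpA) (hc' hqA) hpq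
    exact φ.symm.injOn hp hq this

theorem chartVolume_compl [BorelSpace X] (c : X) :
    chartVolume (n := n) c (chartAt (Model n) c).sourceᶜ = 0 := by
  rw [chartVolume_apply c (chartAt (Model n) c).open_source.measurableSet.compl]
  have : (chartAt (Model n) c).target ∩ (chartAt (Model n) c).symm ⁻¹' (chartAt (Model n) c).sourceᶜ = ∅ := by
    ext p
    simp only [mem_inter_iff, mem_preimage, mem_compl_iff, mem_empty_iff_false, iff_false, not_and, not_not]
    exact fun hp => (chartAt (Model n) c).map_target hp
  rw [this, Measure.restrict_empty, lintegral_zero_measure]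

/-- The Riemannian volume is given by `√(det g_ij) dx` in each preferred chart. -/
theorem riemannianVolume_apply_of_subset_source [BorelSpace X] (c : X) {A : Set X} (hA : MeasurableSet A)
    (hc : A ⊆ (chartAt (Model n) c).source) :
    riemannianVolume n X A = chartVolume (n := n) c A := by
  refine le_antisymm ?_ ((le_iSup (fun c : X => chartVolume (n := n) c) c) A)
  set S := (chartAt (Model n) c).source
  have hS : MeasurableSet S := (chartAt (Model n) c).open_source.measurableSet
  let ν : Measure X := chartVolume (n := n) c + (⊤ : Measure X).restrict Sᶜ
  have hle : riemannianVolume n X ≤ ν := by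
    refine iSup_le fun c' => Measure.le_iff.2 fun B hB => ?_
    rw [← measure_inter_add_sdiff B hS]
    have h1 : chartVolume (n := n) c' (B ∩ S) ≤ chartVolume (n := n) c B := by
      set S' := (chartAt (Model n) c').source
      have hS' : MeasurableSet S' := (chartAt (Model n) c').open_source.measurableSet
      rw [← measure_inter_add_sdiff (B ∩ S) hS']
      have h2 : chartVolume (n := n) c' ((B ∩ S) \ S') = 0 :=
        measure_mono_null (fun x hx => hx.2) (chartVolume_compl c')
      rw [h2, add_zero, chartVolume_eq c' c ((hB.inter hS).inter hS') (fun x hx => hx.2) (fun x hx => hx.1.2)]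
      exact measure_mono fun x hx => hx.1.1
    have h3 : chartVolume (n := n) c' (B \ S) ≤ (⊤ : Measure X).restrict Sᶜ B := by
      rw [Measure.restrict_apply hB]
      exact (le_top : chartVolume (n := n) c' ≤ ⊤) _
    exact add_le_add h1 h3
  refine (hle A).trans ?_
  have : (⊤ : Measure X).restrict Sᶜ A = 0 := by
    rw [Measure.restrict_apply hA, show A ∩ Sᶜ = ∅ from by
      ext x; simp only [mem_inter_iff, mem_compl_iff, mem_empty_iff_false, iff_false, not_and, not_not]; exact fun h => hc h, measure_empty]
  simp [ν, this]

variable [IsContMDiffRiemannianBundle (𝓡 n) ∞ (Model n) (fun x : X => TangentSpace (𝓡 n) x)]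

theorem chartVolume_finiteAt [BorelSpace X] (c : X) :
    ∃ s ∈ 𝓝 c, s ⊆ (chartAt (Model n) c).source ∧ MeasurableSet s ∧
      chartVolume (n := n) c s < ⊤ := by
  set φ := chartAt (Model n) c with hφ
  have hc : φ c ∈ φ.target := φ.map_source (mem_chart_source _ c)
  have h1 : ContinuousAt (density c) (φ c) :=
    (density_continuousOn c).continuousAt (φ.open_target.mem_nhds hc)
  have h2 : ∀ᶠ p in 𝓝 (φ c), density c p < density c (φ c) + 1 :=
    h1.eventually (gt_mem_nhds (lt_add_one _))
  obtain ⟨r, hr, hball⟩ := Metric.eventually_nhds_iff_ball.1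
    (h2.and (φ.open_target.mem_nhds hc))
  refine ⟨φ.source ∩ φ ⁻¹' Metric.ball (φ c) r, ?_, inter_subset_left, ?_, ?_⟩
  · exact (φ.isOpen_inter_preimage Metric.isOpen_ball).mem_nhds
      ⟨mem_chart_source _ c, Metric.mem_ball_self hr⟩
  · exact (φ.isOpen_inter_preimage Metric.isOpen_ball).measurableSet
  · rw [chartVolume_apply c (φ.isOpen_inter_preimage Metric.isOpen_ball).measurableSet]
    calc _ ≤ ∫⁻ p in Metric.ball (φ c) r, ENNReal.ofReal (density c p) := by
            refine lintegral_mono_set ?_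
            rintro p ⟨hp, hp1, hp2⟩
            simpa [← hφ, φ.right_inv hp] using hp2
      _ ≤ ∫⁻ p in Metric.ball (φ c) r, ENNReal.ofReal (density c (φ c) + 1) :=
            setLIntegral_mono' measurableSet_ball fun p hp =>
              ENNReal.ofReal_le_ofReal (hball p hp).1.le
      _ < ⊤ := by
            rw [setLIntegral_const]
            exact ENNReal.mul_lt_top ENNReal.ofReal_lt_top measure_ball_lt_top

instance riemannianVolume_isLocallyFinite [BorelSpace X] : IsLocallyFiniteMeasure (riemannianVolume n X) where
  finiteAtNhds x := by
    obtain ⟨s, hs, hsub, hm, hlt⟩ := chartVolume_finiteAt (n := n) x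
    exact ⟨s, hs, by rwa [riemannianVolume_apply_of_subset_source x hm hsub]⟩

instance riemannianVolume_isOpenPos [BorelSpace X] :
    Measure.IsOpenPosMeasure (riemannianVolume n X) where
  open_pos V hV hne := by
    obtain ⟨c, hc⟩ := hne
    set φ := chartAt (Model n) c
    have hle := (le_iSup (fun c : X => chartVolume (n := n) c) c) V
    refine ne_of_gt (lt_of_lt_of_le ?_ hle)
    rw [chartVolume_apply c hV.measurableSet]
    have ho : IsOpen (φ.target ∩ φ.symm ⁻¹' V) := φ.isOpen_inter_preimage_symm hV
    have hpos : 0 < volume (φ.target ∩ φ.symm ⁻¹' V) :=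
      ho.measure_pos volume ⟨φ c, φ.map_source (mem_chart_source _ c), by
        rw [mem_preimage, φ.left_inv (mem_chart_source _ c)]; exact hc⟩
    refine pos_iff_ne_zero.2 fun h0 => hpos.ne' ?_
    have hm : AEMeasurable (fun p => ENNReal.ofReal (density c p))
        (volume.restrict (φ.target ∩ φ.symm ⁻¹' V)) :=
      (((density_continuousOn c).mono inter_subset_left).aemeasurable ho.measurableSet).ennreal_ofReal
    rw [lintegral_eq_zero_iff' hm] at h0
    have h1 := (ae_restrict_iff' ho.measurableSet).1 h0
    have h2 : φ.target ∩ φ.symm ⁻¹' V ⊆ {p | ¬ (p ∈ φ.target ∩ φ.symm ⁻¹' V →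
        ENNReal.ofReal (density c p) = (0 : Model n → ℝ≥0∞) p)} := by
      intro p hp h3
      have h4 := h3 hp
      rw [Pi.zero_apply, ENNReal.ofReal_eq_zero] at h4
      exact absurd (density_pos c hp.1) (not_lt.2 h4)
    exact measure_mono_null h2 (ae_iff.1 h1)

end Metric

section CotangentMetric

variable {n : ℕ} {X : Type*} [TopologicalSpace X] [ChartedSpace (Model n) X]
  [IsManifold (𝓡 n) ∞ X]
  [RiemannianBundle (fun x : X => TangentSpace (𝓡 n) x)]

/-- The Hermitian inner product of complex covectors induced by the Riemannian metric:
`∑ i, conj (α (e i)) * β (e i)` for an orthonormal basis `e` of the tangent space (the value does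
not depend on the basis). -/
def cotInner (x : X) (α β : CCot n X x) : ℂ :=
  ∑ i, starRingEnd ℂ (α (stdOrthonormalBasis ℝ (TangentSpace (𝓡 n) x) i)) *
    β (stdOrthonormalBasis ℝ (TangentSpace (𝓡 n) x) i)

variable [IsContMDiffRiemannianBundle (𝓡 n) ∞ (Model n) (fun x : X => TangentSpace (𝓡 n) x)]

theorem cotInner_continuous {α β : ∀ x : X, CCot n X x} (hα : IsSmoothForm α) (hβ : IsSmoothForm β) :
    Continuous fun x => cotInner x (α x) (β x) := by
  rw [continuous_iff_continuousAt]
  intro x₀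
  let e := trivializationAt (Model n) (TangentSpace (𝓡 n) : X → Type _) x₀
  have hx₀ : x₀ ∈ e.baseSet := FiberBundle.mem_baseSet_trivializationAt' x₀
  let b := (EuclideanSpace.basisFun (Fin n) ℝ).toBasis
  let G : X → Matrix (Fin n) (Fin n) ℝ := fun x => Matrix.of fun i j =>
    inner ℝ (e.localFrame b i x) (e.localFrame b j x)
  have hG : ContinuousAt G x₀ := by
    refine continuousAt_pi.2 fun i => continuousAt_pi.2 fun j => ?_
    exact (ContMDiffAt.inner_bundle (contMDiffAt_localFrame_of_mem (I := 𝓡 n) (n := ∞) e b i hx₀)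
      (contMDiffAt_localFrame_of_mem (I := 𝓡 n) (n := ∞) e b j hx₀)).continuousAt
  have hdet : (G x₀).det ≠ 0 := by
    have h := gram_left_inv (stdOrthonormalBasis ℝ (TangentSpace (𝓡 n) x₀)) (e.basisAt b hx₀)
    have h2 : G x₀ = Matrix.of fun i j => inner ℝ (e.basisAt b hx₀ i) (e.basisAt b hx₀ j) := by
      simp only [G, e.localFrame_apply_of_mem_baseSet b hx₀]
    rw [h2]
    exact Matrix.det_ne_zero_of_left_inverse h
  have hGi : ContinuousAt (fun x => (G x)⁻¹) x₀ := by
    simp only [Matrix.inv_def, Ring.inverse_eq_inv']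
    exact ((Continuous.matrix_det continuous_id).continuousAt.comp hG |>.inv₀ hdet).smul
      ((Continuous.matrix_adjugate continuous_id).continuousAt.comp hG)
  have hev : ∀ {γ : ∀ x : X, CCot n X x}, IsSmoothForm γ → ∀ i,
      ContinuousAt (fun x => γ x (e.localFrame b i x)) x₀ := by
    intro γ hγ i
    have h := ContMDiffAt.clm_bundle_apply (hγ x₀) (contMDiffAt_localFrame_of_mem (I := 𝓡 n) (n := ∞) e b i hx₀)
    exact ((Bundle.contMDiffAt_section _).1 h).continuousAt
  have hform : (fun x => cotInner x (α x) (β x)) =ᶠ[𝓝 x₀] fun x => ∑ k, ∑ l, (((G x)⁻¹ k l : ℝ) : ℂ) *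
        (starRingEnd ℂ (α x (e.localFrame b k x)) * β x (e.localFrame b l x)) := by
    filter_upwards [e.open_baseSet.mem_nhds hx₀] with x hx
    have := sum_orthonormal_eq_gram (stdOrthonormalBasis ℝ (TangentSpace (𝓡 n) x)) (e.basisAt b hx)
      (α x : TangentSpace (𝓡 n) x →ₗ[ℝ] ℂ) (β x : TangentSpace (𝓡 n) x →ₗ[ℝ] ℂ)
    simp only [cotInner, G, e.localFrame_apply_of_mem_baseSet b hx]
    exact this
  refine ContinuousAt.congr ?_ hform.symm
  refine tendsto_finsetSum _ fun k _ => tendsto_finsetSum _ fun l _ => ?_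
  have h1 : ContinuousAt (fun x => (G x)⁻¹ k l) x₀ := continuousAt_pi.1 (continuousAt_pi.1 hGi k) l
  exact (Complex.continuous_ofReal.continuousAt.comp h1).mul
    ((Complex.continuous_conj.continuousAt.comp (hev hα k)).mul (hev hβ l))

end CotangentMetric

section Laplacian

variable {n : ℕ} {X : Type*} [TopologicalSpace X] [ChartedSpace (Model n) X]
  [IsManifold (𝓡 n) ∞ X]

/-- The space of smooth complex `1`-forms with compact support contained in the open set `U`. -/
def testForms (n : ℕ) {X : Type*} [TopologicalSpace X] [ChartedSpace (Model n) X]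
    [IsManifold (𝓡 n) ∞ X] (U : TopologicalSpace.Opens X) : Submodule ℂ (∀ x : X, CCot n X x) where
  carrier := {α | IsSmoothForm α ∧ IsCompact (closure {x | α x ≠ 0}) ∧ closure {x | α x ≠ 0} ⊆ U}
  zero_mem' := by
    refine ⟨Bundle.contMDiff_zeroSection ℝ (E := fun x : X => TangentSpace (𝓡 n) x →L[ℝ] Bundle.Trivial X ℂ x), ?_, ?_⟩ <;> simp
  add_mem' := by
    rintro α β ⟨hα, hα', hα''⟩ ⟨hβ, hβ', hβ''⟩
    have h : closure {x | (α + β) x ≠ 0} ⊆ closure {x | α x ≠ 0} ∪ closure {x | β x ≠ 0} := by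
      rw [← closure_union]
      refine closure_mono fun x hx => ?_
      by_contra h
      simp only [mem_union, mem_ofPred_eq, not_or, not_not] at h
      exact hx (by simp [h.1, h.2])
    exact ⟨hα.add hβ, (hα'.union hβ').of_isClosed_subset isClosed_closure h,
      h.trans (union_subset hα'' hβ'')⟩
  smul_mem' := by
    rintro c α ⟨hα, hα', hα''⟩
    have h : closure {x | (c • α) x ≠ 0} ⊆ closure {x | α x ≠ 0} :=
      closure_mono fun x hx h0 => hx (by rw [Pi.smul_apply, h0, smul_zero])
    exact ⟨hα.smul c, hα'.of_isClosed_subset isClosed_closure h, h.trans hα''⟩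

/-- The space of smooth compactly supported `1`-forms in `U`, to be endowed with the `L²` inner
product. -/
def TestForm (n : ℕ) {X : Type*} [TopologicalSpace X] [ChartedSpace (Model n) X]
    [IsManifold (𝓡 n) ∞ X] (U : TopologicalSpace.Opens X) : Type _ := testForms n U

instance testFormAddCommGroup (U : TopologicalSpace.Opens X) : AddCommGroup (TestForm n U) :=
  inferInstanceAs (AddCommGroup (testForms n U))

instance testFormModule (U : TopologicalSpace.Opens X) : Module ℂ (TestForm n U) :=
  inferInstanceAs (Module ℂ (testForms n U))

variable [RiemannianBundle (fun x : X => TangentSpace (𝓡 n) x)]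
  [IsContMDiffRiemannianBundle (𝓡 n) ∞ (Model n) (fun x : X => TangentSpace (𝓡 n) x)]
  [MeasurableSpace X] [BorelSpace X]

theorem cotInner_support {U : TopologicalSpace.Opens X} (α β : TestForm n U) :
    HasCompactSupport fun x => cotInner x (α.1 x) (β.1 x) := by
  refine α.2.2.1.of_isClosed_subset isClosed_closure (closure_mono fun x hx h0 => hx ?_)
  simp [cotInner, h0]

theorem cotInner_integrable {U : TopologicalSpace.Opens X} (α β : TestForm n U) :
    Integrable (fun x => cotInner x (α.1 x) (β.1 x)) (riemannianVolume n X) :=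
  (cotInner_continuous α.2.1 β.2.1).integrable_of_hasCompactSupport (cotInner_support α β)

/-- The `L²` inner product `∫ ⟨α, β⟩ dvol` on smooth compactly supported `1`-forms. -/
@[reducible]
def formCore (U : TopologicalSpace.Opens X) : PreInnerProductSpace.Core ℂ (TestForm n U) where
  inner α β := ∫ x, cotInner x (α.1 x) (β.1 x) ∂(riemannianVolume n X)
  conj_inner_symm α β := by
    rw [← integral_conj]
    refine integral_congr_ae (Filter.Eventually.of_forall fun x => ?_)
    simp [cotInner, mul_comm]
  re_inner_nonneg α := by
    have h : ∀ x, cotInner x (α.1 x) (α.1 x) =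
        ((∑ i, ‖α.1 x (stdOrthonormalBasis ℝ (TangentSpace (𝓡 n) x) i)‖ ^ 2 : ℝ) : ℂ) := by
      intro x
      simp [cotInner, Complex.conj_mul']
    simp only [h]
    rw [integral_complex_ofReal]
    exact integral_nonneg fun x => Finset.sum_nonneg fun i _ => sq_nonneg _
  add_left α β γ := by
    rw [← integral_add (cotInner_integrable α γ) (cotInner_integrable β γ)]
    refine integral_congr_ae (Filter.Eventually.of_forall fun x => ?_)
    change cotInner x (α.1 x + β.1 x) (γ.1 x) = _
    simp [cotInner, add_mul, Finset.sum_add_distrib]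
  smul_left α β c := by
    rw [← integral_const_mul]
    refine integral_congr_ae (Filter.Eventually.of_forall fun x => ?_)
    change cotInner x (c • α.1 x) (β.1 x) = _
    simp [cotInner, mul_assoc, Finset.mul_sum]

instance testFormSeminormedAddCommGroup (U : TopologicalSpace.Opens X) : SeminormedAddCommGroup (TestForm n U) :=
  InnerProductSpace.Core.toSeminormedAddCommGroup (c := formCore U)

instance testFormInnerProductSpace (U : TopologicalSpace.Opens X) : InnerProductSpace ℂ (TestForm n U) :=
  InnerProductSpace.ofCore (formCore U)

/-- The Hilbert space `L²(U, Λ¹)`: the completion of the space of smooth compactly supported complex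
`1`-forms in `U` with respect to the `L²` inner product. -/
abbrev L2Form (n : ℕ) {X : Type*} [TopologicalSpace X] [ChartedSpace (Model n) X]
    [IsManifold (𝓡 n) ∞ X] [RiemannianBundle (fun x : X => TangentSpace (𝓡 n) x)]
    [IsContMDiffRiemannianBundle (𝓡 n) ∞ (Model n) (fun x : X => TangentSpace (𝓡 n) x)]
    [MeasurableSpace X] [BorelSpace X] (U : TopologicalSpace.Opens X) : Type _ :=
  UniformSpace.Completion (TestForm n U)

/-- The Hilbert space `L²(U)` of complex functions on `U`, for the Riemannian volume. -/
abbrev L2Fun (n : ℕ) {X : Type*} [TopologicalSpace X] [ChartedSpace (Model n) X]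
    [RiemannianBundle (fun x : X => TangentSpace (𝓡 n) x)]
    [MeasurableSpace X] (U : TopologicalSpace.Opens X) : Type _ :=
  Lp ℂ 2 ((riemannianVolume n X).restrict (U : Set X))

theorem testFunction_memLp {U : TopologicalSpace.Opens X} (u : testFunctions n U) :
    MemLp u.1 2 ((riemannianVolume n X).restrict (U : Set X)) :=
  (u.2.1.continuous.memLp_of_hasCompactSupport u.2.2.1).restrict _

/-- The map `C_c^∞(U) → L²(U)`. -/
def testToL2 (U : TopologicalSpace.Opens X) : testFunctions n U →ₗ[ℂ] L2Fun n U where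
  toFun u := (testFunction_memLp u).toLp u.1
  map_add' _ _ := rfl
  map_smul' _ _ := rfl

theorem testToL2_injective (U : TopologicalSpace.Opens X) :
    Function.Injective (testToL2 (n := n) U) := by
  rw [injective_iff_map_eq_zero]
  intro u hu
  have h0 : (testToL2 (n := n) U u : X → ℂ) =ᵐ[(riemannianVolume n X).restrict (U : Set X)] 0 := by
    rw [hu]
    exact Lp.coeFn_zero _ _ _
  have h1 : u.1 =ᵐ[(riemannianVolume n X).restrict (U : Set X)] 0 :=
    (testFunction_memLp u).coeFn_toLp.symm.trans h0
  have ho : IsOpen {x | u.1 x ≠ 0} := isOpen_ne_fun u.2.1.continuous continuous_const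
  have h2 : riemannianVolume n X {x | u.1 x ≠ 0} = 0 := by
    have h3 : ∀ᵐ x ∂(riemannianVolume n X), x ∈ (U : Set X) → u.1 x = 0 :=
      (ae_restrict_iff' U.isOpen.measurableSet).1 h1
    refine measure_mono_null ?_ (ae_iff.1 h3)
    intro x hx h4
    exact hx (h4 (u.2.2.2 (subset_tsupport _ hx)))
  refine Subtype.ext (funext fun x => ?_)
  by_contra hx
  exact ho.measure_ne_zero (riemannianVolume n X) ⟨x, hx⟩ h2

namespace FirstOrderOperator

variable (D : FirstOrderOperator n X)

/-- The `1`-form `D u = σ(du) + u b`. -/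
def toForm (u : X → ℂ) (x : X) : CCot n X x :=
  D.symbol x (diff n u x) + u x • D.potential x

/-- `D` as a linear map from smooth compactly supported functions to smooth compactly supported
`1`-forms. -/
def onTest (U : TopologicalSpace.Opens X) : testFunctions n U →ₗ[ℂ] TestForm n U where
  toFun u := ⟨D.toForm u.1, by
    have hsub : closure {x | D.toForm u.1 x ≠ 0} ⊆ tsupport u.1 := by
      refine closure_minimal (fun x hx => ?_) (isClosed_tsupport _)
      by_contra h
      refine hx ?_
      rw [toForm, diff_eq_zero h, image_eq_zero_of_notMem_tsupport h, map_zero, zero_smul, add_zero]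
    exact ⟨D.smooth u.1 ⟨u.2.1, u.2.2.1, subset_univ _⟩,
      u.2.2.1.of_isClosed_subset isClosed_closure hsub, hsub.trans u.2.2.2⟩⟩
  map_add' u v := by
    refine Subtype.ext (funext fun x => ?_)
    change D.symbol x (diff n (u.1 + v.1) x) + (u.1 x + v.1 x) • D.potential x =
      D.toForm u.1 x + D.toForm v.1 x
    rw [diff_add u.2.1 v.2.1, map_add, add_smul, toForm, toForm]
    abel
  map_smul' c u := by
    refine Subtype.ext (funext fun x => ?_)
    change D.symbol x (diff n (c • u.1) x) + (c * u.1 x) • D.potential x = c • D.toForm u.1 x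
    rw [diff_smul c u.2.1, map_smul, mul_smul, toForm, smul_add]

/-- `D` as an unbounded operator from `L²(U)` to `L²(U, Λ¹)` with domain `C_c^∞(U)`, mapping the
class of `u` to `D u`. -/
def minimal (U : TopologicalSpace.Opens X) : L2Fun n U →ₗ.[ℂ] L2Form n U where
  domain := LinearMap.range (testToL2 U)
  toFun := (UniformSpace.Completion.toComplL (𝕜 := ℂ) (E := TestForm n U)).toLinearMap ∘ₗ
    D.onTest U ∘ₗ (LinearEquiv.ofInjective (testToL2 U) (testToL2_injective U)).symm.toLinearMap

/-- The closure `D_U` of `D` on `C_c^∞(U)`, as an operator from `L²(U)` to `L²(U, Λ¹)`. -/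
def closed (U : TopologicalSpace.Opens X) : L2Fun n U →ₗ.[ℂ] L2Form n U :=
  LinearPMap.closure (D.minimal U)

/-- The operator `D^* D` acting on `C_c^∞(U)`. -/
def formalLaplacian (U : TopologicalSpace.Opens X) : L2Fun n U →ₗ.[ℂ] L2Fun n U :=
  compose (LinearPMap.adjoint (D.minimal U)) (D.minimal U)

/-- The operator `Δ_U = D_U^* D_U` in `L²(U)`, on its natural domain. -/
def laplacian (U : TopologicalSpace.Opens X) : L2Fun n U →ₗ.[ℂ] L2Fun n U :=
  compose (LinearPMap.adjoint (D.closed U)) (D.closed U)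

end FirstOrderOperator

end Laplacian

end RiemannianCut

end

/-!
Write `d` for the operator `D` and `Γ(Y)` for the graph of its closure `d_Y`, a Hilbert space with
the inner product of `L²(Y) × L²(Y, Λ¹)`.

**The Friedrichs extension.** Integration by parts in charts, after a decomposition by cutoffs,
shows that every smooth compactly supported `1`-form lies in the domain of the adjoint of `d` on
`C_c^∞(Y)` (`hasFormalAdjoint`). Hence the adjoint is densely defined, `d` is closable, `d^* d` is defined on
`C_c^∞(Y)`, and the rest is the abstract statement `isFriedrichsExtension_closure`.

**The essential spectrum.** Let `ι : Γ(Y) → L²(Y)` be the first projection. The resolvent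
`(Δ_Y + 1)⁻¹` is `R_Y = ι ι†`, and `Δ_Y - z` is Fredholm exactly when `1 - (z + 1) R_Y` is. For a
normal operator on a separable Hilbert space this means that the operator reflects convergence to
zero along weakly null sequences (`fredholm_iff_reflectsWeaklyNull`). Extension by zero
`J : L²(X') → L²(X)` maps `Γ(X')` isometrically into `Γ(X)`, and `R_X - J R_X' J†` is `ι P ι†`, where
`P` is the orthogonal projection onto the complement of `Γ(X')` in `Γ(X)`. It remains to see that
`ι P ι†` is compact, and for this (`essSpectrum_adjoint_comp_self_eq`) that a bounded sequence in
`Γ(X)`, orthogonal to `Γ(X')`, whose image under `ι` is weakly null tends to zero in `L²(X)`.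

* Local compactness (`FirstOrderOperator.tendsto_setIntegral_zero`): a sequence of bounded energy
  `∫ |u|² + |d u|²` which is weakly null in `L²` tends to zero in `L²` on compact sets. This is
  Gårding's inequality for an operator with injective symbol, obtained from the case of constant
  coefficients by freezing the coefficients at a point, together with Plancherel's theorem: the
  Fourier transforms of the localised functions are bounded and tend to zero pointwise, and the
  bound of the derivatives controls high frequencies.
* Far from `K` the sequence is small by orthogonality
  (`FirstOrderOperator.tendsto_graphFst_of_orthogonal`): if `ψ` vanishes near `K` and equals `1`
  outside a compact set, the pairing of `(u, d u)` with `(ψ² u, d (ψ² u)) ∈ Γ(X')` has real part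
  `∫ ψ² |u|² + |d (ψ u)|² - |u|² |σ(dψ)|²`, and the last term is an integral over a compact set.

The operators `Δ_X` and `Δ_X'` act in different spaces, and only the resolvents are compared.
-/

namespace RiemannianCut

/-! ### Weakly null sequences and Fredholm operators -/

section WeaklyNull

open Filter

variable {E F : Type*} [NormedAddCommGroup E] [InnerProductSpace ℂ E]
  [NormedAddCommGroup F] [InnerProductSpace ℂ F]

/-- A bounded sequence in an inner product space which converges weakly to `0`. -/
structure WeaklyNull (x : ℕ → E) : Prop where
  bounded : ∃ C, ∀ k, ‖x k‖ ≤ C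
  tendsto_inner : ∀ y, Tendsto (fun k => inner ℂ y (x k)) atTop (𝓝 0)

theorem WeaklyNull.map [CompleteSpace E] [CompleteSpace F] {x : ℕ → E} (hx : WeaklyNull x)
    (A : E →L[ℂ] F) : WeaklyNull fun k => A (x k) := by
  obtain ⟨C, hC⟩ := hx.bounded
  refine ⟨⟨‖A‖ * C, fun k => (A.le_opNorm _).trans (by gcongr; exact hC k)⟩, fun y => ?_⟩
  simpa [ContinuousLinearMap.adjoint_inner_left] using hx.tendsto_inner (A.adjoint y)

theorem WeaklyNull.add {x y : ℕ → E} (hx : WeaklyNull x) (hy : WeaklyNull y) :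
    WeaklyNull fun k => x k + y k := by
  obtain ⟨C, hC⟩ := hx.bounded
  obtain ⟨C', hC'⟩ := hy.bounded
  refine ⟨⟨C + C', fun k => (norm_add_le _ _).trans (add_le_add (hC k) (hC' k))⟩, fun z => ?_⟩
  simpa [inner_add_right] using (hx.tendsto_inner z).add (hy.tendsto_inner z)

theorem weaklyNull_of_tendsto {x : ℕ → E} (hx : Tendsto x atTop (𝓝 0)) : WeaklyNull x := by
  obtain ⟨C, hC⟩ := (Metric.isBounded_range_of_tendsto x hx).exists_norm_le
  refine ⟨⟨C, fun k => hC _ (mem_range_self k)⟩, fun y => ?_⟩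
  simpa using (tendsto_const_nhds (x := y)).inner (𝕜 := ℂ) hx

theorem WeaklyNull.congr_of_tendsto_sub {x y : ℕ → E} (hx : WeaklyNull x)
    (h : Tendsto (fun k => y k - x k) atTop (𝓝 0)) : WeaklyNull y := by
  simpa using hx.add (weaklyNull_of_tendsto h)

/-- Bounded sequences have weakly convergent subsequences (Banach–Alaoglu). -/
theorem exists_weaklyNull_subseq [CompleteSpace E] [TopologicalSpace.SeparableSpace E]
    {x : ℕ → E} {C : ℝ} (hx : ∀ k, ‖x k‖ ≤ C) :
    ∃ (a : E) (φ : ℕ → ℕ), StrictMono φ ∧ WeaklyNull fun k => x (φ k) - a := by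
  let f : ℕ → WeakDual ℂ E := fun k => StrongDual.toWeakDual (InnerProductSpace.toDual ℂ E (x k))
  have hf : ∀ k, f k ∈ (WeakDual.toStrongDual ⁻¹' Metric.closedBall (0 : StrongDual ℂ E) C) := by
    intro k
    simpa [f] using hx k
  obtain ⟨g, -, φ, hφ, hg⟩ := WeakDual.isSeqCompact_closedBall ℂ E 0 C hf
  let a : E := (InnerProductSpace.toDual ℂ E).symm (WeakDual.toStrongDual g)
  refine ⟨a, φ, hφ, ⟨C + ‖a‖, fun k => (norm_sub_le _ _).trans (by gcongr; exact hx _)⟩,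
    fun y => ?_⟩
  have h1 : Tendsto (fun k => inner ℂ (x (φ k)) y) atTop (𝓝 (g y)) :=
    ((WeakDual.eval_continuous y).tendsto g).comp hg
  have h2 : g y = inner ℂ a y := by
    simp [a]
  rw [h2] at h1
  have h3 := ((Complex.continuous_conj.tendsto _).comp h1).sub_const (inner ℂ y a)
  simpa [Function.comp_def, inner_sub_right] using h3

theorem WeaklyNull.tendsto_of_mem {x : ℕ → E} (hx : WeaklyNull x) (S : Submodule ℂ E)
    [FiniteDimensional ℂ S] (hS : ∀ k, x k ∈ S) : Tendsto x atTop (𝓝 0) := by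
  have h : ∀ k, x k = ∑ i, inner ℂ (stdOrthonormalBasis ℂ S i : E) (x k) •
      (stdOrthonormalBasis ℂ S i : E) := by
    intro k
    have h1 := congrArg Subtype.val ((stdOrthonormalBasis ℂ S).sum_repr' ⟨x k, hS k⟩)
    simpa using h1.symm
  rw [funext h]
  have h0 : (0 : E) = ∑ i, (0 : ℂ) • (stdOrthonormalBasis ℂ S i : E) := by simp
  rw [h0]
  exact tendsto_finsetSum _ fun i _ => (hx.tendsto_inner _).smul_const _

/-- A weakly null sequence with null image is null. An operator has this property if and only if it
has finite-dimensional kernel and closed range; in this form, stability under completely continuous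
perturbations is evident. -/
def ReflectsWeaklyNull (A : E →L[ℂ] F) : Prop :=
  ∀ x : ℕ → E, WeaklyNull x → Tendsto (fun k => A (x k)) atTop (𝓝 0) → Tendsto x atTop (𝓝 0)

variable [CompleteSpace E] [CompleteSpace F]

/-- The unit ball of the kernel is sequentially compact. -/
theorem ReflectsWeaklyNull.finiteDimensional_ker [TopologicalSpace.SeparableSpace E]
    {A : E →L[ℂ] F} (hA : ReflectsWeaklyNull A) :
    FiniteDimensional ℂ (LinearMap.ker A.toLinearMap) := by
  have hc : IsClosed ((LinearMap.ker A.toLinearMap : Submodule ℂ E) : Set E) := A.isClosed_ker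
  refine FiniteDimensional.of_isCompact_closedBall ℂ (r := 1) one_pos (c := 0) ?_
  rw [isCompact_iff_isSeqCompact]
  intro x hx
  have hx1 : ∀ k, ‖(x k : E)‖ ≤ 1 := fun k => by simpa using hx k
  obtain ⟨a, φ, hφ, hw⟩ := exists_weaklyNull_subseq hx1
  have hAx : ∀ k, A (x k : E) = 0 := fun k => (x k).2
  have ha : A a = 0 := by
    have h1 := (hw.map A).tendsto_inner (A a)
    simp only [map_sub, hAx, zero_sub, inner_neg_right] at h1
    simpa using tendsto_nhds_unique h1 tendsto_const_nhds
  have h2 := hA _ hw (by simp [hAx, ha])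
  have h3 : Tendsto (fun k => (x (φ k) : E)) atTop (𝓝 a) := by
    simpa using h2.add_const a
  refine ⟨⟨a, ha⟩, ?_, φ, hφ, tendsto_subtype_rng.2 h3⟩
  have := le_of_tendsto h3.norm (Eventually.of_forall fun k => hx1 _)
  simpa using this

theorem ReflectsWeaklyNull.isClosed_range [TopologicalSpace.SeparableSpace E]
    {A : E →L[ℂ] F} (hA : ReflectsWeaklyNull A) :
    IsClosed (LinearMap.range A.toLinearMap : Set F) := by
  set N : Submodule ℂ E := LinearMap.ker A.toLinearMap with hN
  have : CompleteSpace N := A.isClosed_ker.completeSpace_coe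
  have hb : ∃ K : ℝ, ∀ x ∈ Nᗮ, ‖x‖ ≤ K * ‖A x‖ := by
    by_contra! hcon
    -- normalised vectors `y k` in `(ker A)ᗮ` with `A (y k) → 0`; a weak limit lies in `ker A` and in
    -- `(ker A)ᗮ`, so it vanishes and `y k → 0`, contradicting `‖y k‖ = 1`
    choose x hxN hx using fun k : ℕ => hcon (k + 1)
    have hx0 : ∀ k, x k ≠ 0 := by
      intro k h0
      have := hx k
      simp [h0] at this
    let y : ℕ → E := fun k => ((‖x k‖⁻¹ : ℝ) : ℂ) • x k
    have hy : ∀ k, ‖y k‖ = 1 := by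
      intro k
      simp [y, norm_smul, hx0 k]
    have hAy : Tendsto (fun k => A (y k)) atTop (𝓝 0) := by
      refine squeeze_zero_norm (fun k => ?_) (tendsto_one_div_add_atTop_nhds_zero_nat (𝕜 := ℝ))
      have h1 : ‖A (y k)‖ = ‖x k‖⁻¹ * ‖A (x k)‖ := by simp [y, norm_smul]
      have h2 := norm_pos_iff.2 (hx0 k)
      rw [h1, le_div_iff₀ (by positivity), inv_mul_eq_div, div_mul_eq_mul_div, div_le_one h2,
        mul_comm]
      exact (hx k).le
    obtain ⟨a, φ, hφ, hw⟩ := exists_weaklyNull_subseq (fun k => (hy k).le)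
    have ha : A a = 0 := by
      have h1 := (hw.map A).tendsto_inner (A a)
      have h2 := (tendsto_const_nhds (x := A a)).inner (𝕜 := ℂ)
        ((hAy.comp hφ.tendsto_atTop).sub_const (A a))
      simp only [map_sub, Function.comp_def] at h1 h2
      simpa using tendsto_nhds_unique h1 h2
    have ha' : a = 0 := by
      have h1 := hw.tendsto_inner a
      have h2 : ∀ k, inner ℂ a (y (φ k)) = 0 := fun k =>
        (Submodule.mem_orthogonal _ _).1 (Nᗮ.smul_mem _ (hxN _)) a ha
      simp only [inner_sub_right, h2, zero_sub] at h1
      simpa using tendsto_nhds_unique h1 tendsto_const_nhds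
    have h3 := (hA _ hw (by simpa [ha, Function.comp_def] using hAy.comp hφ.tendsto_atTop)).norm
    simp [ha', hy] at h3
  obtain ⟨K, hK⟩ := hb
  have hlip : AntilipschitzWith K.toNNReal (A ∘L Nᗮ.subtypeL) := by
    refine ContinuousLinearMap.antilipschitz_of_bound _ fun x => ?_
    refine (hK x x.2).trans ?_
    gcongr
    · exact Real.le_coe_toNNReal K
    · rfl
  have hcl := hlip.isClosed_range (A ∘L Nᗮ.subtypeL).uniformContinuous
  convert hcl using 1
  ext z
  constructor
  · rintro ⟨x, rfl⟩
    refine ⟨⟨x - N.starProjection x, N.sub_starProjection_mem_orthogonal x⟩, ?_⟩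
    have : A (N.starProjection x) = 0 := N.starProjection_apply_mem x
    simp [this]
  · rintro ⟨x, rfl⟩
    exact ⟨x, rfl⟩

theorem reflectsWeaklyNull_of_closed_range {A : E →L[ℂ] F}
    (hker : FiniteDimensional ℂ (LinearMap.ker A.toLinearMap))
    (hran : IsClosed (LinearMap.range A.toLinearMap : Set F)) : ReflectsWeaklyNull A := by
  intro x hx hAx
  set N : Submodule ℂ E := LinearMap.ker A.toLinearMap with hN
  have hA0 : ∀ y, A (N.starProjection y) = 0 := fun y => N.starProjection_apply_mem y
  have hinj : Function.Injective (A ∘L Nᗮ.subtypeL) := by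
    rw [injective_iff_map_eq_zero]
    intro y hy
    have h1 : (y : E) ∈ N := hy
    have h2 := (Submodule.mem_orthogonal _ _).1 y.2 _ h1
    exact Subtype.ext (inner_self_eq_zero.1 h2)
  have hcl : IsClosed (Set.range (A ∘L Nᗮ.subtypeL)) := by
    convert hran using 1
    ext z
    constructor
    · rintro ⟨x, rfl⟩
      exact ⟨x, rfl⟩
    · rintro ⟨x, rfl⟩
      refine ⟨⟨x - N.starProjection x, N.sub_starProjection_mem_orthogonal x⟩, ?_⟩
      simp [hA0]
  obtain ⟨c, hc⟩ := ContinuousLinearMap.antilipschitz_of_injective_of_isClosed_range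
    (A ∘L Nᗮ.subtypeL) hinj hcl
  have h1 : Tendsto (fun k => N.starProjection (x k)) atTop (𝓝 0) :=
    (hx.map N.starProjection).tendsto_of_mem N fun k => N.starProjection_apply_mem _
  have h2 : Tendsto (fun k => x k - N.starProjection (x k)) atTop (𝓝 0) := by
    refine squeeze_zero_norm (a := fun k => c * ‖A (x k)‖) (fun k => ?_)
        (by simpa using hAx.norm.const_mul (c : ℝ))
    have h3 := hc.le_mul_dist ⟨x k - N.starProjection (x k), N.sub_starProjection_mem_orthogonal _⟩
        0
    simpa [hA0] using h3
  simpa using h2.add h1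

/-- The hypothesis holds for normal operators. It gives `(ran A)ᗮ = ker A`, so that the cokernel is
finite-dimensional as soon as the kernel is. -/
theorem fredholm_iff_reflectsWeaklyNull [TopologicalSpace.SeparableSpace E] {A : E →L[ℂ] E}
    (hA : ∀ x, ‖A.adjoint x‖ = ‖A x‖) :
    (FiniteDimensional ℂ (LinearMap.ker A.toLinearMap) ∧
      IsClosed (LinearMap.range A.toLinearMap : Set E) ∧
      FiniteDimensional ℂ (E ⧸ LinearMap.range A.toLinearMap)) ↔ ReflectsWeaklyNull A := by
  refine ⟨fun h => reflectsWeaklyNull_of_closed_range h.1 h.2.1, fun h => ?_⟩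
  refine ⟨h.finiteDimensional_ker, h.isClosed_range, ?_⟩
  have := h.finiteDimensional_ker
  have : CompleteSpace (LinearMap.range A.toLinearMap) := h.isClosed_range.completeSpace_coe
  have e : (LinearMap.range A.toLinearMap)ᗮ = LinearMap.ker A.toLinearMap := by
    have h1 : (LinearMap.range A.toLinearMap)ᗮ = LinearMap.ker A.adjoint.toLinearMap :=
      ContinuousLinearMap.orthogonal_range A
    rw [h1]
    ext x
    have h2 := hA x
    constructor
    · intro hx
      have : A.adjoint x = 0 := hx
      rw [this, norm_zero] at h2
      exact norm_eq_zero.1 h2.symm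
    · intro hx
      have : A x = 0 := hx
      rw [this, norm_zero] at h2
      exact norm_eq_zero.1 h2
  have e2 := Submodule.quotientEquivOfIsCompl _ _
    (Submodule.isCompl_orthogonal (K := LinearMap.range A.toLinearMap))
  rw [e] at e2
  exact e2.symm.finiteDimensional

end WeaklyNull

/-! ### The resolvent of `T† T` and the essential spectrum -/

section Resolvent

open Filter

variable {E F : Type*} [NormedAddCommGroup E] [InnerProductSpace ℂ E]
  [NormedAddCommGroup F] [InnerProductSpace ℂ F]

theorem mem_graph_compose {V W Z : Type*} [AddCommGroup V] [Module ℂ V] [AddCommGroup W]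
    [Module ℂ W] [AddCommGroup Z] [Module ℂ Z] (g : W →ₗ.[ℂ] Z) (f : V →ₗ.[ℂ] W) (x : V) (z : Z) :
    (x, z) ∈ (compose g f).graph ↔ ∃ y, (x, y) ∈ f.graph ∧ (y, z) ∈ g.graph := by
  simp only [LinearPMap.mem_graph_iff]
  constructor
  · rintro ⟨⟨a, ha⟩, h1, h2⟩
    obtain ⟨b, hb, hba⟩ := ha
    simp only at h1
    refine ⟨f b, ⟨b, hba.trans h1, rfl⟩, ⟨f b, hb⟩, rfl, ?_⟩
    rw [← h2]
    subst hba
    rfl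
  · rintro ⟨y, ⟨a, rfl, rfl⟩, ⟨b, hb, rfl⟩⟩
    have hfa : f a ∈ g.domain := hb ▸ b.2
    refine ⟨⟨a, a, hfa, rfl⟩, rfl, ?_⟩
    exact congrArg g (Subtype.ext hb.symm)

theorem mem_graph_adjoint_iff [CompleteSpace E] {T : E →ₗ.[ℂ] F} (hT : Dense (T.domain : Set E))
    (y : F) (u : E) :
    (y, u) ∈ T.adjoint.graph ↔ ∀ p ∈ T.graph, inner ℂ p.1 u = inner ℂ p.2 y := by
  rw [LinearPMap.adjoint_graph_eq_graph_adjoint hT, Submodule.mem_adjoint_iff]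
  constructor
  · intro h p hp
    exact (sub_eq_zero.1 (h p.1 p.2 hp)).symm
  · intro h a b hab
    exact sub_eq_zero.2 (h (a, b) hab).symm

/-- The graph of `T`, as a subspace of the Hilbert direct sum. -/
def hilbertGraph (T : E →ₗ.[ℂ] F) : Submodule ℂ (WithLp 2 (E × F)) :=
  T.graph.comap (WithLp.linearEquiv 2 ℂ (E × F)).toLinearMap

theorem isClosed_hilbertGraph {T : E →ₗ.[ℂ] F} (hT : T.IsClosed) :
    IsClosed (hilbertGraph T : Set (WithLp 2 (E × F))) :=
  IsClosed.preimage (WithLp.prod_continuous_ofLp 2 E F) hT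

/-- The projection of the graph of `T` to the domain of `T`. -/
def graphFst (T : E →ₗ.[ℂ] F) : hilbertGraph T →L[ℂ] E :=
  WithLp.fstL 2 ℂ E F ∘L (hilbertGraph T).subtypeL

/-- `T† T f = u` if and only if `f = ι ι† (f + u)`, where `ι` is the projection of the graph of
`T` to the domain: thus `ι ι†` is the resolvent `(T† T + 1)⁻¹`. -/
theorem mem_graph_adjoint_comp_self_iff [CompleteSpace E] [CompleteSpace F] {T : E →ₗ.[ℂ] F}
    [CompleteSpace (hilbertGraph T)] (hT : Dense (T.domain : Set E)) (f u : E) :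
    (f, u) ∈ (compose T.adjoint T).graph ↔ graphFst T ((graphFst T).adjoint (f + u)) = f := by
  have key : ∀ q : hilbertGraph T, ∀ w : hilbertGraph T, inner ℂ w
      ((graphFst T).adjoint (f + u) - q) =
      inner ℂ w.1.fst (f + u - q.1.fst) - inner ℂ w.1.snd q.1.snd := by
    intro q w
    rw [inner_sub_right, ContinuousLinearMap.adjoint_inner_right, Submodule.coe_inner,
      WithLp.prod_inner_apply]
    simp only [inner_sub_right, graphFst]
    simp
    ring
  rw [mem_graph_compose]
  simp only [mem_graph_adjoint_iff hT]
  constructor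
  · rintro ⟨y, h1, h2⟩
    let q : hilbertGraph T := ⟨WithLp.toLp 2 (f, y), h1⟩
    have h3 : (graphFst T).adjoint (f + u) = q := by
      rw [← sub_eq_zero]
      refine ext_inner_left ℂ fun w => ?_
      rw [key q w, inner_zero_right]
      have := h2 _ w.2
      have hu : f + u - q.1.fst = u := add_sub_cancel_left f u
      rw [hu]
      exact sub_eq_zero.2 this
    rw [h3]
    rfl
  · intro h
    obtain ⟨q, hq⟩ : ∃ q, q = (graphFst T).adjoint (f + u) := ⟨_, rfl⟩
    rw [← hq] at h key
    have hq1 : q.1.fst = f := h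
    refine ⟨q.1.snd, ?_, fun p hp => ?_⟩
    · rw [← hq1]
      exact q.2
    · have h2 := key q ⟨WithLp.toLp 2 p, hp⟩
      rw [sub_self, inner_zero_right, hq1, add_sub_cancel_left] at h2
      exact sub_eq_zero.1 h2.symm

/-- If `R = (L + 1)⁻¹`, then `1 - (z + 1) R = (L - z) R`, so that this operator and `L - z` have the
same kernel and the same range. -/
theorem fredholm_subScalar_iff {L : E →ₗ.[ℂ] E} {R : E →L[ℂ] E}
    (hR : ∀ f u, (f, u) ∈ L.graph ↔ R (f + u) = f) (z : ℂ) :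
    (FiniteDimensional ℂ (LinearMap.ker (subScalar L z)) ∧
      IsClosed (LinearMap.range (subScalar L z) : Set E) ∧
      FiniteDimensional ℂ (E ⧸ LinearMap.range (subScalar L z))) ↔
    (FiniteDimensional ℂ (LinearMap.ker (1 - (z + 1) • R).toLinearMap) ∧
      IsClosed (LinearMap.range (1 - (z + 1) • R).toLinearMap : Set E) ∧
      FiniteDimensional ℂ (E ⧸ LinearMap.range (1 - (z + 1) • R).toLinearMap)) := by
  have hsub : ∀ f : L.domain, subScalar L z f = L f - z • (f : E) := fun f => rfl
  have hRf : ∀ f : L.domain, R (f + L f) = f := fun f => (hR _ _).1 (L.mem_graph f)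
  have hran : LinearMap.range (subScalar L z) = LinearMap.range (1 - (z + 1) • R).toLinearMap := by
    ext y
    constructor
    · rintro ⟨f, rfl⟩
      refine ⟨f + L f, ?_⟩
      simp only [ContinuousLinearMap.coe_coe, sub_apply,
        smul_apply, hRf, one_apply_eq_self, hsub]
      rw [add_smul, one_smul]
      abel
    · rintro ⟨x, rfl⟩
      have h1 : (R x, x - R x) ∈ L.graph := (hR _ _).2 (by simp)
      obtain ⟨f, hf1, hf2⟩ := (LinearPMap.mem_graph_iff _).1 h1
      refine ⟨f, ?_⟩
      simp only [ContinuousLinearMap.coe_coe, sub_apply,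
        smul_apply, one_apply_eq_self, hsub]
      simp only at hf1 hf2
      rw [hf2, hf1, add_smul, one_smul]
      abel
  have hker : (LinearMap.ker (subScalar L z)).map L.domain.subtype =
      LinearMap.ker (1 - (z + 1) • R).toLinearMap := by
    ext y
    rw [LinearMap.mem_ker]
    simp only [ContinuousLinearMap.coe_coe, sub_apply,
        smul_apply, one_apply_eq_self, Submodule.mem_map]
    constructor
    · rintro ⟨f, hf, rfl⟩
      have h1 : L f = z • (f : E) := sub_eq_zero.1 hf
      have h2 := hRf f
      rw [h1, show (f : E) + z • (f : E) = (z + 1) • (f : E) by rw [add_smul, one_smul, add_comm],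
        map_smul] at h2
      exact sub_eq_zero.2 h2.symm
    · intro hy
      have h1 : (y, z • y) ∈ L.graph := by
        rw [hR, show y + z • y = (z + 1) • y by rw [add_smul, one_smul, add_comm], map_smul]
        exact (sub_eq_zero.1 hy).symm
      obtain ⟨f, hf1, hf2⟩ := (LinearPMap.mem_graph_iff _).1 h1
      simp only at hf1 hf2
      refine ⟨f, ?_, hf1⟩
      rw [LinearMap.mem_ker, hsub, hf2, hf1, sub_self]
  have e := Submodule.equivMapOfInjective L.domain.subtype (Submodule.injective_subtype _)
    (LinearMap.ker (subScalar L z))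
  rw [hker] at e
  rw [hran]
  exact and_congr_left fun _ => ⟨fun _ => e.finiteDimensional, fun _ => e.symm.finiteDimensional⟩

/-- `1 - z R` is normal for self-adjoint `R`. -/
theorem norm_adjoint_one_sub_smul [CompleteSpace E] {R : E →L[ℂ] E} (hR : R.adjoint = R)
    (z : ℂ) (x : E) : ‖(1 - z • R).adjoint x‖ = ‖(1 - z • R) x‖ := by
  have hsym : ∀ a b, inner ℂ (R a) b = inner ℂ a (R b) := by
    intro a b
    rw [← ContinuousLinearMap.adjoint_inner_right, hR]
  have h1 : (1 - z • R).adjoint = 1 - (starRingEnd ℂ z) • R := by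
    rw [map_sub, map_smulₛₗ, hR]
    congr 1
    exact star_one (E →L[ℂ] E)
  rw [h1, ← sq_eq_sq₀ (norm_nonneg _) (norm_nonneg _)]
  have h2 : ∀ w : ℂ, ((‖(1 - w • R) x‖ ^ 2 : ℝ) : ℂ) = inner ℂ x x - w * inner ℂ x (R x) -
      (starRingEnd ℂ w) * inner ℂ x (R x) + (starRingEnd ℂ w) * w * inner ℂ (R x) (R x) := by
    intro w
    have := inner_self_eq_norm_sq_to_K (𝕜 := ℂ) ((1 - w • R) x)
    push_cast
    refine this.symm.trans ?_
    simp only [sub_apply, smul_apply,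
      one_apply_eq_self, inner_sub_left, inner_sub_right, inner_smul_left,
      inner_smul_right, hsym]
    ring
  have h3 := h2 z
  have h4 := h2 (starRingEnd ℂ z)
  simp only [Complex.conj_conj] at h4
  exact_mod_cast (h4.trans (by rw [h3]; ring) :
    ((‖(1 - (starRingEnd ℂ z) • R) x‖ ^ 2 : ℝ) : ℂ) = ((‖(1 - z • R) x‖ ^ 2 : ℝ) : ℂ))

theorem mem_essSpectrum_iff [CompleteSpace E] [TopologicalSpace.SeparableSpace E]
    {L : E →ₗ.[ℂ] E} {R : E →L[ℂ] E} (hadj : R.adjoint = R)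
    (hR : ∀ f u, (f, u) ∈ L.graph ↔ R (f + u) = f) (z : ℂ) :
    z ∈ essSpectrum L ↔ ¬ ReflectsWeaklyNull (1 - (z + 1) • R) := by
  rw [← fredholm_iff_reflectsWeaklyNull (norm_adjoint_one_sub_smul hadj _),
    ← fredholm_subScalar_iff hR]
  rfl

/-- A form of Weyl's theorem: if the resolvents `R` and `J R' J†` differ by a completely continuous
operator, then the essential spectra agree. They may live on different Hilbert spaces, since
`J R' J†` vanishes on `(ran J)ᗮ`, where `1 - (z + 1) J R' J†` is the identity. -/
theorem essSpectrum_eq_of_resolvent {E' : Type*} [NormedAddCommGroup E'] [InnerProductSpace ℂ E']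
    [CompleteSpace E] [TopologicalSpace.SeparableSpace E]
    [CompleteSpace E'] [TopologicalSpace.SeparableSpace E']
    {L : E →ₗ.[ℂ] E} {R : E →L[ℂ] E} (hadj : R.adjoint = R)
    (hR : ∀ f u, (f, u) ∈ L.graph ↔ R (f + u) = f)
    {L' : E' →ₗ.[ℂ] E'} {R' : E' →L[ℂ] E'} (hadj' : R'.adjoint = R')
    (hR' : ∀ f u, (f, u) ∈ L'.graph ↔ R' (f + u) = f) (J : E' →ₗᵢ[ℂ] E)
    (hc : ∀ x : ℕ → E, WeaklyNull x →
      Tendsto (fun k => R (x k) - J (R' (J.toContinuousLinearMap.adjoint (x k)))) atTop (𝓝 0)) :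
    essSpectrum L = essSpectrum L' := by
  have hJ : ∀ y, J.toContinuousLinearMap.adjoint (J y) = y := by
    intro y
    refine ext_inner_left ℂ fun w => ?_
    rw [ContinuousLinearMap.adjoint_inner_right]
    exact J.inner_map_map w y
  ext z
  rw [mem_essSpectrum_iff hadj hR, mem_essSpectrum_iff hadj' hR', not_iff_not]
  constructor
  · intro h x hx hAx
    have h1 := h _ (hx.map J.toContinuousLinearMap) (by
      have h2 := (hc _ (hx.map J.toContinuousLinearMap)).const_smul (z + 1)
      have h3 := ((J.toContinuousLinearMap.continuous.tendsto 0).comp hAx).sub h2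
      simp only [map_zero, smul_zero, sub_zero] at h3
      refine h3.congr fun k => ?_
      simp [hJ, smul_sub])
    have h2 := h1.norm
    simp only [LinearIsometry.coe_toContinuousLinearMap, LinearIsometry.norm_map, norm_zero] at h2
    exact tendsto_zero_iff_norm_tendsto_zero.2 h2
  · intro h x hx hAx
    have hB : Tendsto (fun k => x k - (z + 1) • J (R' (J.toContinuousLinearMap.adjoint (x k))))
        atTop (𝓝 0) := by
      have h2 := hAx.add ((hc _ hx).const_smul (z + 1))
      simp only [smul_zero, add_zero] at h2
      refine h2.congr fun k => ?_
      simp [smul_sub]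
    have h1 := h _ (hx.map J.toContinuousLinearMap.adjoint) (by
      have h2 := (J.toContinuousLinearMap.adjoint.continuous.tendsto 0).comp hB
      rw [map_zero] at h2
      refine h2.congr fun k => ?_
      simp [hJ])
    have h2 := hB.add (((J.toContinuousLinearMap ∘L R').continuous.tendsto 0).comp h1 |>.const_smul
        (z + 1))
    simpa using h2

/-- If an isometry `j` between the graphs of `T'` and `T` lies over an isometry `J` of the Hilbert
spaces, and the projection of `(ran j)ᗮ` to `E` maps bounded sequences with weakly null image to
null sequences, then `T† T` and `T'† T'` have the same essential spectrum. -/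
theorem essSpectrum_adjoint_comp_self_eq {E' F' : Type*} [NormedAddCommGroup E']
    [InnerProductSpace ℂ E'] [NormedAddCommGroup F'] [InnerProductSpace ℂ F']
    [CompleteSpace E] [TopologicalSpace.SeparableSpace E] [CompleteSpace F]
    [CompleteSpace E'] [TopologicalSpace.SeparableSpace E'] [CompleteSpace F']
    {T : E →ₗ.[ℂ] F} (hT : T.IsClosed) (hTd : Dense (T.domain : Set E))
    {T' : E' →ₗ.[ℂ] F'} (hT' : T'.IsClosed) (hTd' : Dense (T'.domain : Set E'))
    (J : E' →ₗᵢ[ℂ] E) (j : hilbertGraph T' →ₗᵢ[ℂ] hilbertGraph T)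
    (hj : ∀ q, graphFst T (j q) = J (graphFst T' q))
    (hc : ∀ q : ℕ → hilbertGraph T, (∀ k w, inner ℂ (j w) (q k) = 0) → (∃ C, ∀ k, ‖q k‖ ≤ C) →
      WeaklyNull (fun k => graphFst T (q k)) → Tendsto (fun k => graphFst T (q k)) atTop (𝓝 0)) :
    essSpectrum (compose T.adjoint T) = essSpectrum (compose T'.adjoint T') := by
  have : CompleteSpace (hilbertGraph T) := (isClosed_hilbertGraph hT).completeSpace_coe
  have : CompleteSpace (hilbertGraph T') := (isClosed_hilbertGraph hT').completeSpace_coe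
  refine essSpectrum_eq_of_resolvent (R := graphFst T ∘L (graphFst T).adjoint)
    (R' := graphFst T' ∘L (graphFst T').adjoint) ?_ (mem_graph_adjoint_comp_self_iff hTd) ?_
    (mem_graph_adjoint_comp_self_iff hTd') J fun x hx => ?_
  · rw [ContinuousLinearMap.adjoint_comp, ContinuousLinearMap.adjoint_adjoint]
  · rw [ContinuousLinearMap.adjoint_comp, ContinuousLinearMap.adjoint_adjoint]
  -- `A = (1 - j j†) ι†`, since `j† ι† = ι'† J†`
  let A : E →L[ℂ] hilbertGraph T := (graphFst T).adjoint -
    j.toContinuousLinearMap ∘L (graphFst T').adjoint ∘L J.toContinuousLinearMap.adjoint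
  have h1 : ∀ k, graphFst T (A (x k)) = (graphFst T ∘L (graphFst T).adjoint) (x k) -
      J ((graphFst T' ∘L (graphFst T').adjoint) (J.toContinuousLinearMap.adjoint (x k))) := by
    intro k
    simp [A, hj]
  simp only [← h1]
  refine hc (fun k => A (x k)) (fun k w => ?_) ?_ ((hx.map A).map (graphFst T))
  · simp only [A, sub_apply, inner_sub_right, ContinuousLinearMap.comp_apply,
      ContinuousLinearMap.adjoint_inner_right, hj, LinearIsometry.coe_toContinuousLinearMap,
      LinearIsometry.inner_map_map]
    rw [← LinearIsometry.coe_toContinuousLinearMap J, sub_self]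
  · exact (hx.map A).bounded

theorem exists_linearIsometry_extension {V G H : Type*} [AddCommGroup V] [Module ℂ V]
    [NormedAddCommGroup G] [InnerProductSpace ℂ G] [NormedAddCommGroup H] [InnerProductSpace ℂ H]
    [CompleteSpace H] (e : V →ₗ[ℂ] G) (he : DenseRange e) (f : V →ₗ[ℂ] H)
    (h : ∀ v, ‖f v‖ = ‖e v‖) : ∃ j : G →ₗᵢ[ℂ] H, ∀ v, j (e v) = f v := by
  have h1 : ∀ v, f.extendOfNorm e (e v) = f v :=
    LinearMap.extendOfNorm_eq he ⟨1, fun v => by rw [h, one_mul]⟩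
  refine ⟨⟨(f.extendOfNorm e).toLinearMap, fun x => ?_⟩, h1⟩
  refine he.induction_on (p := fun x => ‖f.extendOfNorm e x‖ = ‖x‖) x
    (isClosed_eq (by fun_prop) (by fun_prop)) fun v => ?_
  rw [h1, h]

end Resolvent

/-! ### Elliptic estimates with constant coefficients -/

section Fourier

open Filter FourierTransform SchwartzMap
open scoped LineDeriv

variable {n : ℕ}

/-- The partial derivative `∂ f / ∂ x_k` of a Schwartz function. -/
noncomputable abbrev coordDeriv (k : Fin n) (f : 𝓢(Model n, ℂ)) : 𝓢(Model n, ℂ) :=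
  ∂_{EuclideanSpace.single k (1 : ℝ)} f

theorem integrable_norm_sq_schwartz (f : 𝓢(Model n, ℂ)) : Integrable fun x => ‖f x‖ ^ 2 :=
  (f.memLp 2).integrable_norm_pow (by norm_num)

theorem fourier_sum_lineDeriv (a : Fin n → ℂ) (f : 𝓢(Model n, ℂ)) (ξ : Model n) :
    𝓕 (∑ k, a k • coordDeriv k f) ξ =
      2 * Real.pi * Complex.I * (∑ k, a k * ξ k) * 𝓕 f ξ := by
  have h : 𝓕 (∑ k, a k • coordDeriv k f) =
      ∑ k, a k • 𝓕 (coordDeriv k f) := by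
    have := map_sum (SchwartzMap.fourierTransformCLM ℂ (V := Model n) (E := ℂ))
        (fun k => a k • coordDeriv k f) Finset.univ
    simpa only [map_smul] using! this
  rw [h]
  simp only [fourier_lineDerivOp_eq]
  have h1 : ∀ k : Fin n, Function.HasTemperateGrowth
      (fun x : Model n => inner ℝ x (EuclideanSpace.single k (1 : ℝ))) :=
    fun k => ((innerSL ℝ).flip _).hasTemperateGrowth
  simp only [sum_apply, smul_apply, SchwartzMap.smulLeftCLM_apply_apply (h1 _),
    Finset.mul_sum, Finset.sum_mul]
  refine Finset.sum_congr rfl fun k _ => ?_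
  simp [EuclideanSpace.inner_single_right]
  ring

theorem norm_sq_fourier_sum_lineDeriv (a : Fin n → ℂ) (f : 𝓢(Model n, ℂ)) (ξ : Model n) :
    ‖𝓕 (∑ k, a k • coordDeriv k f) ξ‖ ^ 2 =
      4 * Real.pi ^ 2 * (‖∑ k, a k * ξ k‖ ^ 2 * ‖𝓕 f ξ‖ ^ 2) := by
  rw [fourier_sum_lineDeriv]
  simp only [norm_mul, Complex.norm_I, Complex.norm_real, Complex.norm_ofNat, mul_pow,
      Real.norm_eq_abs, sq_abs]
  ring

theorem sum_integral_norm_sq_lineDeriv_eq (f : 𝓢(Model n, ℂ)) :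
    Integrable (fun ξ => ‖ξ‖ ^ 2 * ‖𝓕 f ξ‖ ^ 2) ∧
    ∑ k, ∫ x, ‖coordDeriv k f x‖ ^ 2 =
      4 * Real.pi ^ 2 * ∫ ξ, ‖ξ‖ ^ 2 * ‖𝓕 f ξ‖ ^ 2 := by
  have h1 : ∀ (k : Fin n) (ξ : Model n), ‖𝓕 (coordDeriv k f) ξ‖ ^ 2 =
      4 * Real.pi ^ 2 * ((ξ k) ^ 2 * ‖𝓕 f ξ‖ ^ 2) := by
    intro k ξ
    have := norm_sq_fourier_sum_lineDeriv (Pi.single k 1) f ξ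
    simpa [Pi.single_apply, ite_mul] using this
  have h2 : ∀ ξ : Model n, ‖ξ‖ ^ 2 * ‖𝓕 f ξ‖ ^ 2 =
      (4 * Real.pi ^ 2)⁻¹ * ∑ k, ‖𝓕 (coordDeriv k f) ξ‖ ^ 2 := by
    intro ξ
    have : (4 * Real.pi ^ 2 : ℝ) ≠ 0 := by positivity
    simp only [h1, ← Finset.mul_sum, ← Finset.sum_mul]
    rw [inv_mul_cancel_left₀ this, EuclideanSpace.norm_sq_eq]
    simp
  have h3 : ∀ k : Fin n, Integrable fun ξ => ‖𝓕 (coordDeriv k f) ξ‖ ^ 2 :=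
    fun k => integrable_norm_sq_schwartz _
  refine ⟨?_, ?_⟩
  · simp only [h2]
    exact (integrable_finsetSum _ fun k _ => h3 k).const_mul _
  · simp only [h2]
    rw [integral_const_mul, integral_finsetSum _ fun k _ => h3 k, mul_inv_cancel_left₀
        (by positivity)]
    exact Finset.sum_congr rfl fun k _ => (integral_norm_sq_fourier _).symm

/-- Gårding's inequality for constant coefficients, by Plancherel's theorem. -/
theorem garding_const_coeff {ι : Type*} [Fintype ι] (a : ι → Fin n → ℂ) {c : ℝ}
    (hc : ∀ ξ : Model n, c * ‖ξ‖ ^ 2 ≤ ∑ i, ‖∑ k, a i k * ξ k‖ ^ 2) (f : 𝓢(Model n, ℂ)) :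
    c * ∑ k, ∫ x, ‖coordDeriv k f x‖ ^ 2 ≤
      ∑ i, ∫ x, ‖∑ k, a i k * coordDeriv k f x‖ ^ 2 := by
  have h1 : ∀ i, ∫ x, ‖∑ k, a i k * coordDeriv k f x‖ ^ 2 =
      ∫ ξ, ‖𝓕 (∑ k, a i k • coordDeriv k f) ξ‖ ^ 2 := by
    intro i
    rw [integral_norm_sq_fourier]
    simp [sum_apply]
  obtain ⟨h2, h3⟩ := sum_integral_norm_sq_lineDeriv_eq f
  rw [Finset.sum_congr rfl fun i _ => h1 i, h3,
    ← integral_finsetSum _ fun i _ => integrable_norm_sq_schwartz _, mul_left_comm,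
    ← integral_const_mul, ← integral_const_mul]
  refine integral_mono ((h2.const_mul _).const_mul _)
    (integrable_finsetSum _ fun i _ => integrable_norm_sq_schwartz _) fun ξ => ?_
  simp only [norm_sq_fourier_sum_lineDeriv, ← Finset.mul_sum, ← Finset.sum_mul]
  rw [← mul_assoc c]
  gcongr
  exact hc ξ

/-- The mechanism of Rellich's theorem: the bound of the derivatives controls the part of the
Fourier transforms outside a ball, and dominated convergence the part inside. -/
theorem tendsto_integral_norm_sq_of_fourier {f : ℕ → 𝓢(Model n, ℂ)} {C M : ℝ}
    (hC : ∀ j ξ, ‖𝓕 (f j) ξ‖ ≤ C) (hf : ∀ ξ, Tendsto (fun j => 𝓕 (f j) ξ) atTop (𝓝 0))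
    (hM : ∀ j, ∑ k, ∫ x, ‖coordDeriv k (f j) x‖ ^ 2 ≤ M) :
    Tendsto (fun j => ∫ x, ‖f j x‖ ^ 2) atTop (𝓝 0) := by
  have hM0 : 0 ≤ M := (Finset.sum_nonneg fun k _ => integral_nonneg fun x => by positivity).trans
      (hM 0)
  have key : ∀ R : ℝ, 0 < R → ∀ j, ∫ x, ‖f j x‖ ^ 2 ≤
      (∫ ξ in Metric.closedBall (0 : Model n) R, ‖𝓕 (f j) ξ‖ ^ 2) + M / R ^ 2 := by
    intro R hR j
    obtain ⟨h1, h2⟩ := sum_integral_norm_sq_lineDeriv_eq (f j)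
    rw [← integral_norm_sq_fourier,
      ← integral_add_compl measurableSet_closedBall (integrable_norm_sq_schwartz (𝓕 (f j)))]
    refine add_le_add le_rfl ?_
    have h3 : ∫ ξ in (Metric.closedBall (0 : Model n) R)ᶜ, ‖𝓕 (f j) ξ‖ ^ 2 ≤
        ∫ ξ in (Metric.closedBall (0 : Model n) R)ᶜ, (R ^ 2)⁻¹ * (‖ξ‖ ^ 2 * ‖𝓕 (f j) ξ‖ ^ 2) := by
      refine setIntegral_mono_on (integrable_norm_sq_schwartz _).integrableOn
        (h1.const_mul _).integrableOn measurableSet_closedBall.compl fun ξ hξ => ?_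
      have h4 : R < ‖ξ‖ := by simpa using hξ
      have h5 : 1 ≤ (R ^ 2)⁻¹ * ‖ξ‖ ^ 2 := by
        rw [inv_mul_eq_div, one_le_div (by positivity)]
        gcongr
      rw [← mul_assoc]
      exact le_mul_of_one_le_left (by positivity) h5
    have h4 : ∫ ξ in (Metric.closedBall (0 : Model n) R)ᶜ, (R ^ 2)⁻¹ * (‖ξ‖ ^ 2 * ‖𝓕 (f j) ξ‖ ^ 2) ≤
        (R ^ 2)⁻¹ * ∫ ξ, ‖ξ‖ ^ 2 * ‖𝓕 (f j) ξ‖ ^ 2 := by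
      rw [← integral_const_mul]
      exact setIntegral_le_integral (h1.const_mul _)
        (Eventually.of_forall fun ξ => by positivity)
    have h5 : ∫ ξ, ‖ξ‖ ^ 2 * ‖𝓕 (f j) ξ‖ ^ 2 ≤ M := by
      have h6 := hM j
      rw [h2] at h6
      have h7 : (0 : ℝ) ≤ ∫ ξ, ‖ξ‖ ^ 2 * ‖𝓕 (f j) ξ‖ ^ 2 :=
        integral_nonneg fun ξ => by positivity
      have h8 : (1 : ℝ) ≤ 4 * Real.pi ^ 2 := by nlinarith [Real.pi_gt_three]
      nlinarith
    refine h3.trans (h4.trans ?_)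
    rw [div_eq_inv_mul]
    gcongr
  have hlow : ∀ R : ℝ, Tendsto
      (fun j => ∫ ξ in Metric.closedBall (0 : Model n) R, ‖𝓕 (f j) ξ‖ ^ 2) atTop (𝓝 0) := by
    intro R
    have h1 : (0 : ℝ) = ∫ ξ in Metric.closedBall (0 : Model n) R, (0 : ℝ) := by simp
    rw [h1]
    refine tendsto_integral_of_dominated_convergence (fun _ => C ^ 2)
      (fun j => (integrable_norm_sq_schwartz _).aestronglyMeasurable.restrict) ?_ ?_ ?_
    · have : IsFiniteMeasure (volume.restrict (Metric.closedBall (0 : Model n) R)) :=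
        ⟨by simpa using measure_closedBall_lt_top⟩
      exact integrable_const _
    · refine fun j => Eventually.of_forall fun ξ => ?_
      rw [Real.norm_of_nonneg (by positivity)]
      gcongr
      exact hC j ξ
    · refine Eventually.of_forall fun ξ => ?_
      simpa using (hf ξ).norm.pow 2
  rw [Metric.tendsto_atTop]
  intro ε hε
  obtain ⟨R, hR, hR'⟩ : ∃ R : ℝ, 0 < R ∧ M / R ^ 2 < ε / 2 := by
    have h1 : Tendsto (fun R : ℝ => M / R ^ 2) atTop (𝓝 0) :=
      tendsto_const_nhds.div_atTop (tendsto_pow_atTop two_ne_zero)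
    exact ((eventually_gt_atTop 0).and (h1.eventually (gt_mem_nhds (half_pos hε)))).exists
  obtain ⟨N, hN⟩ := Metric.tendsto_atTop.1 (hlow R) (ε / 2) (half_pos hε)
  refine ⟨N, fun j hj => ?_⟩
  have h1 := hN j hj
  have h2 := key R hR j
  rw [Real.dist_eq, sub_zero, abs_of_nonneg (integral_nonneg fun x => by positivity)] at h1 ⊢
  linarith

end Fourier

/-! ### Smooth functions and forms in a chart -/

section Chart

theorem contDiff_indicator_of_compact {V W : Type*} [NormedAddCommGroup V] [NormedSpace ℝ V]
    [NormedAddCommGroup W] [NormedSpace ℝ W] {T S : Set V} (hT : IsOpen T) (hS : IsCompact S)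
    (hST : S ⊆ T) {g : V → W} {m : ℕ∞ω} (hg : ContDiffOn ℝ m g T) (h0 : ∀ p ∈ T, p ∉ S → g p = 0) :
    ContDiff ℝ m (T.indicator g) ∧ tsupport (T.indicator g) ⊆ S := by
  have hz : ∀ p, p ∉ S → T.indicator g p = 0 := by
    intro p hp
    by_cases hpT : p ∈ T
    · rw [indicator_of_mem hpT, h0 p hpT hp]
    · exact indicator_of_notMem hpT _
  refine ⟨contDiff_iff_contDiffAt.2 fun p => ?_, closure_minimal (fun p hp => ?_) hS.isClosed⟩
  · by_cases hp : p ∈ S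
    · have h1 : T.indicator g =ᶠ[𝓝 p] g := by
        filter_upwards [hT.mem_nhds (hST hp)] with q hq using indicator_of_mem hq _
      exact (hg.contDiffAt (hT.mem_nhds (hST hp))).congr_of_eventuallyEq h1
    · have h1 : T.indicator g =ᶠ[𝓝 p] fun _ => 0 := by
        filter_upwards [hS.isClosed.isOpen_compl.mem_nhds hp] with q hq using hz q hq
      exact contDiffAt_const.congr_of_eventuallyEq h1
  · by_contra h
    exact hp (hz p h)

variable {n : ℕ} {X : Type*} [TopologicalSpace X] [ChartedSpace (Model n) X]
  [IsManifold (𝓡 n) ∞ X]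

theorem contDiffOn_comp_chart_symm {V : Type*} [NormedAddCommGroup V] [NormedSpace ℝ V] {u : X → V}
    (c : X) (hu : ContMDiffOn (𝓡 n) 𝓘(ℝ, V) ∞ u (chartAt (Model n) c).source) :
    ContDiffOn ℝ ∞ (u ∘ (chartAt (Model n) c).symm) (chartAt (Model n) c).target := by
  rw [← contMDiffOn_iff_contDiffOn]
  exact hu.comp (contMDiffOn_chart_symm (I := 𝓡 n)) (chartAt (Model n) c).mapsTo_symm

/-- A function on `X` in the chart at `c`, extended by zero outside the target of the chart. -/
noncomputable def inChart (n : ℕ) {X : Type*} [TopologicalSpace X] [ChartedSpace (Model n) X]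
    {V : Type*} [Zero V]
    (c : X) (u : X → V) : Model n → V :=
  (chartAt (Model n) c).target.indicator (u ∘ (chartAt (Model n) c).symm)

theorem inChart_smooth {V : Type*} [NormedAddCommGroup V] [NormedSpace ℝ V] {u : X → V}
    (c : X) (hu : ContMDiffOn (𝓡 n) 𝓘(ℝ, V) ∞ u (chartAt (Model n) c).source) {S : Set X}
    (hS : IsCompact S) (hsub : S ⊆ (chartAt (Model n) c).source) (h0 : ∀ x, x ∉ S → u x = 0) :
    ContDiff ℝ ∞ (inChart n c u) ∧ tsupport (inChart n c u) ⊆ chartAt (Model n) c '' S := by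
  refine contDiff_indicator_of_compact (chartAt (Model n) c).open_target
    (hS.image_of_continuousOn ((chartAt (Model n) c).continuousOn.mono hsub)) ?_
    (contDiffOn_comp_chart_symm c hu) fun p hp hpS => h0 _ fun h => hpS ⟨_, h, ?_⟩
  · rintro _ ⟨x, hx, rfl⟩
    exact (chartAt (Model n) c).map_source (hsub hx)
  · exact (chartAt (Model n) c).right_inv hp

/-- The coordinate vector fields are smooth. -/
theorem contMDiffOn_symmL (c : X) (v : Model n) :
    ContMDiffOn (𝓡 n) (𝓡 n).tangent ∞ (fun x : X => (TotalSpace.mk' (Model n) x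
      ((trivializationAt (Model n) (TangentSpace (𝓡 n)) c).symmL ℝ x v) : TangentBundle (𝓡 n) X))
      (chartAt (Model n) c).source := by
  have h := ((trivializationAt (Model n) (TangentSpace (𝓡 n)) c).contMDiffOn_section_baseSet_iff
    (IB := 𝓡 n) (n := ∞) (s := fun x : X =>
      ((trivializationAt (Model n) (TangentSpace (𝓡 n)) c).symmL ℝ x v))).2 ?_
  · simpa using h
  · refine (contMDiffOn_const (c := v)).congr fun x hx => ?_
    rw [Trivialization.symmL_apply _ hx]
    exact congrArg Prod.snd (Trivialization.apply_mk_symm _ hx v)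

variable [RiemannianBundle (fun x : X => TangentSpace (𝓡 n) x)]

theorem form_coordVec_contDiffOn {α : ∀ x : X, CCot n X x} (hα : IsSmoothForm α) (c : X)
    (i : Fin n) :
    ContDiffOn ℝ ∞ (fun p => α ((chartAt (Model n) c).symm p) (coordVec c p i))
      (chartAt (Model n) c).target := by
  have h : ContMDiffOn (𝓡 n) 𝓘(ℝ, ℂ) ∞ (fun x => α x ((trivializationAt (Model n)
      (TangentSpace (𝓡 n)) c).symmL ℝ x (EuclideanSpace.single i (1 : ℝ))))
      (chartAt (Model n) c).source := by
    intro x hx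
    have h1 := ContMDiffWithinAt.clm_bundle_apply ((hα x).contMDiffWithinAt
      (s := (chartAt (Model n) c).source)) (contMDiffOn_symmL c (EuclideanSpace.single i (1 : ℝ)) x
          hx)
    exact Bundle.contMDiffWithinAt_section.1 h1
  refine (contDiffOn_comp_chart_symm c h).congr fun p hp => ?_
  simp only [Function.comp, coordVec]
  rw [symmL_eq_coord c hp]

variable [IsContMDiffRiemannianBundle (𝓡 n) ∞ (Model n) (fun x : X => TangentSpace (𝓡 n) x)]

theorem gram_contDiffOn (c : X) (i j : Fin n) :
    ContDiffOn ℝ ∞ (fun p => gram c p i j) (chartAt (Model n) c).target := by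
  have h1 := (contMDiffOn_symmL c (EuclideanSpace.single i (1 : ℝ))).inner_bundle
    (contMDiffOn_symmL c (EuclideanSpace.single j (1 : ℝ)))
  refine (contDiffOn_comp_chart_symm c h1).congr fun p hp => ?_
  simp only [gram, Matrix.of_apply, coordVec, Function.comp]
  rw [symmL_eq_coord c hp, symmL_eq_coord c hp]

theorem gram_det_pos (c : X) {p : Model n} (hp : p ∈ (chartAt (Model n) c).target) :
    0 < (gram c p).det := Real.sqrt_pos.1 (density_pos c hp)

theorem contDiffOn_det {m : Type*} [Fintype m] [DecidableEq m] {V : Type*} [NormedAddCommGroup V]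
    [NormedSpace ℝ V] {T : Set V} {G : V → Matrix m m ℝ}
    (hG : ∀ i j, ContDiffOn ℝ ∞ (fun p => G p i j) T) : ContDiffOn ℝ ∞ (fun p => (G p).det) T := by
  simp only [Matrix.det_apply]
  exact ContDiffOn.sum fun σ _ => (contDiffOn_prod fun i _ => hG _ _).const_smul _

theorem density_contDiffOn (c : X) :
    ContDiffOn ℝ ∞ (density c) (chartAt (Model n) c).target :=
  (contDiffOn_det fun i j => gram_contDiffOn c i j).sqrt fun _ hp => (gram_det_pos c hp).ne'

theorem gram_inv_contDiffOn (c : X) (i j : Fin n) :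
    ContDiffOn ℝ ∞ (fun p => (gram c p)⁻¹ i j) (chartAt (Model n) c).target := by
  simp only [Matrix.inv_def, Ring.inverse_eq_inv', Matrix.smul_apply, smul_eq_mul,
    Matrix.adjugate_apply]
  refine ((contDiffOn_det fun i j => gram_contDiffOn c i j).inv
    fun _ hp => (gram_det_pos c hp).ne').mul (contDiffOn_det fun k l => ?_)
  simp only [Matrix.updateRow_apply]
  by_cases h : k = j
  · simp only [h, if_true]
    exact contDiffOn_const
  · simp only [h, if_false]
    exact gram_contDiffOn c k l

/-- The coordinate vectors `∂_i` form a basis of the tangent space. -/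
theorem exists_basis_coordVec (c : X) {p : Model n} (hp : p ∈ (chartAt (Model n) c).target) :
    ∃ b : Module.Basis (Fin n) ℝ (TangentSpace (𝓡 n) ((chartAt (Model n) c).symm p)),
      ∀ i, b i = coordVec c p i := by
  let e := trivializationAt (Model n) (TangentSpace (𝓡 n) : X → Type _) c
  have hx : (chartAt (Model n) c).symm p ∈ e.baseSet := by
    simpa [e] using (chartAt (Model n) c).map_target hp
  refine ⟨e.basisAt (EuclideanSpace.basisFun (Fin n) ℝ).toBasis hx, fun i => ?_⟩
  have h1 := symmL_eq_coord c hp (EuclideanSpace.single i (1 : ℝ))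
  rw [Trivialization.symmL_apply _ hx] at h1
  rw [coordVec, ← h1]
  simp [Bundle.Trivialization.basisAt]

theorem cotInner_eq_gram (c : X) {p : Model n} (hp : p ∈ (chartAt (Model n) c).target)
    (α β : CCot n X ((chartAt (Model n) c).symm p)) :
    cotInner _ α β = ∑ k, ∑ l, (((gram c p)⁻¹ k l : ℝ) : ℂ) *
      (starRingEnd ℂ (α (coordVec c p k)) * β (coordVec c p l)) := by
  obtain ⟨b, hb⟩ := exists_basis_coordVec c hp
  have h := sum_orthonormal_eq_gram
    (stdOrthonormalBasis ℝ (TangentSpace (𝓡 n) ((chartAt (Model n) c).symm p))) b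
    (α : TangentSpace (𝓡 n) ((chartAt (Model n) c).symm p) →ₗ[ℝ] ℂ)
    (β : TangentSpace (𝓡 n) ((chartAt (Model n) c).symm p) →ₗ[ℝ] ℂ)
  simp only [hb] at h
  exact h

theorem cotInner_contDiffOn {α β : ∀ x : X, CCot n X x} (hα : IsSmoothForm α)
    (hβ : IsSmoothForm β) (c : X) :
    ContDiffOn ℝ ∞ (fun p => cotInner _ (α ((chartAt (Model n) c).symm p)) (β _))
      (chartAt (Model n) c).target := by
  refine ContDiffOn.congr ?_ fun p hp => cotInner_eq_gram c hp _ _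
  refine ContDiffOn.sum fun k _ => ContDiffOn.sum fun l _ => ?_
  exact (Complex.ofRealCLM.contDiff.comp_contDiffOn (gram_inv_contDiffOn c k l)).mul
    ((Complex.conjCLE.contDiff.comp_contDiffOn (form_coordVec_contDiffOn hα c k)).mul
      (form_coordVec_contDiffOn hβ c l))

theorem cotInner_self (x : X) (α : CCot n X x) :
    cotInner x α α =
      ((∑ i, ‖α (stdOrthonormalBasis ℝ (TangentSpace (𝓡 n) x) i)‖ ^ 2 : ℝ) : ℂ) := by
  simp [cotInner, Complex.conj_mul']

/-- The Cauchy–Schwarz inequality between covectors and vectors. -/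
theorem norm_apply_sq_le (x : X) (α : CCot n X x) (v : TangentSpace (𝓡 n) x) :
    ‖α v‖ ^ 2 ≤ (cotInner x α α).re * inner ℝ v v := by
  rw [cotInner_self, Complex.ofReal_re]
  set b := stdOrthonormalBasis ℝ (TangentSpace (𝓡 n) x)
  have h1 : α v = ∑ i, b.repr v i • α (b i) := by
    conv_lhs => rw [← b.sum_repr v]
    rw [map_sum]
    exact Finset.sum_congr rfl fun i _ => map_smul α _ _
  have h2 : (inner ℝ v v : ℝ) = ∑ i, (b.repr v i) ^ 2 := by
    rw [real_inner_self_eq_norm_sq, ← b.repr.norm_map, EuclideanSpace.norm_sq_eq]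
    simp
  calc ‖α v‖ ^ 2 ≤ (∑ i, ‖α (b i)‖ * |b.repr v i|) ^ 2 := by
        gcongr
        rw [h1]
        refine (norm_sum_le _ _).trans (Finset.sum_le_sum fun i _ => ?_)
        rw [norm_smul, Real.norm_eq_abs, mul_comm]
    _ ≤ _ := by
        refine (Finset.sum_mul_sq_le_sq_mul_sq _ _ _).trans ?_
        rw [h2]
        simp

variable [MeasurableSpace X] [BorelSpace X]

theorem restrict_source_eq_chartVolume (c : X) :
    (riemannianVolume n X).restrict (chartAt (Model n) c).source = chartVolume (n := n) c := by
  ext A hA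
  have hs := (chartAt (Model n) c).open_source.measurableSet
  rw [Measure.restrict_apply hA, riemannianVolume_apply_of_subset_source c (hA.inter hs)
    inter_subset_right]
  have h0 : chartVolume (n := n) c (A \ (chartAt (Model n) c).source) = 0 :=
    measure_mono_null (fun x hx => hx.2) (chartVolume_compl c)
  rw [← measure_inter_add_sdiff A hs, h0, add_zero]

/-- Integration in a chart: `∫ f dvol = ∫ √(det g_ij) f dp` if `f` vanishes outside the chart. -/
theorem integral_eq_chart {V : Type*} [NormedAddCommGroup V] [NormedSpace ℝ V] (c : X) {f : X → V}
    (hf : AEStronglyMeasurable f (riemannianVolume n X))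
    (h0 : ∀ x, x ∉ (chartAt (Model n) c).source → f x = 0) :
    ∫ x, f x ∂(riemannianVolume n X) =
      ∫ p in (chartAt (Model n) c).target, density c p • f ((chartAt (Model n) c).symm p) := by
  have hT := (chartAt (Model n) c).open_target.measurableSet
  have hsm : AEMeasurable (chartAt (Model n) c).symm
      ((volume.restrict (chartAt (Model n) c).target).withDensity
    fun p => ENNReal.ofReal (density c p)) :=
    ((chartAt (Model n) c).continuousOn_symm.aemeasurable hT).mono_ac
      (withDensity_absolutelyContinuous _ _)
  rw [← setIntegral_eq_integral_of_forall_compl_eq_zero h0, restrict_source_eq_chartVolume]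
  have hf' := hf.restrict (s := (chartAt (Model n) c).source)
  rw [restrict_source_eq_chartVolume, chartVolume] at hf'
  rw [chartVolume, integral_map hsm hf']
  have hd : AEMeasurable (fun p => (density c p).toNNReal)
      (volume.restrict (chartAt (Model n) c).target) :=
    ((density_continuousOn c).aemeasurable hT).real_toNNReal
  rw [show (fun p => ENNReal.ofReal (density c p)) =
    fun p => (((density c p).toNNReal : NNReal) : ℝ≥0∞) from rfl,
    integral_withDensity_eq_integral_smul₀ hd]
  refine setIntegral_congr_fun hT fun p hp => ?_
  rw [NNReal.smul_def, Real.coe_toNNReal _ (density_pos c hp).le]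

end Chart

/-! ### Cutoff functions and local frames -/

section Frame

open Filter

variable {n : ℕ} {X : Type*} [TopologicalSpace X] [ChartedSpace (Model n) X]
  [IsManifold (𝓡 n) ∞ X]

theorem exists_cutoff [T2Space X] [SecondCountableTopology X] {K O : Set X} (hK : IsCompact K)
    (hO : IsOpen O) (hKO : K ⊆ O) : ∃ χ : X → ℝ, ContMDiff (𝓡 n) 𝓘(ℝ, ℝ) ∞ χ ∧ HasCompactSupport χ ∧
      tsupport χ ⊆ O ∧ (∀ᶠ x in 𝓝ˢ K, χ x = 1) ∧ ∀ x, χ x ∈ Icc (0 : ℝ) 1 := by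
  have := ChartedSpace.locallyCompactSpace (Model n) X
  obtain ⟨L, hL, hKL, hLO⟩ := exists_compact_between hK hO hKO
  obtain ⟨f, h1, h0, hI⟩ := exists_contMDiffMap_one_nhds_of_subset_interior (𝓡 n) (n := (⊤ : ℕ∞))
    hK.isClosed hKL
  have hsub : tsupport f ⊆ L := closure_minimal (fun x hx => by
    by_contra h
    exact hx (h0 x h)) hL.isClosed
  exact ⟨f, f.contMDiff, hL.of_isClosed_subset (isClosed_tsupport _) hsub, hsub.trans hLO, h1, hI⟩

theorem contMDiff_ofReal {g : X → ℝ} (hg : ContMDiff (𝓡 n) 𝓘(ℝ, ℝ) ∞ g) :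
    ContMDiff (𝓡 n) 𝓘(ℝ, ℂ) ∞ fun x => (g x : ℂ) :=
  Complex.ofRealCLM.contDiff.contMDiff.comp hg

theorem ofReal_mem_testFunctions {g : X → ℝ} (hg : ContMDiff (𝓡 n) 𝓘(ℝ, ℝ) ∞ g)
    (hc : HasCompactSupport g) : (fun x => (g x : ℂ)) ∈ testFunctions n
        (⊤ : TopologicalSpace.Opens X) :=
  ⟨contMDiff_ofReal hg, hc.comp_left (g := fun t : ℝ => (t : ℂ)) Complex.ofReal_zero, subset_univ _⟩

theorem contMDiff_complex_mul {u v : X → ℂ} (hu : ContMDiff (𝓡 n) 𝓘(ℝ, ℂ) ∞ u)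
    (hv : ContMDiff (𝓡 n) 𝓘(ℝ, ℂ) ∞ v) : ContMDiff (𝓡 n) 𝓘(ℝ, ℂ) ∞ fun x => u x * v x :=
  (contDiff_mul (𝕜 := ℝ) (𝔸 := ℂ)).contMDiff.comp (hu.prodMk_space hv)

theorem ofReal_mul_mem_testFunctions {U U' : TopologicalSpace.Opens X} {g : X → ℝ}
    (hg : ContMDiff (𝓡 n) 𝓘(ℝ, ℝ) ∞ g) {u : X → ℂ} (hu : u ∈ testFunctions n U)
    (hsub : tsupport g ⊆ U') : (fun x => (g x : ℂ) * u x) ∈ testFunctions n U' := by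
  refine ⟨contMDiff_complex_mul (contMDiff_ofReal hg) hu.1, hu.2.1.mul_left, ?_⟩
  refine (closure_mono fun x hx => ?_).trans hsub
  intro h
  exact hx (by simp [h])

theorem IsSmoothForm.real_smul {α : ∀ x : X, CCot n X x} (hα : IsSmoothForm α) {g : X → ℝ}
    (hg : ContMDiff (𝓡 n) 𝓘(ℝ, ℝ) ∞ g) : IsSmoothForm fun x => (g x : ℂ) • α x := by
  have h := ContMDiff.smul_section hg hα
  refine h.congr fun x => ?_
  congr 1

theorem diff_mul {u v : X → ℂ} {x : X} (hu : ContMDiff (𝓡 n) 𝓘(ℝ, ℂ) ∞ u)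
    (hv : ContMDiff (𝓡 n) 𝓘(ℝ, ℂ) ∞ v) :
    diff n (fun y => u y * v y) x = u x • diff n v x + v x • diff n u x := by
  have h1 := (hu.mdifferentiableAt (x := x) (by simp)).hasMFDerivAt
  have h2 := (hv.mdifferentiableAt (x := x) (by simp)).hasMFDerivAt
  exact (h1.mul h2).mfderiv

theorem diff_congr {u v : X → ℂ} {x : X} (h : u =ᶠ[𝓝 x] v) : diff n u x = diff n v x :=
  h.mfderiv_eq

/-- The derivative at `x` of the preferred chart at `c`. -/
noncomputable def chartDeriv (c x : X) : Tan n X x →L[ℝ] Model n :=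
  mfderiv (𝓡 n) (𝓡 n) (chartAt (Model n) c) x

theorem chartDeriv_surjective (c : X) {x : X} (hx : x ∈ (chartAt (Model n) c).source) :
    Function.Surjective (chartDeriv (n := n) c x) :=
  (mdifferentiable_of_mem_atlas (I := 𝓡 n) (chart_mem_atlas (Model n) c)).mfderiv_surjective hx

theorem diff_eq_in_chart (c : X) {x : X} (hx : x ∈ (chartAt (Model n) c).source) {v : X → ℂ}
    (hv : ContMDiff (𝓡 n) 𝓘(ℝ, ℂ) ∞ v) (t : Tan n X x) :
    diff n v x t = fderiv ℝ (v ∘ (chartAt (Model n) c).symm) (chartAt (Model n) c x)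
      (chartDeriv c x t) := by
  set φ := chartAt (Model n) c
  have h1 : MDifferentiableAt (𝓡 n) (𝓡 n) φ x := mdifferentiableAt_atlas (chart_mem_atlas _ c) hx
  have h2 : DifferentiableAt ℝ (v ∘ φ.symm) (φ x) :=
    ((contDiffOn_comp_chart_symm c hv.contMDiffOn).contDiffAt
      (φ.open_target.mem_nhds (φ.map_source hx))).differentiableAt (by simp)
  have h3 : v =ᶠ[𝓝 x] (v ∘ φ.symm) ∘ φ := by
    filter_upwards [φ.open_source.mem_nhds hx] with y hy
    simp [φ.left_inv hy]
  have h4 := h2.hasFDerivAt.hasMFDerivAt.comp x h1.hasMFDerivAt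
  rw [diff_congr h3]
  exact congrArg (fun L : Model n →L[ℝ] ℂ => L t) h4.mfderiv

theorem clm_eq_sum_single (L : Model n →L[ℝ] ℂ) (τ : Model n) :
    L τ = ∑ k, (τ k : ℂ) * L (EuclideanSpace.single k (1 : ℝ)) := by
  conv_lhs => rw [← (EuclideanSpace.basisFun (Fin n) ℝ).sum_repr τ, map_sum]
  simp

namespace FirstOrderOperator

variable (D : FirstOrderOperator n X)

theorem toForm_congr {u v : X → ℂ} {x : X} (h : u =ᶠ[𝓝 x] v) : D.toForm u x = D.toForm v x := by
  rw [toForm, toForm, diff_congr h, h.self_of_nhds]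

theorem toForm_one (x : X) : D.toForm (fun _ => 1) x = D.potential x := by
  have h : diff n (fun _ : X => (1 : ℂ)) x = 0 := mfderiv_const
  rw [toForm, h, map_zero, one_smul, zero_add]

theorem toForm_mul {u v : X → ℂ} (hu : ContMDiff (𝓡 n) 𝓘(ℝ, ℂ) ∞ u)
    (hv : ContMDiff (𝓡 n) 𝓘(ℝ, ℂ) ∞ v) (x : X) :
    D.toForm (fun y => u y * v y) x = u x • D.toForm v x + v x • D.symbol x (diff n u x) := by
  rw [toForm, toForm, diff_mul hu hv, map_add, map_smul, map_smul, smul_add, mul_smul]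
  abel

/-- `σ(dg)` is a smooth form, for `g` smooth with compact support: it equals `D g - g D χ`, where
`χ = 1` near the support of `g`. -/
theorem isSmoothForm_symbol_diff [T2Space X] [SecondCountableTopology X] {g : X → ℝ}
    (hg : ContMDiff (𝓡 n) 𝓘(ℝ, ℝ) ∞ g) (hc : HasCompactSupport g) :
    IsSmoothForm fun x => D.symbol x (diff n (fun y => (g y : ℂ)) x) := by
  obtain ⟨χ, h1, h2, -, h3, -⟩ := exists_cutoff (n := n) hc isOpen_univ (subset_univ _)
  have h4 : ∀ x ∈ tsupport g, D.toForm (fun y => (χ y : ℂ)) x = D.potential x := by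
    intro x hx
    have h5 : (fun y => (χ y : ℂ)) =ᶠ[𝓝 x] fun _ => 1 := by
      filter_upwards [h3.filter_mono (nhds_le_nhdsSet hx)] with y hy
      simp [hy]
    rw [D.toForm_congr h5, toForm_one]
  have h6 : (fun x => D.symbol x (diff n (fun y => (g y : ℂ)) x)) =
      (fun x => D.toForm (fun y => (g y : ℂ)) x) +
        (-1 : ℂ) • fun x => (g x : ℂ) • D.toForm (fun y => (χ y : ℂ)) x := by
    funext x
    simp only [Pi.add_apply, Pi.smul_apply]
    by_cases hx : x ∈ tsupport g
    · rw [h4 x hx, toForm]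
      module
    · rw [image_eq_zero_of_notMem_tsupport hx, D.toForm_congr (v := fun _ => 0), toForm,
        diff_congr (v := fun _ => 0), diff, mfderiv_const]
      · simp
      all_goals
        filter_upwards [notMem_tsupport_iff_eventuallyEq.1 hx] with y hy
        exact congrArg _ hy
  rw [h6]
  exact (D.smooth _ (ofReal_mem_testFunctions hg hc)).add
    (((D.smooth _ (ofReal_mem_testFunctions h1 h2)).real_smul hg).smul _)

/-- Near each point `c`, the operator has the form `D v = ∑ k, ∂_k v • s k + v • β` in the chart
at `c`, with smooth forms `s k` (the values of the symbol on the coordinate covectors) and `β`.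
They are read off from the values of `D` on cut off coordinate functions, which makes them smooth. -/
theorem exists_local_form [T2Space X] [SecondCountableTopology X] (hD : D.HasInjectiveSymbol)
    (c : X) :
    ∃ W ∈ 𝓝 c, IsOpen W ∧ W ⊆ (chartAt (Model n) c).source ∧
      ∃ (s : Fin n → ∀ x : X, CCot n X x) (β : ∀ x : X, CCot n X x),
        (∀ k, IsSmoothForm (s k)) ∧ IsSmoothForm β ∧
        (∀ v : X → ℂ, ContMDiff (𝓡 n) 𝓘(ℝ, ℂ) ∞ v → ∀ x ∈ W, D.toForm v x =
          ∑ k, fderiv ℝ (v ∘ (chartAt (Model n) c).symm) (chartAt (Model n) c x)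
            (EuclideanSpace.single k (1 : ℝ)) • s k x + v x • β x) ∧
        ∀ x ∈ W, ∀ ξ : Model n, ξ ≠ 0 → ∑ k, (ξ k : ℂ) • s k x ≠ 0 := by
  set φ := chartAt (Model n) c with hφ
  obtain ⟨χ, hχ, hχc, hχs, hχ1, -⟩ := exists_cutoff (n := n) (isCompact_singleton (x := c))
      φ.open_source
    (singleton_subset_iff.2 (mem_chart_source _ c))
  rw [nhdsSet_singleton] at hχ1
  have hη : ∀ k : Fin n, ContMDiff (𝓡 n) 𝓘(ℝ, ℝ) ∞ fun x => χ x * (φ x) k := by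
    intro k x
    by_cases hx : x ∈ φ.source
    · have h1 : ContMDiffAt (𝓡 n) (𝓡 n) ∞ φ x :=
        (contMDiffOn_chart (I := 𝓡 n)).contMDiffAt (φ.open_source.mem_nhds hx)
      have h2 : ContMDiffAt (𝓡 n) 𝓘(ℝ, ℝ) ∞ (fun x => (φ x) k) x :=
        ((EuclideanSpace.proj k : Model n →L[ℝ] ℝ).contDiff.contMDiff.contMDiffAt).comp x h1
      exact (hχ x).mul h2
    · have h1 : (fun x => χ x * (φ x) k) =ᶠ[𝓝 x] fun _ => 0 := by
        filter_upwards [notMem_tsupport_iff_eventuallyEq.1 fun h => hx (hχs h)] with y hy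
        simp [hy]
      exact contMDiffAt_const.congr_of_eventuallyEq h1
  have hηc : ∀ k : Fin n, HasCompactSupport fun x => χ x * (φ x) k := fun k => hχc.mul_right
  obtain ⟨W, hW, hWo, hcW⟩ := eventually_nhds_iff.1
      (hχ1.and (φ.open_source.mem_nhds (mem_chart_source _ c)))
  -- the differential of the cut off coordinate function is the coordinate covector on `W`
  have hdη : ∀ x ∈ W, ∀ (k : Fin n) (t : Tan n X x),
      diff n (fun y => ((χ y * (φ y) k : ℝ) : ℂ)) x t =
        ((chartDeriv c x t) k : ℂ) := by
    intro x hx k t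
    have hxs := (hW x hx).2
    rw [diff_eq_in_chart c hxs (contMDiff_ofReal (hη k))]
    have h1 : (fun y => ((χ y * (φ y) k : ℝ) : ℂ)) ∘ φ.symm =ᶠ[𝓝 (φ x)]
        (Complex.ofRealCLM ∘L (EuclideanSpace.proj k : Model n →L[ℝ] ℝ)) := by
      have h2 : ∀ᶠ p in 𝓝 (φ x), φ.symm p ∈ W := by
        refine (φ.continuousAt_symm (φ.map_source hxs)).eventually ?_
        rw [φ.left_inv hxs]
        exact hWo.mem_nhds hx
      filter_upwards [h2, φ.open_target.mem_nhds (φ.map_source hxs)] with p hp hpt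
      simp [(hW _ hp).1, φ.right_inv hpt]
    rw [h1.fderiv_eq, ContinuousLinearMap.fderiv]
    rfl
  refine ⟨W, hWo.mem_nhds hcW, hWo, fun x hx => (hW x hx).2,
    fun k x => D.symbol x (diff n (fun y => ((χ y * (φ y) k : ℝ) : ℂ)) x),
    fun x => D.toForm (fun y => (χ y : ℂ)) x, fun k => D.isSmoothForm_symbol_diff (hη k) (hηc k),
    D.smooth _ (ofReal_mem_testFunctions hχ hχc), fun v hv x hx => ?_, fun x hx ξ hξ h0 => ?_⟩
  · have hxs := (hW x hx).2
    have h1 : diff n v x = ∑ k, fderiv ℝ (v ∘ φ.symm) (φ x) (EuclideanSpace.single k (1 : ℝ)) •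
        diff n (fun y => ((χ y * (φ y) k : ℝ) : ℂ)) x := by
      refine ContinuousLinearMap.ext fun t => ?_
      rw [diff_eq_in_chart c hxs hv, clm_eq_sum_single]
      have h2 := sum_apply Finset.univ (fun k => fderiv ℝ (v ∘ φ.symm) (φ x)
          (EuclideanSpace.single k (1 : ℝ)) •
        diff n (fun y => ((χ y * (φ y) k : ℝ) : ℂ)) x) t
      refine Eq.trans (Finset.sum_congr rfl fun k _ => ?_) h2.symm
      rw [mul_comm, ← hdη x hx k t]
      rfl
    have h3 : (fun y => (χ y : ℂ)) =ᶠ[𝓝 x] fun _ => 1 := by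
      filter_upwards [hWo.mem_nhds hx] with y hy
      simp [(hW y hy).1]
    have h4 : D.toForm (fun y => (χ y : ℂ)) x = D.potential x := by
      rw [D.toForm_congr h3, toForm_one]
    simp only [h4]
    rw [toForm, h1, map_sum]
    simp only [map_smul]
  · have hxs := (hW x hx).2
    let ζ : Tan n X x →L[ℝ] ℝ := (innerSL ℝ ξ).comp (chartDeriv c x)
    have h1 : complexify ζ = ∑ k, (ξ k : ℂ) • diff n (fun y => ((χ y * (φ y) k : ℝ) : ℂ)) x := by
      refine ContinuousLinearMap.ext fun t => ?_
      have h2 := sum_apply Finset.univ (fun k => (ξ k : ℂ) •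
        diff n (fun y => ((χ y * (φ y) k : ℝ) : ℂ)) x) t
      refine Eq.trans ?_ h2.symm
      have h3 : complexify ζ t = ((inner ℝ ξ (chartDeriv c x t) : ℝ) : ℂ) := rfl
      rw [h3, PiLp.inner_apply, Complex.ofReal_sum]
      refine Finset.sum_congr rfl fun k _ => ?_
      have h4 : ((ξ k : ℂ) • diff n (fun y => ((χ y * (φ y) k : ℝ) : ℂ)) x) t =
        (ξ k : ℂ) * ((chartDeriv c x t) k : ℂ) := by
        rw [← hdη x hx k t]
        rfl
      refine Eq.trans ?_ h4.symm
      simp [mul_comm]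
    have h2 : ζ ≠ 0 := by
      intro h
      obtain ⟨t, ht⟩ := chartDeriv_surjective c hxs ξ
      have h3 : ζ t = inner ℝ ξ ξ := congrArg (inner ℝ ξ) ht
      rw [h] at h3
      exact hξ (inner_self_eq_zero.1 h3.symm)
    have h3 := hD x ζ h2
    simp only [h1, map_sum, map_smul] at h3
    simp only at h0
    have h4 := h3 (a₁ := 1) (a₂ := 0) (by
      change (1 : ℂ) • _ = (0 : ℂ) • _
      rw [h0, smul_zero, smul_zero])
    exact one_ne_zero h4

end FirstOrderOperator

end Frame

/-! ### The formal adjoint -/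

section FormalAdjoint

open Filter

variable {n : ℕ} {X : Type*} [TopologicalSpace X] [T2Space X] [SecondCountableTopology X]
  [ChartedSpace (Model n) X] [IsManifold (𝓡 n) ∞ X]
  [RiemannianBundle (fun x : X => TangentSpace (𝓡 n) x)]
  [IsContMDiffRiemannianBundle (𝓡 n) ∞ (Model n) (fun x : X => TangentSpace (𝓡 n) x)]
  [MeasurableSpace X] [BorelSpace X]

/-- Integrals in a chart against a continuous compactly supported function are `L²` pairings
with a continuous compactly supported function on the manifold. -/
theorem exists_pairing_of_chart (c : X) {h : Model n → ℂ} (hh : Continuous h) {S : Set (Model n)}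
    (hS : IsCompact S) (hST : S ⊆ (chartAt (Model n) c).target) (h0 : ∀ p, p ∉ S → h p = 0) :
    ∃ v : X → ℂ, Continuous v ∧ HasCompactSupport v ∧ ∀ u : X → ℂ, Continuous u →
      ∫ p, h p * u ((chartAt (Model n) c).symm p) =
        ∫ x, starRingEnd ℂ (v x) * u x ∂(riemannianVolume n X) := by
  set φ := chartAt (Model n) c with hφ
  let v : X → ℂ := φ.source.indicator fun x => starRingEnd ℂ (h (φ x)) / (density c (φ x) : ℂ)
  have hK : IsCompact (φ.symm '' S) := hS.image_of_continuousOn (φ.continuousOn_symm.mono hST)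
  have hv0 : ∀ x, x ∉ φ.symm '' S → v x = 0 := by
    intro x hx
    by_cases hxs : x ∈ φ.source
    · have : φ x ∉ S := fun h => hx ⟨_, h, φ.left_inv hxs⟩
      simp [v, indicator_of_mem hxs, h0 _ this]
    · exact indicator_of_notMem hxs _
  have hvc : Continuous v := by
    rw [continuous_iff_continuousAt]
    intro x
    by_cases hx : x ∈ φ.symm '' S
    · have hxs : x ∈ φ.source := by
        obtain ⟨p, hp, rfl⟩ := hx
        exact φ.map_target (hST hp)
      have h1 : v =ᶠ[𝓝 x] fun x => starRingEnd ℂ (h (φ x)) / (density c (φ x) : ℂ) := by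
        filter_upwards [φ.open_source.mem_nhds hxs] with y hy using indicator_of_mem hy _
      refine ContinuousAt.congr ?_ h1.symm
      have h2 : ContinuousAt φ x := φ.continuousAt hxs
      have h3 : ContinuousAt (density c) (φ x) :=
        (density_continuousOn c).continuousAt (φ.open_target.mem_nhds (φ.map_source hxs))
      refine ContinuousAt.div ?_ ?_ ?_
      · exact Complex.continuous_conj.continuousAt.comp (hh.continuousAt.comp h2)
      · exact Complex.continuous_ofReal.continuousAt.comp
            (ContinuousAt.comp (f := φ) (g := density c) h3 h2)
      · exact_mod_cast (density_pos c (φ.map_source hxs)).ne'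
    · have h1 : v =ᶠ[𝓝 x] fun _ => 0 := by
        filter_upwards [hK.isClosed.isOpen_compl.mem_nhds hx] with y hy using hv0 y hy
      exact continuousAt_const.congr h1.symm
  refine ⟨v, hvc, HasCompactSupport.intro hK hv0, fun u hu => ?_⟩
  rw [integral_eq_chart c (f := fun x => starRingEnd ℂ (v x) * u x)
    ((Complex.continuous_conj.comp hvc).mul hu).aestronglyMeasurable]
  · rw [← setIntegral_eq_integral_of_forall_compl_eq_zero (s := φ.target)]
    · refine setIntegral_congr_fun φ.open_target.measurableSet fun p hp => ?_
      have h1 : (density c p : ℂ) ≠ 0 := by exact_mod_cast (density_pos c hp).ne'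
      simp only [v, indicator_of_mem (φ.map_target hp), φ.right_inv hp, ← hφ, Complex.real_smul]
      simp
      field_simp
    · intro p hp
      rw [h0 p fun h => hp (hST h), zero_mul]
  · intro x hx
    have h1 : v x = 0 := indicator_of_notMem hx _
    rw [h1, map_zero, zero_mul]

/-- `θ` lies in the domain of the formal adjoint of `D`, with a continuous compactly supported
function as its image. -/
def FirstOrderOperator.HasFormalAdjoint (D : FirstOrderOperator n X) (θ : ∀ x : X, CCot n X x) :
    Prop :=
  ∃ v : X → ℂ, Continuous v ∧ HasCompactSupport v ∧
    ∀ u ∈ testFunctions n (⊤ : TopologicalSpace.Opens X),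
      ∫ x, cotInner x (θ x) (D.toForm u x) ∂(riemannianVolume n X) =
        ∫ x, starRingEnd ℂ (v x) * u x ∂(riemannianVolume n X)

theorem cotInner_add_left (x : X) (α α' β : CCot n X x) :
    cotInner x (α + α') β = cotInner x α β + cotInner x α' β := by
  simp [cotInner, add_mul, Finset.sum_add_distrib]

theorem cotInner_add_right (x : X) (α β β' : CCot n X x) :
    cotInner x α (β + β') = cotInner x α β + cotInner x α β' := by
  simp [cotInner, mul_add, Finset.sum_add_distrib]

theorem cotInner_smul_right (x : X) (z : ℂ) (α β : CCot n X x) :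
    cotInner x α (z • β) = z * cotInner x α β := by
  have h : ∀ t, (z • β) t = z * β t := fun _ => rfl
  simp only [cotInner, h, Finset.mul_sum]
  exact Finset.sum_congr rfl fun i _ => by ring

theorem cotInner_zero_left (x : X) (β : CCot n X x) : cotInner x 0 β = 0 := by
  simp [cotInner]

theorem cotInner_sum_right {ι : Type*} (s : Finset ι) (x : X) (α : CCot n X x)
    (β : ι → CCot n X x) : cotInner x α (∑ i ∈ s, β i) = ∑ i ∈ s, cotInner x α (β i) := by
  classical
  induction s using Finset.induction_on with
  | empty => simp [cotInner]
  | insert a s ha ih => rw [Finset.sum_insert ha, Finset.sum_insert ha, cotInner_add_right, ih]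

variable (D : FirstOrderOperator n X)

theorem hasFormalAdjoint_add {θ η : ∀ x : X, CCot n X x} (hθ : IsSmoothForm θ)
    (hθc : IsCompact (closure {x | θ x ≠ 0})) (hη : IsSmoothForm η)
    (hηc : IsCompact (closure {x | η x ≠ 0})) (h1 : D.HasFormalAdjoint θ)
    (h2 : D.HasFormalAdjoint η) : D.HasFormalAdjoint (θ + η) := by
  obtain ⟨v, hv, hvc, hv'⟩ := h1
  obtain ⟨w, hw, hwc, hw'⟩ := h2
  have key : ∀ {θ : ∀ x : X, CCot n X x}, IsSmoothForm θ → IsCompact (closure {x | θ x ≠ 0}) →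
      ∀ u ∈ testFunctions n (⊤ : TopologicalSpace.Opens X),
      Integrable (fun x => cotInner x (θ x) (D.toForm u x)) (riemannianVolume n X) := by
    intro θ hθ hθc u hu
    refine (cotInner_continuous hθ (D.smooth u hu)).integrable_of_hasCompactSupport
      (HasCompactSupport.intro hθc fun x hx => ?_)
    have : θ x = 0 := by
      by_contra h
      exact hx (subset_closure h)
    rw [this, cotInner_zero_left]
  refine ⟨v + w, hv.add hw, hvc.add hwc, fun u hu => ?_⟩
  have h3 : ∀ {v : X → ℂ}, Continuous v → HasCompactSupport v →
      Integrable (fun x => starRingEnd ℂ (v x) * u x) (riemannianVolume n X) := fun hv hvc =>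
    ((Complex.continuous_conj.comp hv).mul hu.1.continuous).integrable_of_hasCompactSupport
      hu.2.1.mul_left
  simp only [Pi.add_apply, cotInner_add_left, map_add, add_mul]
  rw [integral_add (key hθ hθc u hu) (key hη hηc u hu), integral_add (h3 hv hvc) (h3 hw hwc),
    hv' u hu, hw' u hu]

/-- Integration by parts in a chart, for forms supported where `D` has a local form. -/
theorem hasFormalAdjoint_of_subset_chart (c : X) {W : Set X}
    (hWs : W ⊆ (chartAt (Model n) c).source) {s : Fin n → ∀ x : X, CCot n X x}
    {β : ∀ x : X, CCot n X x} (hs : ∀ k, IsSmoothForm (s k)) (hβ : IsSmoothForm β)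
    (hform : ∀ v : X → ℂ, ContMDiff (𝓡 n) 𝓘(ℝ, ℂ) ∞ v → ∀ x ∈ W, D.toForm v x =
      ∑ k, fderiv ℝ (v ∘ (chartAt (Model n) c).symm) (chartAt (Model n) c x)
        (EuclideanSpace.single k (1 : ℝ)) • s k x + v x • β x)
    {θ : ∀ x : X, CCot n X x} (hθ : IsSmoothForm θ) (hθc : IsCompact (closure {x | θ x ≠ 0}))
    (hθW : closure {x | θ x ≠ 0} ⊆ W) : D.HasFormalAdjoint θ := by
  set φ := chartAt (Model n) c with hφ
  set S := closure {x | θ x ≠ 0} with hS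
  have hθ0 : ∀ x, x ∉ S → θ x = 0 := by
    intro x hx
    by_contra h
    exact hx (subset_closure h)
  have hSs : S ⊆ φ.source := hθW.trans hWs
  obtain ⟨χ, hχ, hχc, hχs, hχ1, -⟩ := exists_cutoff (n := n) hθc φ.open_source hSs
  have hSc : IsCompact (φ '' S) := hθc.image_of_continuousOn (φ.continuousOn.mono hSs)
  have hST : φ '' S ⊆ φ.target := by
    rintro _ ⟨x, hx, rfl⟩
    exact φ.map_source (hSs hx)
  have hnot : ∀ p ∈ φ.target, p ∉ φ '' S → θ (φ.symm p) = 0 := fun p hp hpS =>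
    hθ0 _ fun h => hpS ⟨_, h, φ.right_inv hp⟩
  -- the coefficients of the integrand, with the Riemannian density
  let E : (∀ x : X, CCot n X x) → Model n → ℂ := fun α => φ.target.indicator fun p =>
    (density c p : ℂ) * cotInner _ (θ (φ.symm p)) (α (φ.symm p))
  have hE : ∀ α, IsSmoothForm α → ContDiff ℝ ∞ (E α) ∧ tsupport (E α) ⊆ φ '' S := by
    intro α hα
    refine contDiff_indicator_of_compact φ.open_target hSc hST
      ((Complex.ofRealCLM.contDiff.comp_contDiffOn (density_contDiffOn c)).mul
        (cotInner_contDiffOn hθ hα c)) fun p hp hpS => ?_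
    change (density c p : ℂ) * cotInner _ (θ (φ.symm p)) (α (φ.symm p)) = 0
    rw [hnot p hp hpS, cotInner_zero_left, mul_zero]
  have hEc : ∀ α, IsSmoothForm α → HasCompactSupport (E α) := fun α hα =>
    hSc.of_isClosed_subset (isClosed_tsupport _) (hE α hα).2
  let e : Fin n → Model n := fun k => EuclideanSpace.single k (1 : ℝ)
  -- the formal adjoint of `D` on `θ`, up to conjugation and the density
  let h : Model n → ℂ := fun p => E β p - ∑ k, fderiv ℝ (E (s k)) p (e k)
  have hdc : ∀ k, Continuous fun p => fderiv ℝ (E (s k)) p (e k) := fun k =>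
    ((hE _ (hs k)).1.continuous_fderiv (by simp)).clm_apply continuous_const
  have hh : Continuous h := (hE β hβ).1.continuous.sub (continuous_finsetSum _ fun k _ => hdc k)
  have hd0 : ∀ k p, p ∉ φ '' S → fderiv ℝ (E (s k)) p = 0 := fun k p hp =>
    fderiv_of_notMem_tsupport _ fun h => hp ((hE _ (hs k)).2 h)
  have hE0 : ∀ α, IsSmoothForm α → ∀ p, p ∉ φ '' S → E α p = 0 := fun α hα p hp =>
    image_eq_zero_of_notMem_tsupport fun h => hp ((hE _ hα).2 h)
  obtain ⟨v, hv, hvc, hvp⟩ := exists_pairing_of_chart c hh hSc hST fun p hp => by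
    simp [h, hE0 β hβ p hp, hd0 _ p hp]
  refine ⟨v, hv, hvc, fun u hu => ?_⟩
  rw [← hvp u hu.1.continuous]
  obtain ⟨hw, hws⟩ := inChart_smooth (u := fun x => (χ x : ℂ) * u x) c
    (contMDiff_complex_mul (contMDiff_ofReal hχ) hu.1).contMDiffOn hχc hχs
    fun x hx => by simp [image_eq_zero_of_notMem_tsupport hx]
  set w := inChart n c fun x => (χ x : ℂ) * u x with hwdef
  -- near the support of `θ`, the cutoff has no effect
  have hwu : ∀ p ∈ φ '' S, w =ᶠ[𝓝 p] u ∘ φ.symm := by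
    rintro _ ⟨x, hx, rfl⟩
    have h0 : Tendsto φ.symm (𝓝 (φ x)) (𝓝 x) := by
      have := φ.continuousAt_symm (φ.map_source (hSs hx))
      rwa [ContinuousAt, φ.left_inv (hSs hx)] at this
    have h1 : ∀ᶠ p in 𝓝 (φ x), χ (φ.symm p) = 1 :=
      h0.eventually (hχ1.filter_mono (nhds_le_nhdsSet hx))
    filter_upwards [h1, φ.open_target.mem_nhds (φ.map_source (hSs hx))] with p hp hpt
    rw [hwdef, inChart, indicator_of_mem hpt]
    simp [hp, ← hφ]
  have hint : ∀ {f g : Model n → ℂ}, Continuous f → Continuous g → HasCompactSupport f →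
      Integrable fun p => f p * g p := fun hf hg hfc =>
    (hf.mul hg).integrable_of_hasCompactSupport hfc.mul_right
  have hdw : ∀ k, Continuous fun p => fderiv ℝ w p (e k) := fun k =>
    (hw.continuous_fderiv (by simp)).clm_apply continuous_const
  have hparts : ∀ k, ∫ p, E (s k) p * fderiv ℝ w p (e k) =
      - ∫ p, fderiv ℝ (E (s k)) p (e k) * w p := fun k =>
    integral_mul_fderiv_eq_neg_fderiv_mul_of_integrable
      (hint (hdc k) hw.continuous (HasCompactSupport.intro hSc fun p hp => by simp [hd0 k p hp]))
      (hint (hE _ (hs k)).1.continuous (hdw k) (hEc _ (hs k)))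
      (hint (hE _ (hs k)).1.continuous hw.continuous (hEc _ (hs k)))
      (fun _ _ => (hE _ (hs k)).1.differentiable (by simp) _)
      (fun _ _ => hw.differentiable (by simp) _)
  have hL : ∫ x, cotInner x (θ x) (D.toForm u x) ∂(riemannianVolume n X) =
      ∫ p, (∑ k, E (s k) p * fderiv ℝ w p (e k) + E β p * w p) := by
    rw [integral_eq_chart c (f := fun x => cotInner x (θ x) (D.toForm u x))
      (cotInner_continuous hθ (D.smooth u hu)).aestronglyMeasurable]
    · rw [← setIntegral_eq_integral_of_forall_compl_eq_zero (s := φ.target)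
        (f := fun p => ∑ k, E (s k) p * fderiv ℝ w p (e k) + E β p * w p)]
      · refine setIntegral_congr_fun φ.open_target.measurableSet fun p hp => ?_
        change density c p • cotInner _ (θ (φ.symm p)) (D.toForm u (φ.symm p)) =
          ∑ k, E (s k) p * fderiv ℝ w p (e k) + E β p * w p
        by_cases hpS : p ∈ φ '' S
        · have hx : φ.symm p ∈ S := by
            obtain ⟨x, hx, rfl⟩ := hpS
            rwa [φ.left_inv (hSs hx)]
          have hEp : ∀ α, E α p = (density c p : ℂ) * cotInner _ (θ (φ.symm p)) (α (φ.symm p)) :=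
            fun α => indicator_of_mem hp _
          have h1 := hform u hu.1 _ (hθW hx)
          rw [φ.right_inv hp] at h1
          rw [h1, (hwu p hpS).fderiv_eq, (hwu p hpS).self_of_nhds]
          simp only [hEp, cotInner_add_right, cotInner_sum_right,
            cotInner_smul_right, Complex.real_smul, mul_add, Finset.mul_sum, Function.comp, e]
          congr 1
          · exact Finset.sum_congr rfl fun k _ => by ring
          · ring
        · simp only [hnot p hp hpS, cotInner_zero_left, hE0 _ (hs _) p hpS, hE0 _ hβ p hpS]
          simp
      · intro p hp
        have hpS : p ∉ φ '' S := fun h => hp (hST h)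
        simp [hE0 _ (hs _) p hpS, hE0 _ hβ p hpS]
    · intro x hx
      rw [hθ0 x fun h => hx (hSs h), cotInner_zero_left]
  have hR : ∀ p, h p * u (φ.symm p) =
      E β p * w p - ∑ k, fderiv ℝ (E (s k)) p (e k) * w p := by
    intro p
    by_cases hpS : p ∈ φ '' S
    · rw [(hwu p hpS).self_of_nhds]
      simp only [h, Function.comp, Finset.sum_mul, sub_mul]
    · simp [h, hE0 β hβ p hpS, hd0 _ p hpS]
  have hi1 : ∀ k, Integrable fun p => E (s k) p * fderiv ℝ w p (e k) := fun k =>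
    hint (hE _ (hs k)).1.continuous (hdw k) (hEc _ (hs k))
  have hi2 : ∀ k, Integrable fun p => fderiv ℝ (E (s k)) p (e k) * w p := fun k =>
    hint (hdc k) hw.continuous (HasCompactSupport.intro hSc fun p hp => by simp [hd0 k p hp])
  have hi3 : Integrable fun p => E β p * w p := hint (hE _ hβ).1.continuous hw.continuous (hEc _ hβ)
  rw [hL, integral_congr_ae (Eventually.of_forall hR),
    integral_add (integrable_finsetSum _ fun k _ => hi1 k) hi3,
    integral_sub hi3 (integrable_finsetSum _ fun k _ => hi2 k),
    integral_finsetSum _ fun k _ => hi1 k, integral_finsetSum _ fun k _ => hi2 k]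
  simp only [hparts, Finset.sum_neg_distrib]
  ring

/-- Every smooth compactly supported form lies in the domain of the formal adjoint: finitely many
cutoffs split it into forms supported in charts. -/
theorem hasFormalAdjoint (hD : D.HasInjectiveSymbol) {θ : ∀ x : X, CCot n X x}
    (hθ : IsSmoothForm θ) (hθc : IsCompact (closure {x | θ x ≠ 0})) : D.HasFormalAdjoint θ := by
  choose W hW hWo hWs s β hs hβ hform _ using fun c => D.exists_local_form hD c
  choose χ hχ hχc hχs hχ1 _ using fun c : X => exists_cutoff (n := n) (isCompact_singleton (x := c))
    (hWo c) (singleton_subset_iff.2 (mem_of_mem_nhds (hW c)))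
  simp only [nhdsSet_singleton] at hχ1
  -- induction on the number of cutoffs needed: `θ = χ_c θ + (1 - χ_c) θ`
  have key : ∀ t : Finset X, ∀ θ : ∀ x : X, CCot n X x, IsSmoothForm θ →
      IsCompact (closure {x | θ x ≠ 0}) → {x | θ x ≠ 0} ⊆ ⋃ c ∈ t, {x | χ c x = 1} →
      D.HasFormalAdjoint θ := by
    classical
    intro t
    induction t using Finset.induction_on with
    | empty =>
      intro θ _ _ h0
      have h1 : ∀ x, θ x = 0 := by
        intro x
        by_contra h
        simpa using h0 h
      refine ⟨0, continuous_const, HasCompactSupport.zero, fun u _ => ?_⟩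
      simp [h1, cotInner_zero_left]
    | insert c t hc ih =>
      intro θ hθ hθc hsub
      have e : θ = (fun x => (χ c x : ℂ) • θ x) + fun x => ((1 - χ c x : ℝ) : ℂ) • θ x := by
        funext x
        simp only [Pi.add_apply]
        rw [← add_smul]
        simp
      have hsub1 : closure {x | (χ c x : ℂ) • θ x ≠ 0} ⊆ tsupport (χ c) :=
        closure_mono fun x hx h => hx (by simp [h])
      have hsub2 : closure {x | ((1 - χ c x : ℝ) : ℂ) • θ x ≠ 0} ⊆ closure {x | θ x ≠ 0} :=
        closure_mono fun x hx h => hx (by simp [h])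
      have h1 := (hθ.real_smul (hχ c))
      have h2 := hθ.real_smul
        (contMDiff_const.sub (hχ c) : ContMDiff (𝓡 n) 𝓘(ℝ, ℝ) ∞ fun x => 1 - χ c x)
      have hc1 : IsCompact (closure {x | (χ c x : ℂ) • θ x ≠ 0}) :=
        (hχc c).isCompact.of_isClosed_subset isClosed_closure hsub1
      have hc2 := hθc.of_isClosed_subset isClosed_closure hsub2
      rw [e]
      refine hasFormalAdjoint_add D h1 hc1 h2 hc2 ?_ (ih _ h2 hc2 ?_)
      · exact hasFormalAdjoint_of_subset_chart D c (hWs c) (hs c) (hβ c) (hform c) h1 hc1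
          (hsub1.trans (hχs c))
      · intro x hx
        have hx1 : θ x ≠ 0 := fun h => hx (by simp [h])
        have hx2 : χ c x ≠ 1 := fun h => hx (by simp [h])
        have := hsub hx1
        simp only [Finset.mem_insert, iUnion_iUnion_eq_or_left, mem_union] at this
        exact this.resolve_left hx2
  obtain ⟨t, -, ht⟩ := hθc.elim_nhds_subcover (fun c => {x | χ c x = 1}) fun c _ => hχ1 c
  exact key t θ hθ hθc (subset_closure.trans ht)

end FormalAdjoint

/-! ### Energy estimates -/

section Energy

open Filter

variable {n : ℕ} {X : Type*} [TopologicalSpace X] [ChartedSpace (Model n) X] [IsManifold (𝓡 n) ∞ X]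
  [RiemannianBundle (fun x : X => TangentSpace (𝓡 n) x)]

/-- The square of the pointwise norm of a covector. -/
noncomputable def normSq (x : X) (α : CCot n X x) : ℝ := (cotInner x α α).re

theorem normSq_eq (x : X) (α : CCot n X x) :
    normSq x α = ∑ i, ‖α (stdOrthonormalBasis ℝ (TangentSpace (𝓡 n) x) i)‖ ^ 2 := by
  simp [normSq, cotInner, Complex.conj_mul', ← Complex.ofReal_pow]

theorem normSq_nonneg (x : X) (α : CCot n X x) : 0 ≤ normSq x α := by
  rw [normSq_eq]
  exact Finset.sum_nonneg fun i _ => sq_nonneg _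

theorem normSq_smul (x : X) (z : ℂ) (α : CCot n X x) : normSq x (z • α) = ‖z‖ ^ 2 * normSq x α := by
  have h : ∀ t, (z • α) t = z * α t := fun _ => rfl
  simp only [normSq_eq, h, norm_mul, mul_pow, Finset.mul_sum]

theorem normSq_add_le (x : X) (α β : CCot n X x) :
    normSq x (α + β) ≤ 2 * normSq x α + 2 * normSq x β := by
  simp only [normSq_eq, Finset.mul_sum, ← Finset.sum_add_distrib]
  refine Finset.sum_le_sum fun i _ => ?_
  have h1 : ∀ a b : ℂ, ‖a + b‖ ^ 2 ≤ 2 * ‖a‖ ^ 2 + 2 * ‖b‖ ^ 2 := by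
    intro a b
    have := pow_le_pow_left₀ (norm_nonneg _) (norm_add_le a b) 2
    nlinarith [sq_nonneg (‖a‖ - ‖b‖)]
  exact h1 _ _

theorem normSq_zero (x : X) : normSq x (0 : CCot n X x) = 0 := by
  simp [normSq_eq]

variable [IsContMDiffRiemannianBundle (𝓡 n) ∞ (Model n) (fun x : X => TangentSpace (𝓡 n) x)]

theorem normSq_continuous {α : ∀ x : X, CCot n X x} (hα : IsSmoothForm α) :
    Continuous fun x => normSq x (α x) :=
  Complex.continuous_re.comp (cotInner_continuous hα hα)

namespace FirstOrderOperator

variable [MeasurableSpace X] (D : FirstOrderOperator n X)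

/-- The energy `∫ |u|² + |D u|²`. -/
noncomputable def energy (u : X → ℂ) : ℝ :=
  (∫ x, ‖u x‖ ^ 2 ∂(riemannianVolume n X)) + ∫ x, normSq x (D.toForm u x) ∂(riemannianVolume n X)

theorem toForm_eq_zero {u : X → ℂ} {x : X} (h : x ∉ tsupport u) : D.toForm u x = 0 := by
  rw [toForm, diff_eq_zero h, image_eq_zero_of_notMem_tsupport h, map_zero, zero_smul, add_zero]

variable [BorelSpace X] [T2Space X]

theorem integrable_norm_sq {u : X → ℂ} (hu : u ∈ testFunctions n (⊤ : TopologicalSpace.Opens X)) :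
    Integrable (fun x => ‖u x‖ ^ 2) (riemannianVolume n X) :=
  (hu.1.continuous.norm.pow 2).integrable_of_hasCompactSupport
    (HasCompactSupport.intro hu.2.1 fun x hx => by simp [image_eq_zero_of_notMem_tsupport hx])

theorem integrable_normSq {u : X → ℂ} (hu : u ∈ testFunctions n (⊤ : TopologicalSpace.Opens X)) :
    Integrable (fun x => normSq x (D.toForm u x)) (riemannianVolume n X) :=
  (normSq_continuous (D.smooth u hu)).integrable_of_hasCompactSupport
    (HasCompactSupport.intro hu.2.1 fun x hx => by
      change normSq x (D.toForm u x) = 0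
      rw [D.toForm_eq_zero hx, normSq_zero])

theorem integral_norm_sq_le_energy (u : X → ℂ) :
    ∫ x, ‖u x‖ ^ 2 ∂(riemannianVolume n X) ≤ D.energy u :=
  le_add_of_nonneg_right (integral_nonneg fun _ => normSq_nonneg _ _)

theorem integral_normSq_le_energy (u : X → ℂ) :
    ∫ x, normSq x (D.toForm u x) ∂(riemannianVolume n X) ≤ D.energy u :=
  le_add_of_nonneg_left (integral_nonneg fun _ => by positivity)

variable [SecondCountableTopology X]

theorem exists_normSq_symbol_diff_le {g : X → ℝ}
    (hg : ContMDiff (𝓡 n) 𝓘(ℝ, ℝ) ∞ g) (hc : HasCompactSupport g) :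
    ∃ C, ∀ x, normSq x (D.symbol x (diff n (fun y => (g y : ℂ)) x)) ≤ C := by
  have h1 := normSq_continuous (D.isSmoothForm_symbol_diff hg hc)
  have h2 : HasCompactSupport fun x => normSq x (D.symbol x (diff n (fun y => (g y : ℂ)) x)) := by
    refine HasCompactSupport.intro hc fun x hx => ?_
    have h3 : diff n (fun y => (g y : ℂ)) x = 0 := by
      refine diff_eq_zero fun h => hx (closure_mono (fun y hy => ?_) h)
      intro h0
      exact hy (by simp [h0])
    rw [h3, map_zero, normSq_zero]
  obtain ⟨C, hC⟩ := (h2.isCompact_range h1).isBounded.exists_norm_le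
  exact ⟨C, fun x => (le_abs_self _).trans (hC _ (mem_range_self x))⟩

/-- Multiplication by a cutoff function is bounded in the energy norm. -/
theorem exists_energy_cutoff_le {g : X → ℝ}
    (hg : ContMDiff (𝓡 n) 𝓘(ℝ, ℝ) ∞ g) (hc : HasCompactSupport g) (hI : ∀ x, g x ∈ Icc (0 : ℝ) 1) :
    ∃ C, ∀ u ∈ testFunctions n (⊤ : TopologicalSpace.Opens X),
      D.energy (fun x => (g x : ℂ) * u x) ≤ C * D.energy u := by
  obtain ⟨C, hC⟩ := D.exists_normSq_symbol_diff_le hg hc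
  have hC0 : ∀ x : X, 0 ≤ C := fun x => (normSq_nonneg _ _).trans (hC x)
  refine ⟨3 + 2 * |C|, fun u hu => ?_⟩
  have hgu : (fun x => (g x : ℂ) * u x) ∈ testFunctions n (⊤ : TopologicalSpace.Opens X) :=
    ofReal_mul_mem_testFunctions hg hu (subset_univ _)
  have hg1 : ∀ x, ‖(g x : ℂ)‖ ^ 2 ≤ 1 := by
    intro x
    rw [Complex.norm_real, Real.norm_of_nonneg (hI x).1]
    exact pow_le_one₀ (hI x).1 (hI x).2
  have h1 : ∫ x, ‖(g x : ℂ) * u x‖ ^ 2 ∂(riemannianVolume n X) ≤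
      ∫ x, ‖u x‖ ^ 2 ∂(riemannianVolume n X) := by
    refine integral_mono (integrable_norm_sq hgu) (integrable_norm_sq hu) fun x => ?_
    simp only [norm_mul, mul_pow]
    exact mul_le_of_le_one_left (by positivity) (hg1 x)
  have h2 : ∫ x, normSq x (D.toForm (fun x => (g x : ℂ) * u x) x) ∂(riemannianVolume n X) ≤
      ∫ x, (2 * normSq x (D.toForm u x) + 2 * |C| * ‖u x‖ ^ 2) ∂(riemannianVolume n X) := by
    refine integral_mono (D.integrable_normSq hgu)
      (((D.integrable_normSq hu).const_mul 2).add ((integrable_norm_sq hu).const_mul _)) fun x => ?_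
    simp only
    rw [D.toForm_mul (contMDiff_ofReal hg) hu.1]
    refine (normSq_add_le _ _ _).trans ?_
    rw [normSq_smul, normSq_smul]
    have h3 := mul_le_of_le_one_left (normSq_nonneg x (D.toForm u x)) (hg1 x)
    have h4 := mul_le_mul_of_nonneg_left ((hC x).trans (le_abs_self C)) (sq_nonneg ‖u x‖)
    nlinarith
  rw [integral_add ((D.integrable_normSq hu).const_mul 2) ((integrable_norm_sq hu).const_mul _),
    integral_const_mul, integral_const_mul] at h2
  have h5 : 0 ≤ ∫ x, ‖u x‖ ^ 2 ∂(riemannianVolume n X) := integral_nonneg fun _ => by positivity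
  have h6 : 0 ≤ ∫ x, normSq x (D.toForm u x) ∂(riemannianVolume n X) :=
    integral_nonneg fun _ => normSq_nonneg _ _
  have h7 := abs_nonneg C
  simp only [energy]
  nlinarith [mul_nonneg h7 h6]

/-- An elliptic symbol with constant coefficients is bounded below on the unit sphere. -/
theorem exists_elliptic_constant {a : Fin n → Fin n → ℂ}
    (ha : ∀ ξ : Model n, (∀ i, ∑ k, a i k * ξ k = 0) → ξ = 0) :
    ∃ c > 0, ∀ ξ : Model n, c * ‖ξ‖ ^ 2 ≤ ∑ i, ‖∑ k, a i k * ξ k‖ ^ 2 := by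
  let L : Model n →ₗ[ℝ] EuclideanSpace ℂ (Fin n) :=
    { toFun := fun ξ => WithLp.toLp 2 fun i => ∑ k, a i k * ξ k
      map_add' := fun ξ η => by
        ext i
        simp [mul_add, Finset.sum_add_distrib]
      map_smul' := fun t ξ => by
        ext i
        simp only [PiLp.smul_apply, smul_eq_mul, Complex.ofReal_mul, RingHom.id_apply,
          Complex.real_smul, Finset.mul_sum]
        exact Finset.sum_congr rfl fun k _ => by ring }
  have hker : LinearMap.ker L = ⊥ := by
    rw [LinearMap.ker_eq_bot']
    intro ξ hξ
    exact ha ξ fun i => congrArg (fun v : EuclideanSpace ℂ (Fin n) => v i) hξ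
  obtain ⟨K, hK, hL⟩ := L.exists_antilipschitzWith hker
  have hK' : (0 : ℝ) < K := hK
  refine ⟨((K : ℝ) ^ 2)⁻¹, by positivity, fun ξ => ?_⟩
  have h1 : ‖ξ‖ ≤ K * ‖L ξ‖ := by simpa using hL.le_mul_dist ξ 0
  have h2 : ‖L ξ‖ ^ 2 = ∑ i, ‖∑ k, a i k * ξ k‖ ^ 2 := by
    rw [EuclideanSpace.norm_sq_eq]
    rfl
  rw [← h2, inv_mul_le_iff₀ (by positivity), ← mul_pow]
  exact pow_le_pow_left₀ (norm_nonneg _) h1 2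

end FirstOrderOperator

theorem integrable_norm_sq_of_hasCompactSupport {w : Model n → ℂ} (hw : Continuous w)
    (hc : HasCompactSupport w) : Integrable fun p => ‖w p‖ ^ 2 :=
  (hw.norm.pow 2).integrable_of_hasCompactSupport
    (HasCompactSupport.intro hc fun x hx => by simp [image_eq_zero_of_notMem_tsupport hx])

/-- Gårding's inequality with variable coefficients which differ little from constant ones:
freezing the coefficients at a point produces an error which is absorbed. -/
theorem garding_of_close {a₀ : Fin n → Fin n → ℂ} {c₀ : ℝ}
    (hc₀ : 0 < c₀) (ha₀ : ∀ ξ : Model n, c₀ * ‖ξ‖ ^ 2 ≤ ∑ i, ‖∑ k, a₀ i k * ξ k‖ ^ 2)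
    {ε B : ℝ} (hε : 3 * (n : ℝ) ^ 2 * ε ^ 2 ≤ c₀ / 2)
    {w : Model n → ℂ} (hw : ContDiff ℝ ∞ w) (hwc : HasCompactSupport w)
    {a : Model n → Fin n → Fin n → ℂ} {b : Model n → Fin n → ℂ}
    (ha : ∀ p ∈ tsupport w, ∀ i k, ‖a p i k - a₀ i k‖ ≤ ε) (hb : ∀ p ∈ tsupport w, ∀ i, ‖b p i‖ ≤ B)
    {I : Model n → ℝ} (hI : Integrable I) (hI0 : ∀ p, 0 ≤ I p)
    (hIw : ∀ p ∈ tsupport w, ∀ i,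
      ‖∑ k, fderiv ℝ w p (EuclideanSpace.single k (1 : ℝ)) * a p i k + w p * b p i‖ ^ 2 ≤ I p) :
    ∑ k, ∫ p, ‖fderiv ℝ w p (EuclideanSpace.single k (1 : ℝ))‖ ^ 2 ≤
      2 / c₀ * (3 * n * (∫ p, I p) + 3 * n * B ^ 2 * ∫ p, ‖w p‖ ^ 2) := by
  set d : Fin n → Model n → ℂ := fun k p => fderiv ℝ w p (EuclideanSpace.single k (1 : ℝ)) with hd
  let f : SchwartzMap (Model n) ℂ := hwc.toSchwartzMap hw
  have hfd : ∀ k p, coordDeriv k f p = d k p := fun k p =>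
    SchwartzMap.lineDerivOp_apply_eq_fderiv _ _ _
  have hdc : ∀ k, Integrable fun p => ‖d k p‖ ^ 2 := fun k => by
    simpa only [hfd] using integrable_norm_sq_schwartz (coordDeriv k f)
  have hwi : Integrable fun p => ‖w p‖ ^ 2 := integrable_norm_sq_schwartz f
  have h1 := garding_const_coeff a₀ ha₀ f
  simp only [hfd] at h1
  have hsum : ∀ i, Integrable fun p => ‖∑ k, a₀ i k * d k p‖ ^ 2 := fun i => by
    have := integrable_norm_sq_schwartz (∑ k, a₀ i k • coordDeriv k f)
    simpa only [sum_apply, smul_apply, hfd, smul_eq_mul] using this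
  have hpt : ∀ i p, ‖∑ k, a₀ i k * d k p‖ ^ 2 ≤
      3 * I p + 3 * (n * ε ^ 2 * ∑ k, ‖d k p‖ ^ 2) + 3 * B ^ 2 * ‖w p‖ ^ 2 := by
    intro i p
    by_cases hp : p ∈ tsupport w
    · -- the operator applied to `w`, minus the error of freezing, minus the term of order zero
      have e : ∑ k, a₀ i k * d k p = (∑ k, d k p * a p i k + w p * b p i) -
          (∑ k, (a p i k - a₀ i k) * d k p) - w p * b p i := by
        simp only [sub_mul, Finset.sum_sub_distrib, mul_comm (d _ p)]
        ring
      have h2 : ‖∑ k, (a p i k - a₀ i k) * d k p‖ ^ 2 ≤ n * ε ^ 2 * ∑ k, ‖d k p‖ ^ 2 := by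
        calc _ ≤ (∑ k, ε * ‖d k p‖) ^ 2 := by
              gcongr
              refine (norm_sum_le _ _).trans (Finset.sum_le_sum fun k _ => ?_)
              rw [norm_mul]
              gcongr
              exact ha p hp i k
          _ ≤ (Finset.univ : Finset (Fin n)).card * ∑ k, (ε * ‖d k p‖) ^ 2 :=
              sq_sum_le_card_mul_sum_sq
          _ = _ := by
              simp only [mul_pow, ← Finset.mul_sum, Finset.card_univ, Fintype.card_fin]
              ring
      have h3 : ‖w p * b p i‖ ^ 2 ≤ B ^ 2 * ‖w p‖ ^ 2 := by
        rw [norm_mul, mul_pow, mul_comm]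
        gcongr
        exact hb p hp i
      have h4 : ∀ x y z : ℂ, ‖x - y - z‖ ^ 2 ≤ 3 * ‖x‖ ^ 2 + 3 * ‖y‖ ^ 2 + 3 * ‖z‖ ^ 2 := by
        intro x y z
        have h5 : ‖x - y - z‖ ≤ ‖x‖ + ‖y‖ + ‖z‖ :=
          (norm_sub_le _ _).trans (add_le_add_left (norm_sub_le _ _) _)
        have := pow_le_pow_left₀ (norm_nonneg _) h5 2
        nlinarith [sq_nonneg (‖x‖ - ‖y‖), sq_nonneg (‖x‖ - ‖z‖), sq_nonneg (‖y‖ - ‖z‖)]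
      rw [e]
      refine (h4 _ _ _).trans ?_
      have h6 := hIw p hp i
      linarith
    · have h2 : ∀ k, d k p = 0 := fun k => by
        simp only [hd, fderiv_of_notMem_tsupport ℝ hp]
        rfl
      have h3 := hI0 p
      simp only [h2, image_eq_zero_of_notMem_tsupport hp]
      simp
      exact h3
  have h2 : ∑ i, ∫ p, ‖∑ k, a₀ i k * d k p‖ ^ 2 ≤
      ∑ _i : Fin n, (3 * (∫ p, I p) + 3 * (n * ε ^ 2 * ∑ k, ∫ p, ‖d k p‖ ^ 2) +
        3 * B ^ 2 * ∫ p, ‖w p‖ ^ 2) := by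
    refine Finset.sum_le_sum fun i _ => ?_
    have hs : Integrable fun p => ∑ k, ‖d k p‖ ^ 2 := integrable_finsetSum _ fun k _ => hdc k
    have h5 : ∫ p, ‖∑ k, a₀ i k * d k p‖ ^ 2 ≤
        ∫ p, (3 * I p + 3 * (n * ε ^ 2 * ∑ k, ‖d k p‖ ^ 2) + 3 * B ^ 2 * ‖w p‖ ^ 2) :=
      integral_mono (hsum i) (((hI.const_mul 3).add ((hs.const_mul _).const_mul _)).add
        (hwi.const_mul _)) (hpt i)
    refine h5.trans (le_of_eq ?_)
    rw [integral_add (f := fun p => 3 * I p + 3 * (n * ε ^ 2 * ∑ k, ‖d k p‖ ^ 2))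
        ((hI.const_mul 3).add ((hs.const_mul _).const_mul _)) (hwi.const_mul _),
      integral_add (hI.const_mul 3) ((hs.const_mul _).const_mul _), integral_const_mul,
      integral_const_mul, integral_const_mul, integral_const_mul, integral_finsetSum _ fun k _ =>
          hdc k]
  rw [Finset.sum_const, Finset.card_univ, Fintype.card_fin, nsmul_eq_mul] at h2
  set A := ∑ k, ∫ p, ‖d k p‖ ^ 2
  have hA : 0 ≤ A := Finset.sum_nonneg fun k _ => integral_nonneg fun p => by positivity
  have h3 := mul_le_mul_of_nonneg_right hε hA
  rw [div_mul_eq_mul_div, le_div_iff₀ hc₀]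
  nlinarith

end Energy

/-! ### Local compactness of bounded energy sequences -/

section LocalCompactness

open Filter FourierTransform

variable {n : ℕ} {X : Type*} [TopologicalSpace X] [T2Space X] [SecondCountableTopology X]
  [ChartedSpace (Model n) X] [IsManifold (𝓡 n) ∞ X]
  [RiemannianBundle (fun x : X => TangentSpace (𝓡 n) x)]
  [IsContMDiffRiemannianBundle (𝓡 n) ∞ (Model n) (fun x : X => TangentSpace (𝓡 n) x)]
  [MeasurableSpace X] [BorelSpace X]

/-- `integral_eq_chart` for functions with compact support in the chart, with integrability. -/
theorem integrable_density_mul_chart (c : X) {f : X → ℝ} (hf : Continuous f) {S : Set X}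
    (hS : IsCompact S)
    (hsub : S ⊆ (chartAt (Model n) c).source) (h0 : ∀ x, x ∉ S → f x = 0) :
    Integrable ((chartAt (Model n) c).target.indicator
      fun p => density c p * f ((chartAt (Model n) c).symm p)) ∧
    ∫ p, (chartAt (Model n) c).target.indicator
      (fun p => density c p * f ((chartAt (Model n) c).symm p)) p =
      ∫ x, f x ∂(riemannianVolume n X) := by
  set φ := chartAt (Model n) c with hφ
  constructor
  · have hSc : IsCompact (φ '' S) := hS.image_of_continuousOn (φ.continuousOn.mono hsub)
    have hST : φ '' S ⊆ φ.target := by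
      rintro _ ⟨x, hx, rfl⟩
      exact φ.map_source (hsub hx)
    have hc : ContinuousOn (fun p => density c p * f (φ.symm p)) (φ '' S) :=
      ((density_continuousOn c).mono hST).mul
        (hf.comp_continuousOn (φ.continuousOn_symm.mono hST))
    have h1 : IntegrableOn (φ.target.indicator fun p => density c p * f (φ.symm p)) (φ '' S) :=
      (hc.integrableOn_compact hSc).congr_fun (fun p hp => by rw [indicator_of_mem (hST hp)])
        hSc.measurableSet
    refine (integrableOn_iff_integrable_of_support_subset fun p hp => ?_).1 h1
    have hpt : p ∈ φ.target := mem_of_indicator_ne_zero hp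
    by_contra h
    refine hp ?_
    rw [indicator_of_mem hpt, h0, mul_zero]
    exact fun hs => h ⟨_, hs, φ.right_inv hpt⟩
  · rw [integral_indicator φ.open_target.measurableSet, integral_eq_chart c (f := f)
      hf.aestronglyMeasurable fun x hx => h0 x fun h => hx (hsub h)]
    rfl

namespace FirstOrderOperator

variable (D : FirstOrderOperator n X)

/-- Gårding's inequality in a small coordinate ball, with the comparison of the `L²` norms on the
manifold and in the chart. -/
theorem exists_garding_ball (hD : D.HasInjectiveSymbol) (c : X) :
    ∃ r > 0, Metric.ball (chartAt (Model n) c c) r ⊆ (chartAt (Model n) c).target ∧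
      ∃ C C' : ℝ, 0 ≤ C' ∧ ∀ v ∈ testFunctions n (⊤ : TopologicalSpace.Opens X),
        tsupport v ⊆ (chartAt (Model n) c).source ∩
          chartAt (Model n) c ⁻¹' Metric.ball (chartAt (Model n) c c) r →
        ∑ k, ∫ p, ‖fderiv ℝ (inChart n c v) p (EuclideanSpace.single k (1 : ℝ))‖ ^ 2 ≤
            C * D.energy v ∧
        ∫ p, ‖inChart n c v p‖ ^ 2 ≤ C' * ∫ x, ‖v x‖ ^ 2 ∂(riemannianVolume n X) ∧
        ∫ x, ‖v x‖ ^ 2 ∂(riemannianVolume n X) ≤ C' * ∫ p, ‖inChart n c v p‖ ^ 2 := by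
  obtain ⟨W, hW, hWo, hWs, s, β, hs, hβ, hform, hell⟩ := D.exists_local_form hD c
  set φ := chartAt (Model n) c with hφ
  set p₀ := φ c with hp₀
  have hcs : c ∈ φ.source := mem_chart_source _ c
  have hp₀t : p₀ ∈ φ.target := φ.map_source hcs
  have htn : φ.target ∈ 𝓝 p₀ := φ.open_target.mem_nhds hp₀t
  set a : Model n → Fin n → Fin n → ℂ := fun p i k => s k (φ.symm p) (coordVec c p i) with ha
  set b : Model n → Fin n → ℂ := fun p i => β (φ.symm p) (coordVec c p i) with hb
  have hac : ∀ i k, ContinuousAt (fun p => a p i k) p₀ := fun i k =>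
    (form_coordVec_contDiffOn (hs k) c i).continuousOn.continuousAt htn
  have hbc : ∀ i, ContinuousAt (fun p => b p i) p₀ := fun i =>
    (form_coordVec_contDiffOn hβ c i).continuousOn.continuousAt htn
  have hgc : ∀ i, ContinuousAt (fun p => gram c p i i) p₀ := fun i =>
    (gram_contDiffOn c i i).continuousOn.continuousAt htn
  have hρc : ContinuousAt (density c) p₀ := (density_continuousOn c).continuousAt htn
  have hρ : 0 < density c p₀ := density_pos c hp₀t
  -- the frozen operator at `p₀` is elliptic
  obtain ⟨c₀, hc₀, hc₀'⟩ := exists_elliptic_constant (a := a p₀) (by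
    intro ξ hξ
    by_contra hne
    refine hell (φ.symm p₀) (by rw [hp₀, φ.left_inv hcs]; exact mem_of_mem_nhds hW) ξ hne ?_
    obtain ⟨e, he⟩ := exists_basis_coordVec c hp₀t
    refine ContinuousLinearMap.coe_injective (e.ext fun i => ?_)
    rw [he]
    have h1 : ∀ (t : Finset (Fin n)), (∑ k ∈ t, (ξ k : ℂ) • s k (φ.symm p₀)) (coordVec c p₀ i) =
        ∑ k ∈ t, a p₀ i k * ξ k := by
      intro t
      rw [sum_apply]
      exact Finset.sum_congr rfl fun k _ => mul_comm _ _
    exact (h1 _).trans (hξ i))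
  -- `ε` is the admissible error in `garding_of_close`
  set ε : ℝ := Real.sqrt (c₀ / (6 * ((n : ℝ) ^ 2 + 1))) with hε
  have hε0 : 0 < ε := Real.sqrt_pos.2 (by positivity)
  have hε2 : 3 * (n : ℝ) ^ 2 * ε ^ 2 ≤ c₀ / 2 := by
    rw [hε, Real.sq_sqrt (by positivity), mul_div_assoc', div_le_div_iff₀ (by positivity)
        (by norm_num)]
    nlinarith
  set B : ℝ := ∑ i, ‖b p₀ i‖ + 1 with hB
  set G : ℝ := ∑ i, |gram c p₀ i i| + 1 with hG
  have hG0 : 0 < G := by positivity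
  have hev : ∀ᶠ p in 𝓝 p₀, p ∈ φ.target ∧ φ.symm p ∈ W ∧ (∀ i k, ‖a p i k - a p₀ i k‖ ≤ ε) ∧
      (∀ i, ‖b p i‖ ≤ B) ∧ (∀ i, gram c p i i ≤ G) ∧ density c p₀ / 2 ≤ density c p ∧
      density c p ≤ 2 * density c p₀ := by
    refine Filter.Eventually.and htn (Filter.Eventually.and ?_
        (Filter.Eventually.and ?_ (Filter.Eventually.and ?_
      (Filter.Eventually.and ?_ (Filter.Eventually.and ?_ ?_)))))
    · refine (φ.continuousAt_symm hp₀t).eventually ?_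
      rw [hp₀, φ.left_inv hcs]
      exact hW
    · refine eventually_all.2 fun i => eventually_all.2 fun k => ?_
      filter_upwards [Metric.tendsto_nhds.1 (hac i k) ε hε0] with p hp
      rw [← dist_eq_norm]
      exact hp.le
    · refine eventually_all.2 fun i => ?_
      filter_upwards [(hbc i).norm.eventually (gt_mem_nhds (lt_add_one _))] with p hp
      refine hp.le.trans (add_le_add_left ?_ _)
      exact Finset.single_le_sum (f := fun i => ‖b p₀ i‖) (fun i _ => norm_nonneg _)
          (Finset.mem_univ i)
    · refine eventually_all.2 fun i => ?_
      filter_upwards [(hgc i).eventually (gt_mem_nhds (lt_add_one _))] with p hp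
      refine hp.le.trans (add_le_add_left ((le_abs_self _).trans ?_) _)
      exact Finset.single_le_sum (f := fun i => |gram c p₀ i i|) (fun i _ => abs_nonneg _)
        (Finset.mem_univ i)
    · exact (hρc.eventually (lt_mem_nhds (half_lt_self hρ))).mono fun p hp => hp.le
    · exact (hρc.eventually (gt_mem_nhds (by linarith : density c p₀ < 2 * density c p₀))).mono
        fun p hp => hp.le
  obtain ⟨r, hr, hball⟩ := Metric.eventually_nhds_iff_ball.1 hev
  set δ := density c p₀ / 2 with hδ
  have hδ0 : 0 < δ := by positivity
  refine ⟨r, hr, fun p hp => (hball p hp).1,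
    2 / c₀ * (3 * n * (G / δ) + 3 * n * B ^ 2 * (1 / δ)), 1 / δ + 2 * density c p₀,
    by positivity, fun v hv hvs => ?_⟩
  have hSs : tsupport v ⊆ φ.source := hvs.trans inter_subset_left
  have hS : IsCompact (tsupport v) := hv.2.1
  set w := inChart n c v with hw
  obtain ⟨hws, hwt⟩ := inChart_smooth c hv.1.contMDiffOn hS hSs
    fun x hx => image_eq_zero_of_notMem_tsupport hx
  have hSb : ∀ p ∈ tsupport w, p ∈ Metric.ball p₀ r := by
    intro p hp
    obtain ⟨x, hx, rfl⟩ := hwt hp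
    exact (hvs hx).2
  have hwc : HasCompactSupport w :=
    (hS.image_of_continuousOn (φ.continuousOn.mono hSs)).of_isClosed_subset (isClosed_tsupport _)
        hwt
  have hwi := integrable_norm_sq_of_hasCompactSupport hws.continuous hwc
  have hwe : ∀ p ∈ φ.target, w p = v (φ.symm p) := fun p hp => indicator_of_mem hp _
  obtain ⟨hi1, hi2⟩ := integrable_density_mul_chart c (f := fun x => ‖v x‖ ^ 2)
    (hv.1.continuous.norm.pow 2) hS hSs (fun x hx => by simp [image_eq_zero_of_notMem_tsupport hx])
  obtain ⟨hj1, hj2⟩ := integrable_density_mul_chart c (f := fun x => normSq x (D.toForm v x))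
    (normSq_continuous (D.smooth v hv)) hS hSs
        (fun x hx => by rw [D.toForm_eq_zero hx, normSq_zero])
  have hden : ∀ p ∈ φ.target, 0 < density c p := fun p hp => density_pos c hp
  have hn1 : ∫ p, ‖w p‖ ^ 2 ≤ 1 / δ * ∫ x, ‖v x‖ ^ 2 ∂(riemannianVolume n X) := by
    rw [← hi2, ← integral_const_mul]
    refine integral_mono hwi (hi1.const_mul _) fun p => ?_
    by_cases hp : p ∈ tsupport w
    · obtain ⟨h1, -, -, -, -, h2, -⟩ := hball p (hSb p hp)
      simp only
      rw [indicator_of_mem h1, hwe p h1, one_div, ← div_eq_inv_mul, le_div_iff₀ hδ0, mul_comm]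
      gcongr
    · simp only [image_eq_zero_of_notMem_tsupport hp]
      have : 0 ≤ φ.target.indicator (fun p => density c p * ‖v (φ.symm p)‖ ^ 2) p :=
        indicator_nonneg (fun p hp => mul_nonneg (hden p hp).le (by positivity)) p
      simpa using! mul_nonneg (inv_nonneg.2 hδ0.le) this
  have hn2 : ∫ x, ‖v x‖ ^ 2 ∂(riemannianVolume n X) ≤ 2 * density c p₀ * ∫ p, ‖w p‖ ^ 2 := by
    rw [← hi2, ← integral_const_mul]
    refine integral_mono hi1 (hwi.const_mul _) fun p => ?_
    by_cases hpt : p ∈ φ.target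
    · simp only
      rw [indicator_of_mem hpt, ← hwe p hpt]
      by_cases hp : p ∈ tsupport w
      · obtain ⟨-, -, -, -, -, -, h2⟩ := hball p (hSb p hp)
        gcongr
      · simp [image_eq_zero_of_notMem_tsupport hp]
    · simp only
      rw [indicator_of_notMem hpt]
      positivity
  have hv0 : 0 ≤ ∫ x, ‖v x‖ ^ 2 ∂(riemannianVolume n X) := integral_nonneg fun _ => by positivity
  have hw0 : 0 ≤ ∫ p, ‖w p‖ ^ 2 := integral_nonneg fun _ => by positivity
  refine ⟨?_, hn1.trans ?_, hn2.trans ?_⟩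
  · have hg := garding_of_close hc₀ hc₀' hε2 hws hwc (a := a) (b := b) (B := B)
      (I := fun p => G / δ * φ.target.indicator
        (fun p => density c p * normSq _ (D.toForm v (φ.symm p))) p)
      (fun p hp i k => (hball p (hSb p hp)).2.2.1 i k)
      (fun p hp i => (hball p (hSb p hp)).2.2.2.1 i) (hj1.const_mul _)
      (fun p => mul_nonneg (by positivity)
        (indicator_nonneg (fun p hp => mul_nonneg (hden p hp).le (normSq_nonneg _ _)) p))
      (by
        intro p hp i
        obtain ⟨h1, h2, -, -, h3, h4, -⟩ := hball p (hSb p hp)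
        have hfd : fderiv ℝ w p = fderiv ℝ (v ∘ φ.symm) p := by
          refine Filter.EventuallyEq.fderiv_eq ?_
          filter_upwards [φ.open_target.mem_nhds h1] with q hq using hwe q hq
        have hf := hform v hv.1 (φ.symm p) h2
        rw [φ.right_inv h1] at hf
        have he : ∑ k, fderiv ℝ w p (EuclideanSpace.single k (1 : ℝ)) * a p i k + w p * b p i =
            D.toForm v (φ.symm p) (coordVec c p i) := by
          rw [hf, hwe p h1, hfd, add_apply, sum_apply]
          rfl
        rw [he, indicator_of_mem h1]
        refine (norm_apply_sq_le _ _ _).trans ?_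
        calc _ ≤ normSq _ (D.toForm v (φ.symm p)) * G :=
              mul_le_mul_of_nonneg_left (h3 i) (normSq_nonneg _ _)
          _ ≤ normSq _ (D.toForm v (φ.symm p)) * (G * (density c p / δ)) := by
              refine mul_le_mul_of_nonneg_left ?_ (normSq_nonneg _ _)
              exact le_mul_of_one_le_right hG0.le ((one_le_div hδ0).2 h4)
          _ = _ := by ring)
    rw [integral_const_mul, hj2] at hg
    refine hg.trans ?_
    rw [mul_assoc (2 / c₀)]
    refine mul_le_mul_of_nonneg_left ?_ (by positivity)
    have h5 := D.integral_normSq_le_energy v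
    have h6 := D.integral_norm_sq_le_energy v
    have h7 : ∫ p, ‖w p‖ ^ 2 ≤ 1 / δ * D.energy v :=
      hn1.trans (mul_le_mul_of_nonneg_left h6 (by positivity))
    calc _ ≤ 3 * n * (G / δ * D.energy v) + 3 * n * B ^ 2 * (1 / δ * D.energy v) := by gcongr
      _ = _ := by ring
  · exact mul_le_mul_of_nonneg_right (by linarith) hv0
  · exact mul_le_mul_of_nonneg_right (le_add_of_nonneg_left (by positivity)) hw0

/-- Near each point, a sequence of bounded energy which tends to zero weakly tends to zero in
`L²`. -/
theorem exists_nhds_tendsto_zero (hD : D.HasInjectiveSymbol) (c : X) :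
    ∃ W ∈ 𝓝 c, ∀ u : ℕ → X → ℂ, (∀ j, u j ∈ testFunctions n (⊤ : TopologicalSpace.Opens X)) →
      (∃ M, ∀ j, D.energy (u j) ≤ M) →
      (∀ v : X → ℂ, Continuous v → HasCompactSupport v →
        Tendsto (fun j => ∫ x, starRingEnd ℂ (v x) * u j x ∂(riemannianVolume n X)) atTop (𝓝 0)) →
      Tendsto (fun j => ∫ x in W, ‖u j x‖ ^ 2 ∂(riemannianVolume n X)) atTop (𝓝 0) := by
  obtain ⟨r, hr, hrt, C, C', hC', hball⟩ := D.exists_garding_ball hD c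
  set φ := chartAt (Model n) c with hφ
  have hOo : IsOpen (φ.source ∩ φ ⁻¹' Metric.ball (φ c) r) :=
    φ.isOpen_inter_preimage Metric.isOpen_ball
  obtain ⟨χ, hχ, hχc, hχs, hχ1, hχI⟩ := exists_cutoff (n := n) (isCompact_singleton (x := c)) hOo
    (singleton_subset_iff.2 ⟨mem_chart_source _ c, Metric.mem_ball_self hr⟩)
  rw [nhdsSet_singleton] at hχ1
  obtain ⟨W, hW, hWo, hcW⟩ := mem_nhds_iff.1 hχ1
  refine ⟨W, hWo.mem_nhds hcW, fun u hu ⟨M, hM⟩ hwk => ?_⟩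
  obtain ⟨C₁, hC₁⟩ := D.exists_energy_cutoff_le hχ hχc hχI
  -- localise with `χ`, and pass to the chart
  set v : ℕ → X → ℂ := fun j x => (χ x : ℂ) * u j x with hv
  have hvt : ∀ j, v j ∈ testFunctions n (⊤ : TopologicalSpace.Opens X) := fun j =>
    ofReal_mul_mem_testFunctions hχ (hu j) (subset_univ _)
  have hvs : ∀ j, tsupport (v j) ⊆ tsupport χ := fun j =>
    closure_mono fun x hx h => hx (by simp [hv, h])
  have hE : ∀ j, D.energy (v j) ≤ |C₁| * |M| := fun j => by
    have h0 : 0 ≤ D.energy (u j) :=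
      (integral_nonneg fun _ => by positivity).trans (D.integral_norm_sq_le_energy _)
    refine (hC₁ _ (hu j)).trans ?_
    exact mul_le_mul (le_abs_self _) ((hM j).trans (le_abs_self _)) h0 (abs_nonneg _)
  have hE0 : ∀ j, 0 ≤ D.energy (v j) := fun j =>
    (integral_nonneg fun _ => by positivity).trans (D.integral_norm_sq_le_energy _)
  set w : ℕ → Model n → ℂ := fun j => inChart n c (v j) with hw
  have hSs : ∀ j, tsupport (v j) ⊆ φ.source := fun j => ((hvs j).trans hχs).trans inter_subset_left
  have hws : ∀ j, ContDiff ℝ ∞ (w j) ∧ tsupport (w j) ⊆ φ '' tsupport (v j) := fun j =>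
    inChart_smooth c (hvt j).1.contMDiffOn (hvt j).2.1 (hSs j)
      fun x hx => image_eq_zero_of_notMem_tsupport hx
  have hwc : ∀ j, HasCompactSupport (w j) := fun j =>
    ((hvt j).2.1.image_of_continuousOn (φ.continuousOn.mono (hSs j))).of_isClosed_subset
      (isClosed_tsupport _) (hws j).2
  have hres := fun j => hball (v j) (hvt j) ((hvs j).trans hχs)
  let f : ℕ → SchwartzMap (Model n) ℂ := fun j => (hwc j).toSchwartzMap (hws j).1
  have hfw : ∀ j p, f j p = w j p := fun j p => rfl
  have hF : ∀ j ξ, 𝓕 (f j) ξ =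
      ∫ p, Complex.exp (↑(-2 * Real.pi * inner ℝ p ξ) * Complex.I) * w j p := by
    intro j ξ
    rw [SchwartzMap.fourier_coe, Real.fourier_eq']
    rfl
  have hw2 : ∀ j, ∫ p, ‖w j p‖ ^ 2 ≤ C' * (|C₁| * |M|) := fun j =>
    (hres j).2.1.trans (mul_le_mul_of_nonneg_left
      ((D.integral_norm_sq_le_energy _).trans (hE j)) hC')
  have hlim := tendsto_integral_norm_sq_of_fourier (f := f)
    (C := volume.real (Metric.ball (φ c) r) + C' * (|C₁| * |M|)) (M := |C| * (|C₁| * |M|)) (by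
      -- the Fourier transforms are bounded by the `L¹` norms, on a ball of finite volume
      intro j ξ
      rw [hF]
      refine (norm_integral_le_integral_norm _).trans ?_
      have h1 : ∀ p, ‖Complex.exp (↑(-2 * Real.pi * inner ℝ p ξ) * Complex.I) * w j p‖ =
          ‖w j p‖ := by
        intro p
        rw [norm_mul, Complex.norm_exp_ofReal_mul_I, one_mul]
      simp only [h1]
      have hbi : Integrable ((Metric.ball (φ c) r).indicator fun _ : Model n => (1 : ℝ)) :=
        (integrable_indicator_iff Metric.isOpen_ball.measurableSet).2
          (integrableOn_const (hs := measure_ball_lt_top.ne))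
      have hwi := integrable_norm_sq_of_hasCompactSupport (hws j).1.continuous (hwc j)
      calc ∫ p, ‖w j p‖ ≤
          ∫ p, ((Metric.ball (φ c) r).indicator (fun _ : Model n => (1 : ℝ)) p + ‖w j p‖ ^ 2) := by
            refine integral_mono ((hws j).1.continuous.integrable_of_hasCompactSupport (hwc j)).norm
              (hbi.add hwi) fun p => ?_
            by_cases hp : p ∈ tsupport (w j)
            · obtain ⟨x, hx, rfl⟩ := (hws j).2 hp
              have : φ x ∈ Metric.ball (φ c) r := (hχs (hvs j hx)).2
              simp only [indicator_of_mem this]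
              nlinarith [sq_nonneg (‖w j (φ x)‖ - 1), sq_nonneg (‖w j (φ x)‖)]
            · simp only [image_eq_zero_of_notMem_tsupport hp]
              simpa using! indicator_nonneg (fun _ _ => zero_le_one) p
        _ = volume.real (Metric.ball (φ c) r) + ∫ p, ‖w j p‖ ^ 2 := by
            rw [integral_add hbi hwi, integral_indicator Metric.isOpen_ball.measurableSet,
              setIntegral_const, smul_eq_mul, mul_one]
        _ ≤ _ := by
            have := hw2 j
            gcongr)
    (by
      -- each value of the Fourier transforms is an `L²` pairing of `u j` with a fixed function
      intro ξ
      simp only [hF]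
      have hχ' := ofReal_mem_testFunctions hχ hχc
      have hχt : tsupport χ ⊆ φ.source := hχs.trans inter_subset_left
      obtain ⟨hg1, hg2⟩ := inChart_smooth c (u := fun x => (χ x : ℂ)) hχ'.1.contMDiffOn hχc hχt
        fun x hx => by simp [image_eq_zero_of_notMem_tsupport hx]
      have hec : Continuous fun p : Model n =>
          Complex.exp (↑(-2 * Real.pi * inner ℝ p ξ) * Complex.I) := by fun_prop
      obtain ⟨g, hg, hgc, hgu⟩ := exists_pairing_of_chart c
        (h := fun p => Complex.exp (↑(-2 * Real.pi * inner ℝ p ξ) * Complex.I) *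
          inChart n c (fun x => (χ x : ℂ)) p) (hec.mul hg1.continuous)
        (S := φ '' tsupport χ) (hχc.image_of_continuousOn (φ.continuousOn.mono hχt))
        (by rintro _ ⟨x, hx, rfl⟩; exact φ.map_source (hχt hx))
        (fun p hp => by
          rw [image_eq_zero_of_notMem_tsupport fun h => hp (hg2 h), mul_zero])
      refine (hwk g hg hgc).congr fun j => ?_
      rw [← hgu _ (hu j).1.continuous]
      refine integral_congr_ae (Eventually.of_forall fun p => ?_)
      by_cases hp : p ∈ φ.target
      · simp only [hw, inChart, ← hφ, indicator_of_mem hp, Function.comp_apply, hv, mul_assoc]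
      · simp only [hw, inChart, ← hφ, indicator_of_notMem hp]
        ring)
    (by
      intro j
      have h1 : ∀ k p, coordDeriv k (f j) p = fderiv ℝ (w j) p (EuclideanSpace.single k (1 : ℝ)) :=
        fun k p => SchwartzMap.lineDerivOp_apply_eq_fderiv _ _ _
      simp only [h1]
      refine (hres j).1.trans ?_
      exact mul_le_mul (le_abs_self _) (hE j) (hE0 j) (abs_nonneg _))
  simp only [hfw] at hlim
  have hlim2 := hlim.const_mul C'
  rw [mul_zero] at hlim2
  refine squeeze_zero (fun j => integral_nonneg fun _ => by positivity) (fun j => ?_) hlim2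
  refine le_trans ?_ (hres j).2.2
  calc _ = ∫ x in W, ‖v j x‖ ^ 2 ∂(riemannianVolume n X) := by
        refine setIntegral_congr_fun hWo.measurableSet fun x hx => ?_
        have : χ x = 1 := hW hx
        simp [hv, this]
    _ ≤ _ := setIntegral_le_integral (integrable_norm_sq (hvt j))
        (Eventually.of_forall fun _ => by positivity)

/-- Local compactness: a sequence of test functions of bounded energy which tends to zero weakly
tends to zero in `L²` on every compact set. -/
theorem tendsto_setIntegral_zero (hD : D.HasInjectiveSymbol) {u : ℕ → X → ℂ}
    (hu : ∀ j, u j ∈ testFunctions n (⊤ : TopologicalSpace.Opens X))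
    (hM : ∃ M, ∀ j, D.energy (u j) ≤ M)
    (hwk : ∀ v : X → ℂ, Continuous v → HasCompactSupport v →
      Tendsto (fun j => ∫ x, starRingEnd ℂ (v x) * u j x ∂(riemannianVolume n X)) atTop (𝓝 0))
    {L : Set X} (hL : IsCompact L) :
    Tendsto (fun j => ∫ x in L, ‖u j x‖ ^ 2 ∂(riemannianVolume n X)) atTop (𝓝 0) := by
  have hi := fun j => integrable_norm_sq (hu j)
  have h0 : ∀ (s : Set X) j, 0 ≤ ∫ x in s, ‖u j x‖ ^ 2 ∂(riemannianVolume n X) := fun s j =>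
    integral_nonneg fun _ => by positivity
  refine hL.induction_on (p := fun s =>
    Tendsto (fun j => ∫ x in s, ‖u j x‖ ^ 2 ∂(riemannianVolume n X)) atTop (𝓝 0)) ?_ ?_ ?_ ?_
  · simp
  · intro s t hst ht
    refine squeeze_zero (h0 s) (fun j => ?_) ht
    exact setIntegral_mono_set (hi j).integrableOn (Eventually.of_forall fun _ => by positivity)
      hst.eventuallyLE
  · intro s t hs ht
    have hst := hs.add ht
    rw [add_zero] at hst
    refine squeeze_zero (h0 _) (fun j => ?_) hst
    rw [← integral_add_measure (hi j).integrableOn (hi j).integrableOn]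
    exact integral_mono_measure (Measure.restrict_union_le s t)
      (Eventually.of_forall fun _ => by positivity)
      ((hi j).restrict.add_measure (hi j).restrict)
  · intro x _
    obtain ⟨W, hW, h⟩ := D.exists_nhds_tendsto_zero hD x
    exact ⟨W, mem_nhdsWithin_of_mem_nhds hW, h u hu hM hwk⟩

end FirstOrderOperator

end LocalCompactness

/-! ### The Friedrichs extension of `A† A` -/

section Friedrichs

open Filter

variable {E F : Type*} [NormedAddCommGroup E] [InnerProductSpace ℂ E] [CompleteSpace E]
  [NormedAddCommGroup F] [InnerProductSpace ℂ F] [CompleteSpace F]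

theorem isClosable_of_dense_adjoint_domain {A : E →ₗ.[ℂ] F} (hA : Dense (A.domain : Set E))
    (hA' : Dense (A.adjoint.domain : Set F)) : A.IsClosable :=
  (LinearPMap.adjoint_isClosed hA').isClosable.leIsClosable
    (LinearPMap.IsFormalAdjoint.le_adjoint hA' (LinearPMap.adjoint_isFormalAdjoint hA))

variable {A : E →ₗ.[ℂ] F}

theorem domain_compose_adjoint (hA : ∀ x : A.domain, A x ∈ A.adjoint.domain) :
    (compose A.adjoint A).domain = A.domain := by
  ext x
  constructor
  · rintro ⟨y, -, rfl⟩
    exact y.2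
  · exact fun hx => ⟨⟨x, hx⟩, hA _, rfl⟩

theorem inner_compose_adjoint (hd : Dense (A.domain : Set E)) (f : (compose A.adjoint A).domain) :
    ∃ y, ((f : E), y) ∈ A.graph ∧
      ∀ p ∈ A.graph, inner ℂ (compose A.adjoint A f) p.1 = inner ℂ y p.2 := by
  obtain ⟨y, hy, hz⟩ := (mem_graph_compose A.adjoint A _ _).1 ((compose A.adjoint A).mem_graph f)
  refine ⟨y, hy, fun p hp => ?_⟩
  rw [← inner_conj_symm, (mem_graph_adjoint_iff hd _ _).1 hz p hp, inner_conj_symm]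

/-- The form domain of `A† A` is the domain of the closure of `A`, since `⟪A† A f, f⟫ = ‖A f‖²`. -/
theorem mem_formDomain_iff (hd : Dense (A.domain : Set E)) (hc : A.IsClosable)
    (hA : ∀ x : A.domain, A x ∈ A.adjoint.domain) (f : E) :
    f ∈ formDomain (compose A.adjoint A) ↔ ∃ y, (f, y) ∈ A.closure.graph := by
  have hdom := domain_compose_adjoint hA
  rw [← hc.graph_closure_eq_closure_graph]
  have key : ∀ φ : (compose A.adjoint A).domain, ∀ y, ((φ : E), y) ∈ A.graph →
      (inner ℂ (compose A.adjoint A φ) (φ : E)).re = ‖y‖ ^ 2 := by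
    intro φ y hy
    obtain ⟨y', hy', h⟩ := inner_compose_adjoint hd φ
    rw [h _ hy, A.mem_graph_snd_inj hy' hy rfl, inner_self_eq_norm_sq_to_K]
    norm_cast
  constructor
  · rintro ⟨φ, hφ, hcau⟩
    have hφd : ∀ k, (φ k : E) ∈ A.domain := fun k => hdom ▸ (φ k).2
    choose y hy using fun k => LinearPMap.mem_domain_iff.1 (hφd k)
    have hcs : CauchySeq y := by
      refine Metric.cauchySeq_iff.2 fun ε hε => ?_
      obtain ⟨N, hN⟩ := hcau (ε ^ 2) (by positivity)
      refine ⟨N, fun j hj k hk => ?_⟩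
      have h := hN j hj k hk
      rw [key _ (y j - y k) (by simpa using! A.graph.sub_mem (hy j) (hy k))] at h
      rw [dist_eq_norm]
      exact lt_of_pow_lt_pow_left₀ 2 hε.le h
    obtain ⟨z, hz⟩ := cauchySeq_tendsto_of_complete hcs
    exact ⟨z, mem_closure_of_tendsto (hφ.prodMk_nhds hz) (Eventually.of_forall hy)⟩
  · rintro ⟨y, hy⟩
    obtain ⟨x, hx, hlim⟩ := mem_closure_iff_seq_limit.1 hy
    have hxd : ∀ k, (x k).1 ∈ (compose A.adjoint A).domain := fun k =>
      hdom ▸ LinearPMap.mem_domain_iff.2 ⟨_, hx k⟩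
    refine ⟨fun k => ⟨(x k).1, hxd k⟩, (continuous_fst.tendsto _).comp hlim, fun ε hε => ?_⟩
    have h2 : Tendsto (fun k => (x k).2) atTop (𝓝 y) := (continuous_snd.tendsto _).comp hlim
    obtain ⟨N, hN⟩ := Metric.cauchySeq_iff.1 h2.cauchySeq (Real.sqrt ε) (Real.sqrt_pos.2 hε)
    refine ⟨N, fun j hj k hk => ?_⟩
    rw [key _ ((x j).2 - (x k).2) (by simpa using! A.graph.sub_mem (hx j) (hx k)), ← dist_eq_norm]
    exact (Real.lt_sqrt dist_nonneg).1 (hN j hj k hk)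

/-- If `A` maps its domain to the domain of its adjoint, then `Ā† Ā` is the Friedrichs extension of
`A† A`. -/
theorem isFriedrichsExtension_closure (hd : Dense (A.domain : Set E)) (hc : A.IsClosable)
    (hA : ∀ x : A.domain, A x ∈ A.adjoint.domain) :
    IsFriedrichsExtension (compose A.adjoint A) (compose A.closure.adjoint A.closure) := by
  have hdom := domain_compose_adjoint hA
  have hle : A ≤ A.closure := A.le_closure
  have hd' : Dense (A.closure.domain : Set E) := hd.mono hle.1
  refine ⟨by rw [hdom]; exact hd, fun f g => ?_, fun f => ?_, fun f u => ?_⟩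
  · obtain ⟨y, hy, h⟩ := inner_compose_adjoint hd f
    obtain ⟨z, hz, h'⟩ := inner_compose_adjoint hd g
    rw [h _ hz, ← inner_conj_symm (f : E), h' _ hy, inner_conj_symm]
  · obtain ⟨y, hy, h⟩ := inner_compose_adjoint hd f
    rw [h _ hy]
    exact inner_self_nonneg (𝕜 := ℂ) (x := y)
  · have hgr : ∀ p, p ∈ A.closure.graph ↔ p ∈ closure (A.graph : Set (E × F)) := by
      intro p
      rw [← hc.graph_closure_eq_closure_graph]
      rfl
    -- identities on the graph of `A` extend to the graph of the closure
    have hext : ∀ (a : E) (b : F), (∀ p ∈ A.graph, inner ℂ a p.1 = inner ℂ b p.2) →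
        ∀ p ∈ A.closure.graph, inner ℂ a p.1 = inner ℂ b p.2 := by
      intro a b h p hp
      exact closure_minimal (s := (A.graph : Set (E × F)))
        (t := {p : E × F | inner ℂ a p.1 = inner ℂ b p.2}) h
        (isClosed_eq (by fun_prop) (by fun_prop)) ((hgr p).1 hp)
    have hext' : ∀ (a : E) (b : F), (∀ p ∈ A.graph, inner ℂ p.1 a = inner ℂ p.2 b) →
        ∀ p ∈ A.closure.graph, inner ℂ p.1 a = inner ℂ p.2 b := by
      intro a b h p hp
      rw [← inner_conj_symm, hext a b (fun q hq => ?_) p hp, inner_conj_symm]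
      rw [← inner_conj_symm, h q hq, inner_conj_symm]
    have hsmall : ∀ p ∈ A.graph, p ∈ A.closure.graph := fun p hp => (hgr p).2 (subset_closure hp)
    rw [mem_graph_compose, mem_formDomain_iff hd hc hA]
    constructor
    · rintro ⟨y, hy, hyu⟩
      refine ⟨⟨y, hy⟩, fun g => ?_⟩
      obtain ⟨z, hz, h⟩ := inner_compose_adjoint hd g
      rw [hext _ _ h _ hy, (mem_graph_adjoint_iff hd' _ _).1 hyu _ (hsmall _ hz)]
    · rintro ⟨⟨y, hy⟩, hu⟩
      refine ⟨y, hy, (mem_graph_adjoint_iff hd' _ _).2 (hext' _ _ fun p hp => ?_)⟩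
      have hpd : p.1 ∈ (compose A.adjoint A).domain := hdom ▸ LinearPMap.mem_domain_iff.2 ⟨_, hp⟩
      obtain ⟨z, hz, h⟩ := inner_compose_adjoint hd ⟨p.1, hpd⟩
      rw [← hu ⟨p.1, hpd⟩, hext _ _ h _ hy, A.mem_graph_snd_inj hz hp rfl]

end Friedrichs

/-! ### The graph of the closure of `D` -/

section Graph

open Filter

variable {n : ℕ} {X : Type*} [TopologicalSpace X] [T2Space X] [SecondCountableTopology X]
  [ChartedSpace (Model n) X] [IsManifold (𝓡 n) ∞ X]
  [RiemannianBundle (fun x : X => TangentSpace (𝓡 n) x)]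
  [IsContMDiffRiemannianBundle (𝓡 n) ∞ (Model n) (fun x : X => TangentSpace (𝓡 n) x)]
  [MeasurableSpace X] [BorelSpace X]

theorem setIntegral_eq_integral_of_testFunction {U : TopologicalSpace.Opens X}
    (u : testFunctions n U)
    (g : X → ℂ) : ∫ x in U, g x * u.1 x ∂(riemannianVolume n X) =
      ∫ x, g x * u.1 x ∂(riemannianVolume n X) := by
  refine setIntegral_eq_integral_of_forall_compl_eq_zero fun x hx => ?_
  rw [image_eq_zero_of_notMem_tsupport fun h => hx (u.2.2.2 h), mul_zero]

/-- The `L²` pairing of a function with a test function. -/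
theorem inner_toLp_testToL2 {U : TopologicalSpace.Opens X} {v : X → ℂ}
    (hv : MemLp v 2 ((riemannianVolume n X).restrict (U : Set X))) (u : testFunctions n U) :
    inner ℂ (hv.toLp v) (testToL2 U u) =
      ∫ x, starRingEnd ℂ (v x) * u.1 x ∂(riemannianVolume n X) := by
  rw [L2.inner_def, ← setIntegral_eq_integral_of_testFunction]
  refine integral_congr_ae ?_
  filter_upwards [hv.coeFn_toLp, (testFunction_memLp u).coeFn_toLp] with x h1 h2
  have h3 : (testToL2 U u : X → ℂ) x = u.1 x := h2
  rw [h1, h3, RCLike.inner_apply, mul_comm]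

/-- The fundamental lemma of the calculus of variations. -/
theorem denseRange_testToL2 (U : TopologicalSpace.Opens X) : DenseRange (testToL2 (n := n) U) := by
  have h : (LinearMap.range (testToL2 (n := n) U)).topologicalClosure = ⊤ := by
    rw [Submodule.topologicalClosure_eq_top_iff, Submodule.eq_bot_iff]
    intro f hf
    set ν := (riemannianVolume n X).restrict (U : Set X) with hν
    have hfL : MemLp f 2 ν := Lp.memLp f
    have := ChartedSpace.locallyCompactSpace (Model n) X
    have h1 : ∀ᵐ x ∂ν, x ∈ (U : Set X) → f x = 0 := by
      refine U.isOpen.ae_eq_zero_of_integral_contMDiff_smul_eq_zero (𝓡 n)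
        ((hfL.locallyIntegrable (by norm_num)).locallyIntegrableOn _) fun g hg hgc hgU => ?_
      have hsub : tsupport (fun x => (g x : ℂ)) ⊆ U := by
        refine (closure_mono fun x hx => ?_).trans hgU
        intro h0
        exact hx (by simp [h0])
      have hu : (fun x => (g x : ℂ)) ∈ testFunctions n U :=
        ⟨contMDiff_ofReal hg, hgc.comp_left (g := fun t : ℝ => (t : ℂ)) Complex.ofReal_zero,
          hsub⟩
      have h2 := hf _ ⟨⟨_, hu⟩, rfl⟩
      rw [L2.inner_def] at h2
      rw [← h2]
      refine integral_congr_ae ?_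
      filter_upwards [(testFunction_memLp (⟨_, hu⟩ : testFunctions n U)).coeFn_toLp] with x h3
      have h4 : (testToL2 U (⟨_, hu⟩ : testFunctions n U) : X → ℂ) x = (g x : ℂ) := h3
      rw [h4, RCLike.inner_apply, Complex.conj_ofReal, Complex.real_smul, mul_comm]
    refine Lp.ext ?_
    filter_upwards [h1, ae_restrict_mem U.isOpen.measurableSet,
      Lp.coeFn_zero ℂ 2 ν] with x h2 h3 h4
    rw [h2 h3, h4, Pi.zero_apply]
  exact Submodule.dense_iff_topologicalClosure_eq_top.2 h

namespace FirstOrderOperator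

variable (D : FirstOrderOperator n X)

theorem dense_domain_minimal (U : TopologicalSpace.Opens X) :
    Dense ((D.minimal U).domain : Set (L2Fun n U)) := denseRange_testToL2 U

theorem mem_graph_minimal_iff (U : TopologicalSpace.Opens X) (p : L2Fun n U × L2Form n U) :
    p ∈ (D.minimal U).graph ↔ ∃ u, (testToL2 U u, (D.onTest U u : L2Form n U)) = p := by
  have happ : ∀ u, D.minimal U ⟨testToL2 U u, u, rfl⟩ = (D.onTest U u : L2Form n U) := by
    intro u
    change ((D.onTest U ((LinearEquiv.ofInjective (testToL2 U) (testToL2_injective U)).symm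
      (LinearEquiv.ofInjective (testToL2 U) (testToL2_injective U) u))) : L2Form n U) = _
    rw [LinearEquiv.symm_apply_apply]
  rw [LinearPMap.mem_graph_iff]
  constructor
  · rintro ⟨⟨_, u, rfl⟩, h1, h2⟩
    exact ⟨u, Prod.ext h1 ((happ u).symm.trans h2)⟩
  · rintro ⟨u, rfl⟩
    exact ⟨⟨_, u, rfl⟩, rfl, happ u⟩

theorem coe_mem_adjoint_domain (hD : D.HasInjectiveSymbol) (U : TopologicalSpace.Opens X)
    (θ : TestForm n U) : (θ : L2Form n U) ∈ (D.minimal U).adjoint.domain := by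
  obtain ⟨v, hv, hvc, h⟩ := hasFormalAdjoint D hD θ.2.1 θ.2.2.1
  have hvL : MemLp v 2 ((riemannianVolume n X).restrict (U : Set X)) :=
    (hv.memLp_of_hasCompactSupport hvc).restrict _
  refine LinearPMap.mem_adjoint_domain_of_exists _ ⟨hvL.toLp v, fun x => ?_⟩
  obtain ⟨u, hu⟩ := (D.mem_graph_minimal_iff U _).1 ((D.minimal U).mem_graph x)
  have h1 : (x : L2Fun n U) = testToL2 U u := (congrArg Prod.fst hu).symm
  have h2 : D.minimal U x = (D.onTest U u : L2Form n U) := (congrArg Prod.snd hu).symm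
  rw [h1, h2, inner_toLp_testToL2, UniformSpace.Completion.inner_coe]
  exact (h u.1 ⟨u.2.1, u.2.2.1, subset_univ _⟩).symm

theorem minimal_mem_adjoint_domain (hD : D.HasInjectiveSymbol) (U : TopologicalSpace.Opens X)
    (x : (D.minimal U).domain) : D.minimal U x ∈ (D.minimal U).adjoint.domain := by
  obtain ⟨u, hu⟩ := (D.mem_graph_minimal_iff U _).1 ((D.minimal U).mem_graph x)
  have h : D.minimal U x = (D.onTest U u : L2Form n U) := (congrArg Prod.snd hu).symm
  rw [h]
  exact D.coe_mem_adjoint_domain hD U _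

theorem isClosable_minimal (hD : D.HasInjectiveSymbol) (U : TopologicalSpace.Opens X) :
    (D.minimal U).IsClosable := by
  refine isClosable_of_dense_adjoint_domain (D.dense_domain_minimal U) ?_
  refine (UniformSpace.Completion.denseRange_coe (α := TestForm n U)).mono ?_
  rintro _ ⟨θ, rfl⟩
  exact D.coe_mem_adjoint_domain hD U θ

theorem dense_domain_closed (U : TopologicalSpace.Opens X) :
    Dense ((D.closed U).domain : Set (L2Fun n U)) :=
  (D.dense_domain_minimal U).mono (D.minimal U).le_closure.1

/-- The map `u ↦ (u, D u)` from test functions to the graph of the closure of `D`. -/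
noncomputable def testToGraph (U : TopologicalSpace.Opens X) :
    testFunctions n U →ₗ[ℂ] hilbertGraph (D.closed U) where
  toFun u := ⟨WithLp.toLp 2 (testToL2 U u, (D.onTest U u : L2Form n U)),
    LinearPMap.le_graph_of_le (D.minimal U).le_closure ((D.mem_graph_minimal_iff U _).2 ⟨u, rfl⟩)⟩
  map_add' u v := by
    refine Subtype.ext (congrArg (WithLp.toLp 2) (Prod.ext (map_add _ _ _) ?_))
    change ((D.onTest U (u + v) : TestForm n U) : L2Form n U) = _
    rw [map_add, UniformSpace.Completion.coe_add]
    rfl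
  map_smul' z u := by
    refine Subtype.ext (congrArg (WithLp.toLp 2) (Prod.ext (map_smul _ _ _) ?_))
    change ((D.onTest U (z • u) : TestForm n U) : L2Form n U) = _
    rw [map_smul, UniformSpace.Completion.coe_smul]
    rfl

theorem graphFst_testToGraph (U : TopologicalSpace.Opens X) (u : testFunctions n U) :
    graphFst (D.closed U) (D.testToGraph U u) = testToL2 U u := rfl

theorem denseRange_testToGraph (hD : D.HasInjectiveSymbol) (U : TopologicalSpace.Opens X) :
    DenseRange (D.testToGraph U) := by
  rintro ⟨q, hq⟩
  have h1 : (q.fst, q.snd) ∈ (D.closed U).graph := hq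
  rw [closed, ← (D.isClosable_minimal hD U).graph_closure_eq_closure_graph] at h1
  obtain ⟨x, hx, hlim⟩ := mem_closure_iff_seq_limit.1 h1
  choose u hu using fun k => (D.mem_graph_minimal_iff U _).1 (hx k)
  refine mem_closure_of_tendsto (f := fun k => D.testToGraph U (u k)) (b := atTop) ?_
    (Eventually.of_forall fun k => mem_range_self _)
  refine tendsto_subtype_rng.2 ?_
  have h2 := ((WithLp.prod_continuous_toLp 2 (L2Fun n U) (L2Form n U)).tendsto _).comp hlim
  refine h2.congr fun k => ?_
  rw [Function.comp_apply, ← hu k]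
  rfl

theorem inner_testToGraph (U : TopologicalSpace.Opens X) (u v : testFunctions n U) :
    inner ℂ (D.testToGraph U u) (D.testToGraph U v) =
      (∫ x, starRingEnd ℂ (u.1 x) * v.1 x ∂(riemannianVolume n X)) +
        ∫ x, cotInner x (D.toForm u.1 x) (D.toForm v.1 x) ∂(riemannianVolume n X) := by
  rw [Submodule.coe_inner, WithLp.prod_inner_apply]
  congr 1
  · exact inner_toLp_testToL2 (testFunction_memLp u) v
  · exact UniformSpace.Completion.inner_coe _ _

theorem norm_sq_testToL2 (U : TopologicalSpace.Opens X) (u : testFunctions n U) :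
    ‖testToL2 U u‖ ^ 2 = ∫ x, ‖u.1 x‖ ^ 2 ∂(riemannianVolume n X) := by
  have h := inner_toLp_testToL2 (testFunction_memLp u) u
  have h2 : inner ℂ (testToL2 U u) (testToL2 U u) = ((‖testToL2 U u‖ ^ 2 : ℝ) : ℂ) := by
    rw [inner_self_eq_norm_sq_to_K]
    norm_cast
  refine Complex.ofReal_injective (h2.symm.trans (h.trans ?_))
  rw [← integral_complex_ofReal]
  refine integral_congr_ae (Eventually.of_forall fun x => ?_)
  simp [Complex.conj_mul']

theorem norm_sq_testToGraph (U : TopologicalSpace.Opens X) (u : testFunctions n U) :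
    ‖D.testToGraph U u‖ ^ 2 = D.energy u.1 := by
  have h := D.inner_testToGraph U u u
  have h2 : inner ℂ (D.testToGraph U u) (D.testToGraph U u) =
      ((‖D.testToGraph U u‖ ^ 2 : ℝ) : ℂ) := by
    exact_mod_cast inner_self_eq_norm_sq_to_K (𝕜 := ℂ) (D.testToGraph U u)
  refine Complex.ofReal_injective (h2.symm.trans (h.trans ?_))
  rw [energy, Complex.ofReal_add, ← integral_complex_ofReal, ← integral_complex_ofReal]
  congr 1
  · refine integral_congr_ae (Eventually.of_forall fun x => ?_)
    simp [Complex.conj_mul']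
  · refine integral_congr_ae (Eventually.of_forall fun x => ?_)
    simp only
    rw [normSq_eq, cotInner_self]

/-- The inclusion `C_c^∞(U) → C_c^∞(X)`. -/
def testInclusion (U : TopologicalSpace.Opens X) :
    testFunctions n U →ₗ[ℂ] testFunctions n (⊤ : TopologicalSpace.Opens X) :=
  Submodule.inclusion fun _ hu => ⟨hu.1, hu.2.1, subset_univ _⟩

/-- Extension by zero, as an isometry of the `L²` spaces and of the graphs. -/
theorem exists_extension_by_zero (hD : D.HasInjectiveSymbol) (U : TopologicalSpace.Opens X) :
    ∃ (J : L2Fun n U →ₗᵢ[ℂ] L2Fun n (⊤ : TopologicalSpace.Opens X))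
      (j : hilbertGraph (D.closed U) →ₗᵢ[ℂ] hilbertGraph (D.closed ⊤)),
      (∀ u, j (D.testToGraph U u) = D.testToGraph ⊤ (testInclusion U u)) ∧
      ∀ q, graphFst (D.closed ⊤) (j q) = J (graphFst (D.closed U) q) := by
  have hc := (D.isClosable_minimal hD ⊤).closure_isClosed
  have : CompleteSpace (hilbertGraph (D.closed (⊤ : TopologicalSpace.Opens X))) :=
    (isClosed_hilbertGraph hc).completeSpace_coe
  obtain ⟨J, hJ⟩ := exists_linearIsometry_extension (testToL2 (n := n) U) (denseRange_testToL2 U)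
    (testToL2 ⊤ ∘ₗ testInclusion U) fun u => by
      rw [← sq_eq_sq₀ (norm_nonneg _) (norm_nonneg _), LinearMap.comp_apply, norm_sq_testToL2,
        norm_sq_testToL2]
      rfl
  obtain ⟨j, hj⟩ := exists_linearIsometry_extension (D.testToGraph U)
      (D.denseRange_testToGraph hD U)
    (D.testToGraph ⊤ ∘ₗ testInclusion U) fun u => by
      rw [← sq_eq_sq₀ (norm_nonneg _) (norm_nonneg _), LinearMap.comp_apply, norm_sq_testToGraph,
        norm_sq_testToGraph]
      rfl
  refine ⟨J, j, hj, fun q => ?_⟩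
  refine (D.denseRange_testToGraph hD U).induction_on
    (p := fun q => graphFst (D.closed ⊤) (j q) = J (graphFst (D.closed U) q)) q ?_ fun u => ?_
  · exact isClosed_eq ((graphFst _).continuous.comp j.continuous)
      (J.continuous.comp (graphFst _).continuous)
  · rw [hj, LinearMap.comp_apply, graphFst_testToGraph, graphFst_testToGraph, hJ]
    rfl

end FirstOrderOperator

end Graph

/-! ### Removing a compact set -/

section Cut

open Filter

variable {n : ℕ} {X : Type*} [TopologicalSpace X] [T2Space X] [SecondCountableTopology X]
  [ChartedSpace (Model n) X] [IsManifold (𝓡 n) ∞ X]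
  [RiemannianBundle (fun x : X => TangentSpace (𝓡 n) x)]
  [IsContMDiffRiemannianBundle (𝓡 n) ∞ (Model n) (fun x : X => TangentSpace (𝓡 n) x)]
  [MeasurableSpace X] [BorelSpace X]

theorem re_inner_le_of_inner_eq_zero {G : Type*} [NormedAddCommGroup G] [InnerProductSpace ℂ G]
    {b q : G} (h : inner ℂ b q = 0) (a : G) : (inner ℂ a b).re ≤ ‖a - q‖ * ‖b‖ := by
  have h1 : inner ℂ a b = inner ℂ (a - q) b := by
    rw [inner_sub_left, ← inner_conj_symm q b, h, map_zero, sub_zero]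
  rw [h1]
  exact (Complex.re_le_norm _).trans (norm_inner_le_norm _ _)

namespace FirstOrderOperator

variable (D : FirstOrderOperator n X)

theorem symbol_diff_one_sub {χ : X → ℝ} (hχ : ContMDiff (𝓡 n) 𝓘(ℝ, ℝ) ∞ χ) (x : X) :
    D.symbol x (diff n (fun y => ((1 - χ y : ℝ) : ℂ)) x) =
      -D.symbol x (diff n (fun y => (χ y : ℂ)) x) := by
  have h1 : diff n ((fun y => ((1 - χ y : ℝ) : ℂ)) + fun y => (χ y : ℂ)) x = 0 := by
    have h2 : ((fun y => ((1 - χ y : ℝ) : ℂ)) + fun y => (χ y : ℂ)) = fun _ : X => (1 : ℂ) := by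
      ext y
      simp
    rw [h2]
    exact mfderiv_const
  rw [diff_add (contMDiff_ofReal (contMDiff_const.sub hχ)) (contMDiff_ofReal hχ)] at h1
  rw [← map_neg, eq_neg_of_add_eq_zero_left h1]

/-- The localisation identity `Re ⟪D u, D (ψ² u)⟫ = |D (ψ u)|² - |u|² |σ(dψ)|²` for real `ψ`. -/
theorem re_cotInner_toForm_sq_mul {ψ : X → ℝ} (hψ : ContMDiff (𝓡 n) 𝓘(ℝ, ℝ) ∞ ψ) {u : X → ℂ}
    (hu : ContMDiff (𝓡 n) 𝓘(ℝ, ℂ) ∞ u) (x : X) :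
    (cotInner x (D.toForm u x) (D.toForm (fun y => ((ψ y ^ 2 : ℝ) : ℂ) * u y) x)).re =
      normSq x (D.toForm (fun y => (ψ y : ℂ) * u y) x) -
        ‖u x‖ ^ 2 * normSq x (D.symbol x (diff n (fun y => (ψ y : ℂ)) x)) := by
  have h1 : (fun y => ((ψ y ^ 2 : ℝ) : ℂ) * u y) = fun y => (ψ y : ℂ) * ((ψ y : ℂ) * u y) := by
    ext y
    push_cast
    ring
  have hψ' := contMDiff_ofReal hψ
  rw [h1, D.toForm_mul hψ' (contMDiff_complex_mul hψ' hu), D.toForm_mul hψ' hu]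
  set α := D.toForm u x
  set β := D.symbol x (diff n (fun y => (ψ y : ℂ)) x)
  simp only [normSq_eq, cotInner, Complex.re_sum, Finset.mul_sum, ← Finset.sum_sub_distrib]
  refine Finset.sum_congr rfl fun i _ => ?_
  set e := stdOrthonormalBasis ℝ (TangentSpace (𝓡 n) x) i
  have h2 : ((ψ x : ℂ) • ((ψ x : ℂ) • α + u x • β) + ((ψ x : ℂ) * u x) • β) e =
      (ψ x : ℂ) * ((ψ x : ℂ) * α e + u x * β e) + ((ψ x : ℂ) * u x) * β e := rfl
  have h3 : ((ψ x : ℂ) • α + u x • β) e = (ψ x : ℂ) * α e + u x * β e := rfl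
  rw [h2, h3, ← mul_pow, ← norm_mul, Complex.sq_norm, Complex.sq_norm, Complex.normSq_apply,
    Complex.normSq_apply]
  simp only [Complex.add_re, Complex.add_im, Complex.mul_re, Complex.mul_im, Complex.conj_re,
    Complex.conj_im, Complex.ofReal_re, Complex.ofReal_im]
  ring

/-- Away from the region where the cutoff `χ` is not constant, the `L²` norm is controlled by the
graph pairing. -/
theorem integral_one_sub_cutoff_sq_le {χ : X → ℝ} (hχ : ContMDiff (𝓡 n) 𝓘(ℝ, ℝ) ∞ χ)
    (hχc : HasCompactSupport χ) : ∃ C, ∀ u ∈ testFunctions n (⊤ : TopologicalSpace.Opens X),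
      ∫ x, (1 - χ x) ^ 2 * ‖u x‖ ^ 2 ∂(riemannianVolume n X) ≤
        ((∫ x, starRingEnd ℂ (u x) * ((((1 - χ x) ^ 2 : ℝ) : ℂ) * u x) ∂(riemannianVolume n X)) +
          ∫ x, cotInner x (D.toForm u x)
            (D.toForm (fun y => (((1 - χ y) ^ 2 : ℝ) : ℂ) * u y) x) ∂(riemannianVolume n X)).re +
        C * ∫ x in tsupport χ, ‖u x‖ ^ 2 ∂(riemannianVolume n X) := by
  obtain ⟨C, hC⟩ := D.exists_normSq_symbol_diff_le hχ hχc
  refine ⟨C, fun u hu => ?_⟩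
  have hψ : ContMDiff (𝓡 n) 𝓘(ℝ, ℝ) ∞ fun x => 1 - χ x := contMDiff_const.sub hχ
  have hψ2 : ContMDiff (𝓡 n) 𝓘(ℝ, ℝ) ∞ fun x => (1 - χ x) ^ 2 := hψ.pow 2
  have hw : (fun y => (((1 - χ y) ^ 2 : ℝ) : ℂ) * u y) ∈ testFunctions n
      (⊤ : TopologicalSpace.Opens X) :=
    ofReal_mul_mem_testFunctions hψ2 hu (subset_univ _)
  have hv : (fun y => ((1 - χ y : ℝ) : ℂ) * u y) ∈ testFunctions n (⊤ : TopologicalSpace.Opens X) :=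
    ofReal_mul_mem_testFunctions hψ hu (subset_univ _)
  have hi1 : Integrable (fun x => starRingEnd ℂ (u x) * ((((1 - χ x) ^ 2 : ℝ) : ℂ) * u x))
      (riemannianVolume n X) :=
    ((Complex.continuous_conj.comp hu.1.continuous).mul
      hw.1.continuous).integrable_of_hasCompactSupport
      (HasCompactSupport.intro hu.2.1 fun x hx => by simp [image_eq_zero_of_notMem_tsupport hx])
  have hi2 : Integrable (fun x => cotInner x (D.toForm u x)
      (D.toForm (fun y => (((1 - χ y) ^ 2 : ℝ) : ℂ) * u y) x)) (riemannianVolume n X) :=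
    (cotInner_continuous (D.smooth u hu) (D.smooth _ hw)).integrable_of_hasCompactSupport
      (HasCompactSupport.intro hu.2.1 fun x hx => by
        change cotInner x (D.toForm u x) _ = 0
        rw [D.toForm_eq_zero hx, cotInner_zero_left])
  have hre1 : (∫ x, starRingEnd ℂ (u x) * ((((1 - χ x) ^ 2 : ℝ) : ℂ) * u x)
      ∂(riemannianVolume n X)).re =
      ∫ x, (1 - χ x) ^ 2 * ‖u x‖ ^ 2 ∂(riemannianVolume n X) := by
    rw [← RCLike.re_eq_complex_re, ← integral_re hi1]
    refine integral_congr_ae (Eventually.of_forall fun x => ?_)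
    have : starRingEnd ℂ (u x) * ((((1 - χ x) ^ 2 : ℝ) : ℂ) * u x) =
        (((1 - χ x) ^ 2 * ‖u x‖ ^ 2 : ℝ) : ℂ) := by
      rw [mul_left_comm, Complex.conj_mul']
      push_cast
      ring
    simp only
    rw [this]
    exact Complex.ofReal_re _
  have hb : ∀ x, -((tsupport χ).indicator (fun x => C * ‖u x‖ ^ 2) x) ≤
      (cotInner x (D.toForm u x) (D.toForm (fun y => (((1 - χ y) ^ 2 : ℝ) : ℂ) * u y) x)).re := by
    intro x
    rw [D.re_cotInner_toForm_sq_mul hψ hu.1, D.symbol_diff_one_sub hχ]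
    have h1 : ∀ α : CCot n X x, normSq x (-α) = normSq x α := fun α => by
      rw [← neg_one_smul ℂ α, normSq_smul]
      simp
    rw [h1]
    have h2 := normSq_nonneg x (D.toForm (fun y => ((1 - χ y : ℝ) : ℂ) * u y) x)
    by_cases hx : x ∈ tsupport χ
    · rw [indicator_of_mem hx]
      have := mul_le_mul_of_nonneg_left (hC x) (sq_nonneg ‖u x‖)
      linarith
    · have h3 : diff n (fun y => (χ y : ℂ)) x = 0 :=
        diff_eq_zero fun h => hx (closure_mono (fun y hy => by
          intro h0
          exact hy (by simp [h0])) h)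
      rw [indicator_of_notMem hx, h3, map_zero, normSq_zero]
      linarith
  have hre2 : -(C * ∫ x in tsupport χ, ‖u x‖ ^ 2 ∂(riemannianVolume n X)) ≤
      (∫ x, cotInner x (D.toForm u x)
        (D.toForm (fun y => (((1 - χ y) ^ 2 : ℝ) : ℂ) * u y) x) ∂(riemannianVolume n X)).re := by
    rw [← RCLike.re_eq_complex_re, ← integral_re hi2, ← integral_const_mul,
      ← integral_indicator (isClosed_tsupport χ).measurableSet, ← integral_neg]
    exact integral_mono (((integrable_norm_sq hu).const_mul C).indicator
      (isClosed_tsupport χ).measurableSet).neg hi2.re hb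
  rw [Complex.add_re, hre1]
  linarith

/-- A bounded sequence in the graph of the closure of `D` on `X` which is orthogonal to the graph
over the complement of `K` and tends to zero weakly in `L²` tends to zero in `L²`. -/
theorem tendsto_graphFst_of_orthogonal (hD : D.HasInjectiveSymbol) {K : Set X} (hK : IsCompact K)
    {U : TopologicalSpace.Opens X} (hU : (U : Set X) = Kᶜ)
    {q : ℕ → hilbertGraph (D.closed (⊤ : TopologicalSpace.Opens X))}
    (horth : ∀ k w, inner ℂ (D.testToGraph ⊤ (testInclusion U w)) (q k) = 0)
    (hbd : ∃ C, ∀ k, ‖q k‖ ≤ C) (hwk : WeaklyNull fun k => graphFst (D.closed ⊤) (q k)) :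
    Tendsto (fun k => graphFst (D.closed ⊤) (q k)) atTop (𝓝 0) := by
  obtain ⟨M, hM⟩ := hbd
  -- approximate by test functions
  have happ : ∀ k : ℕ, ∃ u, ‖D.testToGraph ⊤ u - q k‖ < 1 / ((k : ℝ) + 1) := by
    intro k
    obtain ⟨_, hu, ⟨u, rfl⟩⟩ := Metric.dense_iff.1 (D.denseRange_testToGraph hD ⊤) (q k)
      (1 / ((k : ℝ) + 1)) (by positivity)
    exact ⟨u, by rwa [Metric.mem_ball, dist_eq_norm] at hu⟩
  choose u hu using happ
  have hinv : Tendsto (fun k : ℕ => 1 / ((k : ℝ) + 1)) atTop (𝓝 0) :=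
    tendsto_one_div_add_atTop_nhds_zero_nat
  have hsub : Tendsto (fun k => D.testToGraph ⊤ (u k) - q k) atTop (𝓝 0) :=
    squeeze_zero_norm (fun k => (hu k).le) hinv
  have hsub' : Tendsto (fun k => testToL2 ⊤ (u k) - graphFst (D.closed ⊤) (q k)) atTop (𝓝 0) := by
    have h := ((graphFst (D.closed (⊤ : TopologicalSpace.Opens X))).continuous.tendsto 0).comp hsub
    rw [map_zero] at h
    refine h.congr fun k => ?_
    rw [Function.comp_apply, map_sub, graphFst_testToGraph]
  have hut : ∀ k, (u k).1 ∈ testFunctions n (⊤ : TopologicalSpace.Opens X) := fun k => (u k).2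
  have hnb : ∀ k, ‖D.testToGraph ⊤ (u k)‖ ≤ M + 1 := fun k => by
    have h1 : 1 / ((k : ℝ) + 1) ≤ 1 := by
      rw [div_le_one (by positivity)]
      linarith [(Nat.cast_nonneg k : (0 : ℝ) ≤ k)]
    calc _ = ‖q k + (D.testToGraph ⊤ (u k) - q k)‖ := by rw [add_sub_cancel]
      _ ≤ _ := norm_add_le _ _
      _ ≤ _ := add_le_add (hM k) ((hu k).le.trans h1)
  have hE : ∀ k, D.energy (u k).1 ≤ (M + 1) ^ 2 := fun k => by
    rw [← norm_sq_testToGraph]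
    exact pow_le_pow_left₀ (norm_nonneg _) (hnb k) 2
  -- local compactness
  have hloc : ∀ L : Set X, IsCompact L →
      Tendsto (fun k => ∫ x in L, ‖(u k).1 x‖ ^ 2 ∂(riemannianVolume n X)) atTop (𝓝 0) := by
    intro L hL
    refine D.tendsto_setIntegral_zero hD hut ⟨_, hE⟩ (fun v hv hvc => ?_) hL
    have hvL : MemLp v 2 ((riemannianVolume n X).restrict
        ((⊤ : TopologicalSpace.Opens X) : Set X)) :=
      (hv.memLp_of_hasCompactSupport hvc).restrict _
    refine ((hwk.congr_of_tendsto_sub hsub').tendsto_inner (hvL.toLp v)).congr fun k => ?_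
    exact inner_toLp_testToL2 hvL (u k)
  obtain ⟨χ, hχ, hχc, -, hχ1, hχI⟩ := exists_cutoff (n := n) hK isOpen_univ (subset_univ K)
  set g : X → ℝ := fun x => (1 - χ x) ^ 2 with hg
  have hgs : ContMDiff (𝓡 n) 𝓘(ℝ, ℝ) ∞ g := (contMDiff_const.sub hχ).pow 2
  have hgU : tsupport g ⊆ U := by
    intro x hx
    rw [hU]
    intro hxK
    refine notMem_tsupport_iff_eventuallyEq.2 ?_ hx
    filter_upwards [eventually_nhdsSet_iff_forall.1 hχ1 x hxK] with y hy
    simp [hg, hy]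
  -- `g = (1 - χ)²` is not compactly supported, but `h = 1 - g` is
  set h : X → ℝ := fun x => χ x * (2 - χ x) with hh
  have hhs : ContMDiff (𝓡 n) 𝓘(ℝ, ℝ) ∞ h := hχ.mul (contMDiff_const.sub hχ)
  have hhI : ∀ x, h x ∈ Icc (0 : ℝ) 1 := fun x => by
    obtain ⟨h0, h1⟩ := hχI x
    constructor
    · exact mul_nonneg h0 (by linarith)
    · simp only [hh]
      nlinarith [sq_nonneg (1 - χ x)]
  obtain ⟨C₁, hC₁⟩ := D.exists_energy_cutoff_le hhs (hχc.mul_right) hhI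
  obtain ⟨C₂, hC₂⟩ := D.integral_one_sub_cutoff_sq_le hχ hχc
  let w : ℕ → testFunctions n U := fun k =>
    ⟨fun x => (g x : ℂ) * (u k).1 x, ofReal_mul_mem_testFunctions hgs (hut k) hgU⟩
  let z : ℕ → testFunctions n (⊤ : TopologicalSpace.Opens X) := fun k =>
    ⟨fun x => (h x : ℂ) * (u k).1 x, ofReal_mul_mem_testFunctions hhs (hut k) (subset_univ _)⟩
  have hwz : ∀ k, testInclusion U (w k) = u k - z k := by
    intro k
    refine Subtype.ext (funext fun x => ?_)
    change (g x : ℂ) * (u k).1 x = (u k).1 x - (h x : ℂ) * (u k).1 x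
    simp only [hg, hh]
    push_cast
    ring
  have hM1 : 0 ≤ M + 1 := (norm_nonneg _).trans (hnb 0)
  have hzb : ∀ k, ‖D.testToGraph ⊤ (z k)‖ ≤ Real.sqrt (|C₁| * (M + 1) ^ 2) := by
    intro k
    refine Real.le_sqrt_of_sq_le ?_
    rw [norm_sq_testToGraph]
    refine (hC₁ _ (hut k)).trans ?_
    refine mul_le_mul (le_abs_self _) (hE k) ?_ (abs_nonneg _)
    rw [← norm_sq_testToGraph]
    positivity
  set B := M + 1 + Real.sqrt (|C₁| * (M + 1) ^ 2) with hB
  have hwb : ∀ k, ‖D.testToGraph ⊤ (testInclusion U (w k))‖ ≤ B := fun k => by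
    rw [hwz, map_sub]
    exact (norm_sub_le _ _).trans (add_le_add (hnb k) (hzb k))
  -- `w k` is a test function on `U`, so that `q k` is orthogonal to its image
  have hpair : ∀ k, (inner ℂ (D.testToGraph ⊤ (u k)) (D.testToGraph ⊤ (testInclusion U (w k)))).re ≤
      1 / ((k : ℝ) + 1) * B := by
    intro k
    refine (re_inner_le_of_inner_eq_zero (horth k (w k)) _).trans ?_
    exact mul_le_mul (hu k).le (hwb k) (norm_nonneg _) (by positivity)
  have hmain : ∀ k, ‖testToL2 ⊤ (u k)‖ ^ 2 ≤ 2 * (1 / ((k : ℝ) + 1) * B) +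
      (2 * C₂ + 2) * ∫ x in tsupport χ, ‖(u k).1 x‖ ^ 2 ∂(riemannianVolume n X) := by
    intro k
    have h1 := hC₂ _ (hut k)
    have h2 := hpair k
    rw [D.inner_testToGraph] at h2
    have h3 := h1.trans (add_le_add_left h2 _)
    have hi := integrable_norm_sq (hut k)
    have hm := (isClosed_tsupport χ).measurableSet
    have hi1 : Integrable (fun x => (1 - χ x) ^ 2 * ‖(u k).1 x‖ ^ 2) (riemannianVolume n X) := by
      have h4 : Continuous fun x => (1 - χ x) ^ 2 * ‖(u k).1 x‖ ^ 2 :=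
        hgs.continuous.mul ((hut k).1.continuous.norm.pow 2)
      exact h4.integrable_of_hasCompactSupport
        (HasCompactSupport.intro (hut k).2.1 fun x hx => by
          simp [image_eq_zero_of_notMem_tsupport hx])
    have hi2 : Integrable ((tsupport χ).indicator fun x => ‖(u k).1 x‖ ^ 2)
        (riemannianVolume n X) :=
      hi.indicator hm
    have h4 : ∫ x, ‖(u k).1 x‖ ^ 2 ∂(riemannianVolume n X) ≤
        ∫ x, (2 * ((1 - χ x) ^ 2 * ‖(u k).1 x‖ ^ 2) +
          2 * (tsupport χ).indicator (fun x => ‖(u k).1 x‖ ^ 2) x) ∂(riemannianVolume n X) := by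
      refine integral_mono hi ((hi1.const_mul 2).add (hi2.const_mul 2)) fun x => ?_
      obtain ⟨h0, h1⟩ := hχI x
      by_cases hx : x ∈ tsupport χ
      · simp only [indicator_of_mem hx]
        nlinarith [mul_nonneg (sq_nonneg (1 - χ x)) (sq_nonneg ‖(u k).1 x‖), sq_nonneg ‖(u k).1 x‖]
      · simp only [indicator_of_notMem hx, image_eq_zero_of_notMem_tsupport hx]
        nlinarith [sq_nonneg ‖(u k).1 x‖]
    rw [integral_add (hi1.const_mul 2) (hi2.const_mul 2), integral_const_mul, integral_const_mul,
      integral_indicator hm] at h4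
    rw [norm_sq_testToL2]
    refine h4.trans ?_
    have h5 : (2 * C₂ + 2) * ∫ x in tsupport χ, ‖(u k).1 x‖ ^ 2 ∂(riemannianVolume n X) =
        2 * (C₂ * ∫ x in tsupport χ, ‖(u k).1 x‖ ^ 2 ∂(riemannianVolume n X)) +
          2 * ∫ x in tsupport χ, ‖(u k).1 x‖ ^ 2 ∂(riemannianVolume n X) := by ring
    rw [h5]
    linarith
  have hzero : Tendsto (fun k : ℕ => 2 * (1 / ((k : ℝ) + 1) * B) +
      (2 * C₂ + 2) * ∫ x in tsupport χ, ‖(u k).1 x‖ ^ 2 ∂(riemannianVolume n X)) atTop (𝓝 0) := by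
    have := ((hinv.mul_const B).const_mul 2).add ((hloc _ hχc).const_mul (2 * C₂ + 2))
    simpa using this
  have hsq := squeeze_zero (fun k => by positivity) hmain hzero
  have hL2 : Tendsto (fun k => testToL2 ⊤ (u k)) atTop (𝓝 0) := by
    rw [tendsto_zero_iff_norm_tendsto_zero]
    have := (Real.continuous_sqrt.tendsto 0).comp hsq
    rw [Real.sqrt_zero] at this
    exact this.congr fun k => Real.sqrt_sq (norm_nonneg _)
  have := hL2.sub hsub'
  simpa using this

end FirstOrderOperator

end Cut

end RiemannianCut

theorem propositionp {n : ℕ} {X : Type*} [TopologicalSpace X] [T2Space X]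
    [SecondCountableTopology X] [ChartedSpace (EuclideanSpace ℝ (Fin n)) X]
    [IsManifold (𝓡 n) ∞ X]
    [RiemannianBundle (fun x : X => TangentSpace (𝓡 n) x)]
    [IsContMDiffRiemannianBundle (𝓡 n) ∞ (EuclideanSpace ℝ (Fin n))
      (fun x : X => TangentSpace (𝓡 n) x)]
    [MeasurableSpace X] [BorelSpace X]
    (D : RiemannianCut.FirstOrderOperator n X) (hD : D.HasInjectiveSymbol)
    (K : Set X) (hK : IsCompact K) (hK' : RiemannianCut.IsCodimZeroSubmanifold n K)
    (X' : TopologicalSpace.Opens X) (hX' : (X' : Set X) = Kᶜ) :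
    (∀ U ∈ ({⊤, X'} : Set (TopologicalSpace.Opens X)),
      (D.minimal U).IsClosable ∧
      (D.formalLaplacian U).domain = (D.minimal U).domain ∧
      RiemannianCut.IsFriedrichsExtension (D.formalLaplacian U) (D.laplacian U)) ∧
    RiemannianCut.essSpectrum (D.laplacian ⊤) = RiemannianCut.essSpectrum (D.laplacian X') := by
  refine ⟨fun U _ => ⟨D.isClosable_minimal hD U,
    RiemannianCut.domain_compose_adjoint (D.minimal_mem_adjoint_domain hD U),
    RiemannianCut.isFriedrichsExtension_closure (D.dense_domain_minimal U)
        (D.isClosable_minimal hD U)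
      (D.minimal_mem_adjoint_domain hD U)⟩, ?_⟩
  have : Fact ((2 : ENNReal) ≠ ⊤) := ⟨by norm_num⟩
  obtain ⟨J, j, hj, hJ⟩ := D.exists_extension_by_zero hD X'
  refine RiemannianCut.essSpectrum_adjoint_comp_self_eq (D.isClosable_minimal hD ⊤).closure_isClosed
    (D.dense_domain_closed ⊤) (D.isClosable_minimal hD X').closure_isClosed
    (D.dense_domain_closed X') J j hJ fun q horth hbd hwk => ?_
  refine D.tendsto_graphFst_of_orthogonal hD hK hX' (fun k w => ?_) hbd hwk
  rw [← hj]
  exact horth k _
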